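/- **Setting.** Let $k_0\ge 2$, $d_1,\dots,d_{k_0}\ge 1$, $n_0=0$, $n_i=\sum_{j\le i}d_j$, $d=n_{k_0}$. For a vector $x$ of dimension at least $n_i$ let ${\bf x}_{n_i}$ be its first $n_i$ coordinates and ${\bf x}_{[n_{i-1}+1,n_i]}\in\mathbb R^{d_i}$ its $i$-th block. Let $\mu,\nu$ be Borel probability measures on $\mathbb R^d$, let $\mu_i,\nu_i$ be their images under $x\mapsto{\bf x}_{n_i}$, and let $\mu_i(d{\bf x}_{[n_{i-1}+1,n_i]}|{\bf x}_{n_{i-1}})$ be the regular conditional probability. For functions $p$ on $\mathbb R^d\times\mathbb R^d$ and $f_\nu$ on $\mathbb R^d$ put $p_i({\bf x}_{n_i},{\bf y}_{n_i})=\int_{\mathbb R^{d-n_i}}p(x,({\bf y}_{n_i},z))\,dz$ and $f_{\nu_i}({\bf y}_{n_i})=\int_{\mathbb R^{d-n_i}}f_\nu({\bf y}_{n_i},z)\,dz$ for $1\le i<k_0$, and $p_{k_0}=p$, $f_{\nu_{k_0}}=f_\nu$. **Assumptions.** (A0) (i) $p:\mathbb R^d\times\mathbb R^d\to(0,\infty)$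 is continuous and $\int p(x,y)\,dy=1$ for all $x$; for $1\le i<k_0$ the integral defining $p_i$ is finite everywhere, does not depend on $(x_j)_{j>n_i}$, and is continuous in $({\bf x}_{n_i},{\bf y}_{n_i})$. (ii), (iii) For $1\le i\le k_0$ there is a continuous $\psi_i:\mathbb R^{d_i}\to\mathbb R$ such that $y\mapsto\log p_i({\bf x}_{n_i},({\bf y}_{n_{i-1}},y))+\psi_i(y)$ is convex on $\mathbb R^{d_i}$ for all ${\bf x}_{n_i}\in\mathbb R^{n_i}$, ${\bf y}_{n_{i-1}}\in\mathbb R^{n_{i-1}}$ (no ${\bf y}_{n_0}$ if $i=1$). (A1) $\nu$ has a density $f_\nu\ge0$, and $f_{\nu_i}$ is finite everywhere and continuous for $1\le i\le k_0$. **Notation.** For $i\ge 2$ let $p_i({\bf x}_{n_i},y|{\bf y}_{n_{i-1}})=p_i({\bf x}_{n_i},({\bf y}_{n_{i-1}},y))/\int_{\mathbb R^{d_i}}p_i({\bf x}_{n_i},({\bf y}_{n_{i-1}},z))\,dz$. For $\tilde\pi$ on $\mathbb R^{n_{i-1}}\times\mathbb R^{n_{i-1}}$ let $$\tilde\pi\otimes\mu_{i|i-1}(d{\bf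 x}_{n_i}\,d{\bf y}_{n_{i-1}})=\tilde\pi(d{\bf x}_{n_{i-1}}\,d{\bf y}_{n_{i-1}})\,\mu_i(d{\bf x}_{[n_{i-1}+1,n_i]}|{\bf x}_{n_{i-1}}),$$ let $R_i(\tilde\pi)=\tilde\pi\otimes\mu_{i|i-1}(d{\bf x}_{n_i}\,d{\bf y}_{n_{i-1}})\,p_i({\bf x}_{n_i},{\bf y}_{[n_{i-1}+1,n_i]}|{\bf y}_{n_{i-1}})\,d{\bf y}_{[n_{i-1}+1,n_i]}$, let $\mathcal A(\mu_i,\nu_i;\tilde\pi)$ be the set of probability measures $\pi$ on $\mathbb R^{n_i}\times\mathbb R^{n_i}$ with marginals $\mu_i,\nu_i$ and $\pi(d{\bf x}_{n_i}\,d{\bf y}_{n_{i-1}}\times\mathbb R^{d_i})=\tilde\pi\otimes\mu_{i|i-1}$, and let $V_i(\mu_i,\nu_i;\tilde\pi)=\inf\{H(\pi\|R_i(\tilde\pi)):\pi\in\mathcal A(\mu_i,\nu_i;\tilde\pi)\}$, with $H$ the relative entropy. For measurable $h_j:\mathbb R^{n_j}\to[0,\infty)$ let $h_j(0,{\bf x}_{n_j},{\bf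 y}_{n_{j-1}})=\int_{\mathbb R^{d_j}}h_j({\bf y}_{n_{j-1}},z)p_j({\bf x}_{n_j},({\bf y}_{n_{j-1}},z))\,dz$ and define inductively $$\pi_{\mu_1,\nu_1}=\frac{h_1({\bf y}_{n_1})p_1({\bf x}_{n_1},{\bf y}_{n_1})}{h_1(0,{\bf x}_{n_1})}\mu_1(d{\bf x}_{n_1})\,d{\bf y}_{n_1},\qquad \pi_{0,i}=R_i(\pi_{\mu_{i-1},\nu_{i-1}}),$$ $$\pi_{\mu_i,\nu_i}=\frac{h_i({\bf y}_{n_i})}{\int h_i({\bf y}_{n_{i-1}},z)p_i({\bf x}_{n_i},z|{\bf y}_{n_{i-1}})\,dz}\,\pi_{0,i}\quad(i\ge2),$$ $$\pi_{\mu_i,\nu_i}({\bf y}_{n_i},d{\bf x}_{n_i})=\frac1{f_{\nu_i}({\bf y}_{n_i})}\prod_{j=1}^i\frac{h_j({\bf y}_{n_j})p_j({\bf x}_{n_j},{\bf y}_{n_j})}{h_j(0,{\bf x}_{n_j},{\bf y}_{n_{j-1}})}\,\mu_i(d{\bf x}_{n_i})\quad\text{if } f_{\nu_i}({\bf y}_{n_i})>0,$$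 $$\pi_{\mu_{i-1},\nu_{i-1}}\otimes\mu_{i|i-1}({\bf y}_{n_{i-1}},d{\bf x}_{n_i})=\pi_{\mu_{i-1},\nu_{i-1}}({\bf y}_{n_{i-1}},d{\bf x}_{n_{i-1}})\,\mu_i(d{\bf x}_{[n_{i-1}+1,n_i]}|{\bf x}_{n_{i-1}}).$$ **Theorem.** Assume (A0) and (A1). The Schrödinger functional equation $$f_{\nu_1}(y)\,dy=h_1(y)\,dy\int_{\mathbb R^{d_1}}\frac{p_1(x,y)}{\int h_1(z)p_1(x,z)\,dz}\,\mu_1(dx)\tag{1}$$ has a continuous solution $h_1:\mathbb R^{d_1}\to[0,\infty)$. Let $h_1:\mathbb R^{d_1}\to[0,\infty)$ be any measurable solution of (1). Then there are measurable $h_i:\mathbb R^{n_i}\to[0,\infty)$, $i=2,\dots,k_0$, such that for every $i=2,\dots,k_0$: (a) for $f_{\nu_{i-1}}({\bf y}_{n_{i-1}})d{\bf y}_{n_{i-1}}$-a.e. ${\bf y}_{n_{i-1}}$, as measures in $y\in\mathbb R^{d_i}$, $$\frac{f_{\nu_i}({\bf y}_{n_{i-1}},y)}{f_{\nu_{i-1}}({\bf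 y}_{n_{i-1}})}\,dy=h_i({\bf y}_{n_{i-1}},y)\,dy\int_{\mathbb R^{n_i}}\frac{p_i(x,y|{\bf y}_{n_{i-1}})}{\int h_i({\bf y}_{n_{i-1}},z)p_i(x,z|{\bf y}_{n_{i-1}})\,dz}\,\pi_{\mu_{i-1},\nu_{i-1}}\otimes\mu_{i|i-1}({\bf y}_{n_{i-1}},dx);$$ (b) $h_i({\bf y}_{n_{i-1}},\cdot)$ is continuous on $\mathbb R^{d_i}$ for every ${\bf y}_{n_{i-1}}$; (c) $h=h_i$ is a solution of $$f_{\nu_i}({\bf y}_{n_i})\,d{\bf y}_{n_i}=h({\bf y}_{n_i})\int_{x\in\mathbb R^{n_i}}\frac{1}{\int h({\bf y}_{n_{i-1}},z)p_i(x,z|{\bf y}_{n_{i-1}})\,dz}\,\pi_{0,i}(dx\,d{\bf y}_{n_i}),\tag{2}$$ and it is unique up to a multiplicative measurable function of ${\bf y}_{n_{i-1}}$: a measurable $g:\mathbb R^{n_i}\to[0,\infty)$ solves (2) if and only if there is a measurable $\varphi:\mathbb R^{n_{i-1}}\to(0,\infty)$ with $g({\bf y}_{n_i})=\varphi({\bf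 y}_{n_{i-1}})h_i({\bf y}_{n_i})$ for Lebesgue-a.e. ${\bf y}_{n_i}$ with $f_{\nu_{i-1}}({\bf y}_{n_{i-1}})>0$; (d) $$\pi_{\mu_i,\nu_i}(d{\bf x}_{n_i}\,d{\bf y}_{n_i})=\prod_{j=1}^i\frac{h_j({\bf y}_{n_j})p_j({\bf x}_{n_j},{\bf y}_{n_j})}{h_j(0,{\bf x}_{n_j},{\bf y}_{n_{j-1}})}\,\mu_i(d{\bf x}_{n_i})\,d{\bf y}_{n_i}\in\mathcal A(\mu_i,\nu_i;\pi_{\mu_{i-1},\nu_{i-1}});$$ (e) if $V_i(\mu_i,\nu_i;\pi_{\mu_{i-1},\nu_{i-1}})<\infty$, then $\pi_{\mu_i,\nu_i}$ is its unique minimizer. -/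

import Mathlib

open MeasureTheory InformationTheory
open scoped ENNReal NNReal ProbabilityTheory

namespace CondSchrodinger

noncomputable section

/-- `n_i = d_1 + ⋯ + d_i`. -/
def nn (d : ℕ → ℕ) : ℕ → ℕ
  | 0 => 0
  | i + 1 => nn d i + d (i + 1)

/-- `ℝ^{n_i}`. Only its topology, Borel structure, linear structure and Lebesgue measure matter. -/
abbrev E (d : ℕ → ℕ) (i : ℕ) : Type := Fin (nn d i) → ℝ

/-- `ℝ^{d_i}`, the space of the `i`-th block. -/
abbrev B (d : ℕ → ℕ) (i : ℕ) : Type := Fin (d i) → ℝ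

/-- The first `m` coordinates of `x` if `m ≤ N`; otherwise `x` extended by zeros. -/
def coords {N : ℕ} (m : ℕ) (x : Fin N → ℝ) : Fin m → ℝ :=
  fun k => if hk : k.1 < N then x ⟨k.1, hk⟩ else 0

/-- The vector `(y, z) ∈ ℝ^N` with first `m` coordinates `y` and remaining `N - m` ones `z`. -/
def glue {m N : ℕ} (y : Fin m → ℝ) (z : Fin (N - m) → ℝ) : Fin N → ℝ :=
  fun k => if hk : k.1 < m then y ⟨k.1, hk⟩ else z ⟨k.1 - m, by omega⟩

variable {d : ℕ → ℕ} {k₀ : ℕ}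

/-- `(y', y'') ∈ ℝ^{n_{i+1}}` for `y' ∈ ℝ^{n_i}`, `y'' ∈ ℝ^{d_{i+1}}`. -/
def join {i : ℕ} (y' : E d i) (y'' : B d (i + 1)) : E d (i + 1) :=
  Fin.append y' y''

/-- The part in `ℝ^{n_i}` of a vector of `ℝ^{n_{i+1}}`. -/
def head {i : ℕ} (y : E d (i + 1)) : E d i :=
  fun k => y (Fin.castAdd (d (i + 1)) k)

/-- The last block, in `ℝ^{d_{i+1}}`, of a vector of `ℝ^{n_{i+1}}`. -/
def lastBlock {i : ℕ} (y : E d (i + 1)) : B d (i + 1) :=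
  fun k => y (Fin.natAdd (nn d i) k)

/-- `∫ p(x, (y, z)) dz` over the coordinates `z` after the first `n_i`, with the full
variable `x ∈ ℝ^d`. -/
def pFull (p : E d k₀ → E d k₀ → ℝ) (i : ℕ) (x : E d k₀) (y : E d i) : ℝ :=
  ∫ z : Fin (nn d k₀ - nn d i) → ℝ, p x (glue y z)

/-- `p_i(x, y)` for `x, y ∈ ℝ^{n_i}`. The kernels considered are such that `pFull p i x y` depends
on the first `n_i` coordinates of `x` only, so that the others may be set to zero. For `i = k₀` the
integral is over a one-point space of mass one, and `p_{k₀} = p`. -/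
def pm (p : E d k₀ → E d k₀ → ℝ) (i : ℕ) (x y : E d i) : ℝ :=
  pFull p i (coords (nn d k₀) x) y

/-- `p_{i+1}(x, y'' | y')`. -/
def pCond (p : E d k₀ → E d k₀ → ℝ) (i : ℕ) (x : E d (i + 1)) (y'' : B d (i + 1)) (y' : E d i) :
    ℝ≥0∞ :=
  ENNReal.ofReal (pm p (i + 1) x (join y' y'')) /
    ∫⁻ z : B d (i + 1), ENNReal.ofReal (pm p (i + 1) x (join y' z))

/-- The marginal density `f_{ν_i}`. -/
def fm (f : E d k₀ → ℝ) (i : ℕ) (y : E d i) : ℝ :=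
  ∫ z : Fin (nn d k₀ - nn d i) → ℝ, f (glue y z)

/-- Assumptions on the kernel `p`. The field `convex` for `i = 0` is the assumption on the first
block (where `ℝ^{n_0}` is a point). -/
structure A0 (p : E d k₀ → E d k₀ → ℝ) : Prop where
  cont : Continuous fun q : E d k₀ × E d k₀ => p q.1 q.2
  pos : ∀ x y, 0 < p x y
  prob : ∀ x, ∫⁻ y, ENNReal.ofReal (p x y) = 1
  marg_finite : ∀ i, 1 ≤ i → i < k₀ → ∀ (x : E d k₀) (y : E d i),
    Integrable fun z : Fin (nn d k₀ - nn d i) → ℝ => p x (glue y z)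
  marg_indep : ∀ i, 1 ≤ i → i < k₀ → ∀ x x' : E d k₀,
    coords (nn d i) x = coords (nn d i) x' → ∀ y : E d i, pFull p i x y = pFull p i x' y
  marg_cont : ∀ i, 1 ≤ i → i < k₀ → Continuous fun q : E d i × E d i => pm p i q.1 q.2
  convex : ∀ i, i < k₀ → ∃ ψ : B d (i + 1) → ℝ, Continuous ψ ∧
    ∀ (x : E d (i + 1)) (y' : E d i),
      ConvexOn ℝ Set.univ fun y'' : B d (i + 1) => Real.log (pm p (i + 1) x (join y' y'')) + ψ y''

/-- Assumptions on the terminal law `ν`, with density `f`. -/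
structure A1 (ν : Measure (E d k₀)) (f : E d k₀ → ℝ) : Prop where
  nonneg : ∀ y, 0 ≤ f y
  density : ν = volume.withDensity fun y => ENNReal.ofReal (f y)
  cont : Continuous f
  marg_finite : ∀ i, 1 ≤ i → i < k₀ → ∀ y : E d i,
    Integrable fun z : Fin (nn d k₀ - nn d i) → ℝ => f (glue y z)
  marg_cont : ∀ i, 1 ≤ i → i < k₀ → Continuous (fm f i)

/-- The marginal `μ_i` on `ℝ^{n_i}`. -/
def marg (μ : Measure (E d k₀)) (i : ℕ) : Measure (E d i) :=
  μ.map (coords (nn d i))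

instance (μ : Measure (E d k₀)) [IsProbabilityMeasure μ] (i : ℕ) : IsFiniteMeasure (marg μ i) := by
  unfold marg; infer_instance

/-- `μ_{i+1}(dx'' | x')`, the regular conditional probability of the last block given `ℝ^{n_i}`. -/
def condLast (μ : Measure (E d k₀)) [IsProbabilityMeasure μ] (i : ℕ) :
    ProbabilityTheory.Kernel (E d i) (B d (i + 1)) :=
  ((marg μ (i + 1)).map fun x => (head x, lastBlock x)).condKernel

/-- `(π̃ ⊗ μ_{i+1|i})(dx dy') = π̃(dx' dy') μ_{i+1}(dx'' | x')` on `ℝ^{n_{i+1}} × ℝ^{n_i}`. -/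
def otimes (μ : Measure (E d k₀)) [IsProbabilityMeasure μ] {i : ℕ} (π : Measure (E d i × E d i)) :
    Measure (E d (i + 1) × E d i) :=
  (π ⊗ₘ (condLast μ i).comap Prod.fst measurable_fst).map
    fun q => (join q.1.1 q.2, q.1.2)

/-- `(π̃ ⊗ μ_{i+1|i})(dx dy') p_{i+1}(x, y'' | y') dy''` on `ℝ^{n_{i+1}} × ℝ^{n_{i+1}}`. -/
def refMeas (p : E d k₀ → E d k₀ → ℝ) (μ : Measure (E d k₀)) [IsProbabilityMeasure μ] {i : ℕ}
    (π : Measure (E d i × E d i)) : Measure (E d (i + 1) × E d (i + 1)) :=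
  (((otimes μ π).prod (volume : Measure (B d (i + 1)))).withDensity
    fun q => pCond p i q.1.1 q.2 q.1.2).map fun q => (q.1.1, join q.1.2 q.2)

/-- Couplings: `𝒜(P, Q)`. -/
def couplings {α β : Type*} [MeasurableSpace α] [MeasurableSpace β] (P : Measure α)
    (Q : Measure β) : Set (Measure (α × β)) :=
  {π | IsProbabilityMeasure π ∧ π.map Prod.fst = P ∧ π.map Prod.snd = Q}

/-- `𝒜(μ_{i+1}, ν_{i+1}; π̃)`. -/
def constrained (μ ν : Measure (E d k₀)) [IsProbabilityMeasure μ] {i : ℕ}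
    (π' : Measure (E d i × E d i)) : Set (Measure (E d (i + 1) × E d (i + 1))) :=
  {π | π ∈ couplings (marg μ (i + 1)) (marg ν (i + 1)) ∧
    π.map (fun q => (q.1, head q.2)) = otimes μ π'}

/-- `V_{i+1}(μ_{i+1}, ν_{i+1}; π̃)`; `klDiv` is the relative entropy. -/
def V (p : E d k₀ → E d k₀ → ℝ) (μ ν : Measure (E d k₀)) [IsProbabilityMeasure μ] {i : ℕ}
    (π' : Measure (E d i × E d i)) : ℝ≥0∞ :=
  ⨅ π ∈ constrained μ ν π', klDiv π (refMeas p μ π')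

/-- `∫ h(y', z) p_{i+1}(x, z | y') dz`. -/
def condNorm (p : E d k₀ → E d k₀ → ℝ) {i : ℕ} (h : E d (i + 1) → ℝ≥0) (x : E d (i + 1))
    (y' : E d i) : ℝ≥0∞ :=
  ∫⁻ z : B d (i + 1), (h (join y' z) : ℝ≥0∞) * pCond p i x z y'

/-- `h(0, x, y') = ∫ h(y', z) p_{i+1}(x, (y', z)) dz`. -/
def hZero (p : E d k₀ → E d k₀ → ℝ) {i : ℕ} (h : E d (i + 1) → ℝ≥0) (x : E d (i + 1))
    (y' : E d i) : ℝ≥0∞ :=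
  ∫⁻ z : B d (i + 1), (h (join y' z) : ℝ≥0∞) * ENNReal.ofReal (pm p (i + 1) x (join y' z))

/-- The Schrödinger functional equation for the first block, as an equality of measures. -/
def SFE₁ (p : E d k₀ → E d k₀ → ℝ) (μ : Measure (E d k₀)) (f : E d k₀ → ℝ)
    (h₁ : E d 1 → ℝ≥0) : Prop :=
  (volume.withDensity fun y : E d 1 => ENNReal.ofReal (fm f 1 y)) =
    volume.withDensity fun y : E d 1 => (h₁ y : ℝ≥0∞) *
      ∫⁻ x, ENNReal.ofReal (pm p 1 x y) /
        (∫⁻ z : E d 1, (h₁ z : ℝ≥0∞) * ENNReal.ofReal (pm p 1 x z)) ∂(marg μ 1)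

/-- `π_{μ_i,ν_i}`, defined inductively from `h_1, …, h_i` for `i ≥ 1` (the value at `0` is
irrelevant). -/
def piMeas (p : E d k₀ → E d k₀ → ℝ) (μ : Measure (E d k₀)) [IsProbabilityMeasure μ]
    (h : ∀ i, E d i → ℝ≥0) : ∀ i, Measure (E d i × E d i)
  | 0 => 0
  | 1 => ((marg μ 1).prod volume).withDensity fun q =>
      (h 1 q.2 : ℝ≥0∞) / (∫⁻ z : E d 1, (h 1 z : ℝ≥0∞) * ENNReal.ofReal (pm p 1 q.1 z)) *
        ENNReal.ofReal (pm p 1 q.1 q.2)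
  | i + 2 => (refMeas p μ (piMeas p μ h (i + 1))).withDensity fun q =>
      (h (i + 2) q.2 : ℝ≥0∞) / condNorm p (h (i + 2)) q.1 (head q.2)

/-- `∏_{j=1}^{i} h_j(y_{n_j}) p_j(x_{n_j}, y_{n_j}) / h_j(0, x_{n_j}, y_{n_{j-1}})`; the index `j`
below is shifted by one. -/
def prodDensity (p : E d k₀ → E d k₀ → ℝ) (h : ∀ i, E d i → ℝ≥0) (i : ℕ) (x y : E d i) : ℝ≥0∞ :=
  ∏ j ∈ Finset.range i,
    (h (j + 1) (coords _ y) : ℝ≥0∞) * ENNReal.ofReal (pm p (j + 1) (coords _ x) (coords _ y)) /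
      hZero p (h (j + 1)) (coords _ x) (coords _ y)

/-- `π_{μ_i,ν_i}(y, dx)` on `ℝ^{n_i}` (used where `f_{ν_i}(y) > 0`). -/
def piKer (p : E d k₀ → E d k₀ → ℝ) (μ : Measure (E d k₀)) (f : E d k₀ → ℝ)
    (h : ∀ i, E d i → ℝ≥0) (i : ℕ) (y : E d i) : Measure (E d i) :=
  (marg μ i).withDensity fun x => (ENNReal.ofReal (fm f i y))⁻¹ * prodDensity p h i x y

/-- `(π_{μ_i,ν_i} ⊗ μ_{i+1|i})(y', dx)` on `ℝ^{n_{i+1}}`. -/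
def piKerOtimes (p : E d k₀ → E d k₀ → ℝ) (μ : Measure (E d k₀)) [IsProbabilityMeasure μ]
    (f : E d k₀ → ℝ) (h : ∀ i, E d i → ℝ≥0) (i : ℕ) (y' : E d i) : Measure (E d (i + 1)) :=
  (piKer p μ f h i y' ⊗ₘ condLast μ i).map fun q => join q.1 q.2

/-- The conditional Schrödinger functional equation for `h_{i+1}` at the point `y' ∈ ℝ^{n_i}`. -/
def CondSFE (p : E d k₀ → E d k₀ → ℝ) (μ : Measure (E d k₀)) [IsProbabilityMeasure μ]
    (f : E d k₀ → ℝ) (h : ∀ i, E d i → ℝ≥0) (i : ℕ) (y' : E d i) : Prop :=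
  (volume.withDensity fun y'' : B d (i + 1) =>
      ENNReal.ofReal (fm f (i + 1) (join y' y'') / fm f i y')) =
    volume.withDensity fun y'' : B d (i + 1) => (h (i + 1) (join y' y'') : ℝ≥0∞) *
      ∫⁻ x, pCond p i x y'' y' / condNorm p (h (i + 1)) x y' ∂(piKerOtimes p μ f h i y')

/-- The functional equation for `g = h_{i+1}` given `h_1, …, h_i`:
`f_{ν_{i+1}}(y) dy = g(y) ∫_x (∫ g(y', z) p_{i+1}(x, z | y') dz)⁻¹ π_{0,i+1}(dx dy)`. -/
def FunEq (p : E d k₀ → E d k₀ → ℝ) (μ : Measure (E d k₀)) [IsProbabilityMeasure μ]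
    (f : E d k₀ → ℝ) (h : ∀ i, E d i → ℝ≥0) (i : ℕ) (g : E d (i + 1) → ℝ≥0) : Prop :=
  (volume.withDensity fun y : E d (i + 1) => ENNReal.ofReal (fm f (i + 1) y)) =
    (((refMeas p μ (piMeas p μ h i)).withDensity fun q =>
      (condNorm p g q.1 (head q.2))⁻¹).map Prod.snd).withDensity fun y => (g y : ℝ≥0∞)

end

end CondSchrodinger

open CondSchrodinger

/-! The whole statement reduces to one Schrödinger problem depending on a parameter. Let D be the
density of the level-i coupling with respect to μ_i ⊗ dy. Given t in ℝ^{n_i} with f_{ν_i}(t) > 0,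
the law of x in ℝ^{n_{i+1}} is D(x', t) μ_{i+1}(dx) / f_{ν_i}(t), where x' is the part of x in
ℝ^{n_i}, and the target density of the next block is f_{ν_{i+1}}(t, ·) / f_{ν_i}(t). The
normalisation of p_{i+1}(x, · | t) is p_i(x', t), which cancels in every quotient
(`A0.pCond_div_condNorm`), so p_{i+1}(x, (t, ·)) serves as the kernel. Hence (a) and (c) are two
readings of one family of equations (`jointSol_iff`, `funEq_iff_jointSol`). A solution multiplies D
by h p / h(0, ·), and integrating out the last block gives D back, so the result is a coupling
density one level up (`isCouplingDensity_nextDensity`). Equation (1) is the case of a one-point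
parameter space with D = 1 (`sfe_iff_jointSol`).

Existence must do without finite entropy. For a kernel 0 < k ≤ 1 and c = 1 - δ < 1, the equation u =
1 + c S(u), with S the Sinkhorn step, is solved by monotone iteration. The density k(x, y) u(x)⁻¹
b(y), b being the matching factor in y, is then a coupling up to total mass δ. Two approximate
couplings of this product form are close in L¹: the set where φ' is large relative to φ, times the
set where b' is large relative to b, and the product of the complements, have masses whose
difference is fixed by the marginals, while the product form makes both discrepancies have the same
sign (`lintegral_sub_prodForm_le`). So as δ → 0 the densities are Cauchy. A limit of rank-one
factors is rank one, and its marginals are exact (`exists_factors_of_tendsto`). The approximants are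
jointly measurable in the parameter, and so is the solution extracted from the limit
(`exists_measurable_solution`). A positive continuous kernel is brought into this range by dividing
by a product of functions of the norms (`exists_solution_of_continuous`).

Continuity in the last block comes from convexity: exp(ψ) k(x, ·) is convex for each x, so exp(ψ) ∫
k / u is convex, hence continuous where finite, and Fatou's lemma handles the zeros of f
(`continuous_div_lintegral_kernel`).

Uniqueness tests the difference of two couplings against a bounded sum of a function of x and a
function of y, built so that the integrand is a square times a positive weight
(`IsSchrodingerSol.unique`).

Minimality is the Pythagorean identity for the relative entropy. The density with respect to the
reference measure is a product of functions of (x, y') and of y, both of whose laws are prescribed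
by the constraints. As the logarithms need not be integrable, they are truncated, and Fatou's lemma
removes the truncation (`lintegral_klFun_add_le`, `klDiv_withDensity_mul_le`). -/

/-! ### Approximate solutions by monotone iteration -/

namespace CondSchrodinger

open Filter Topology

section Approximants

variable {X Y : Type*} [MeasurableSpace X] [MeasurableSpace Y]

/-- One step of the Fortet-Sinkhorn iteration for the potential `u`. -/
noncomputable def sinkhornStep (P : Measure X) (Q : Measure Y) (k : X → Y → ℝ≥0∞) (u : X → ℝ≥0∞)
    (x : X) : ℝ≥0∞ :=
  ∫⁻ y, k x y * (∫⁻ z, k z y * (u z)⁻¹ ∂P)⁻¹ ∂Q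

/-- The iterates of `u ↦ 1 + c * sinkhornStep u`, started at `1`. -/
noncomputable def potIter (P : Measure X) (Q : Measure Y) (k : X → Y → ℝ≥0∞) (c : ℝ≥0∞) :
    ℕ → X → ℝ≥0∞
  | 0 => fun _ => 1
  | n + 1 => fun x => 1 + c * sinkhornStep P Q k (potIter P Q k c n) x

/-- The smallest solution of `u = 1 + c * sinkhornStep u`. -/
noncomputable def pot (P : Measure X) (Q : Measure Y) (k : X → Y → ℝ≥0∞) (c : ℝ≥0∞) (x : X) :
    ℝ≥0∞ :=
  ⨆ n, potIter P Q k c n x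

variable {P : Measure X} {Q : Measure Y} {k : X → Y → ℝ≥0∞} {c : ℝ≥0∞} {u v : X → ℝ≥0∞}

/-- The potential enters through two nested reciprocals, so the step preserves order; the monotone
iteration rests on this. -/
lemma sinkhornStep_mono (h : u ≤ v) (x : X) : sinkhornStep P Q k u x ≤ sinkhornStep P Q k v x := by
  unfold sinkhornStep
  gcongr with y z
  exact h z

lemma monotone_potIter : Monotone (potIter P Q k c) := by
  refine monotone_nat_of_le_succ fun n => ?_
  induction n with
  | zero => intro x; simp [potIter]
  | succ n ih =>
    intro x
    simp only [potIter]
    gcongr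
    exact sinkhornStep_mono ih x

lemma one_le_potIter (n : ℕ) (x : X) : 1 ≤ potIter P Q k c n x := by
  have := monotone_potIter (P := P) (Q := Q) (k := k) (c := c) (Nat.zero_le n) x
  simpa [potIter] using this

lemma one_le_pot (x : X) : 1 ≤ pot P Q k c x :=
  (one_le_potIter 0 x).trans (le_iSup (fun n => potIter P Q k c n x) 0)

lemma measurable_sinkhornStep [SFinite P] [SFinite Q] (hk : Measurable (Function.uncurry k))
    (hu : Measurable u) : Measurable (sinkhornStep P Q k u) := by
  unfold sinkhornStep
  have h1 : Measurable fun y => ∫⁻ z, k z y * (u z)⁻¹ ∂P := by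
    refine Measurable.lintegral_prod_right' (f := fun q : Y × X => k q.2 q.1 * (u q.2)⁻¹) ?_
    exact (hk.comp measurable_swap).mul (hu.comp measurable_snd).inv
  refine Measurable.lintegral_prod_right' (f := fun q : X × Y => k q.1 q.2 *
    (∫⁻ z, k z q.2 * (u z)⁻¹ ∂P)⁻¹) ?_
  exact hk.mul (h1.comp measurable_snd).inv

lemma measurable_potIter [SFinite P] [SFinite Q] (hk : Measurable (Function.uncurry k)) (n : ℕ) :
    Measurable (potIter P Q k c n) := by
  induction n with
  | zero => exact measurable_const
  | succ n ih => exact ((measurable_sinkhornStep hk ih).const_mul c).const_add 1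

lemma measurable_pot [SFinite P] [SFinite Q] (hk : Measurable (Function.uncurry k)) :
    Measurable (pot P Q k c) :=
  Measurable.iSup fun n => measurable_potIter hk n

omit [MeasurableSpace Y] in
lemma lintegral_inv_mul_le_one [IsProbabilityMeasure P] (hk1 : ∀ x y, k x y ≤ 1)
    (hu1 : ∀ x, 1 ≤ u x) (y : Y) : ∫⁻ z, k z y * (u z)⁻¹ ∂P ≤ 1 := by
  calc ∫⁻ z, k z y * (u z)⁻¹ ∂P ≤ ∫⁻ _, 1 ∂P := by
        refine lintegral_mono fun z => ?_
        exact mul_le_one' (hk1 z y) (ENNReal.inv_le_one.2 (hu1 z))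
    _ = 1 := by simp

/-- Monotone convergence twice: the inner integrals decrease, which is harmless since k ≤ 1 and u ≥
1 bound them by 1, and the outer integrals of their reciprocals increase. -/
lemma pot_eq [IsProbabilityMeasure P] [SFinite Q] (hk : Measurable (Function.uncurry k))
    (hk1 : ∀ x y, k x y ≤ 1) (x : X) :
    pot P Q k c x = 1 + c * sinkhornStep P Q k (pot P Q k c) x := by
  have hm := fun n => measurable_potIter (P := P) (Q := Q) (c := c) hk n
  have hkm : ∀ y, Measurable fun z => k z y := fun y => hk.comp measurable_prodMk_right
  have hN : ∀ y, ∫⁻ z, k z y * (pot P Q k c z)⁻¹ ∂P =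
      ⨅ n, ∫⁻ z, k z y * (potIter P Q k c n z)⁻¹ ∂P := by
    intro y
    have hkm' := hkm y
    rw [← lintegral_iInf (f := fun n z => k z y * (potIter P Q k c n z)⁻¹) (fun n => by fun_prop)]
    · refine lintegral_congr fun z => ?_
      rw [pot, ENNReal.inv_iSup, ENNReal.mul_iInf]
      exact fun h => absurd (h ▸ hk1 z y) (by simp)
    · intro m n hmn z
      have := monotone_potIter (P := P) (Q := Q) (k := k) (c := c) hmn z
      simp only
      gcongr
    · exact ((lintegral_inv_mul_le_one hk1 (one_le_potIter 0) y).trans_lt ENNReal.one_lt_top).ne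
  have hS : sinkhornStep P Q k (pot P Q k c) x = ⨆ n, sinkhornStep P Q k (potIter P Q k c n) x := by
    unfold sinkhornStep
    rw [← lintegral_iSup]
    · refine lintegral_congr fun y => ?_
      rw [hN, ENNReal.inv_iInf, ENNReal.mul_iSup]
    · intro n
      have h1 : Measurable fun y => ∫⁻ z, k z y * (potIter P Q k c n z)⁻¹ ∂P := by
        refine Measurable.lintegral_prod_right' (f := fun q : Y × X =>
          k q.2 q.1 * (potIter P Q k c n q.2)⁻¹) ?_
        exact (hk.comp measurable_swap).mul ((hm n).comp measurable_snd).inv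
      exact (hk.comp measurable_prodMk_left).mul h1.inv
    · intro m n hmn y
      have := monotone_potIter (P := P) (Q := Q) (k := k) (c := c) hmn
      simp only
      gcongr with z
      exact this z
  rw [hS, ENNReal.mul_iSup, ENNReal.add_iSup]
  unfold pot
  refine le_antisymm (iSup_le fun n => ?_) (iSup_le fun n => ?_)
  · refine (monotone_potIter (Nat.le_succ n) x).trans ?_
    exact le_iSup (fun n => 1 + c * sinkhornStep P Q k (potIter P Q k c n) x) n
  · exact le_iSup (fun n => potIter P Q k c n x) (n + 1)

/-- Summing a step of the iteration against `u⁻¹`. -/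
lemma lintegral_inv_mul_sinkhornStep [SFinite P] [SFinite Q] (hk : Measurable (Function.uncurry k))
    (hu : Measurable u) :
    ∫⁻ x, (u x)⁻¹ * sinkhornStep P Q k u x ∂P =
      ∫⁻ y, (∫⁻ z, k z y * (u z)⁻¹ ∂P) * (∫⁻ z, k z y * (u z)⁻¹ ∂P)⁻¹ ∂Q := by
  have h1 : Measurable fun y => ∫⁻ z, k z y * (u z)⁻¹ ∂P := by
    refine Measurable.lintegral_prod_right' (f := fun q : Y × X => k q.2 q.1 * (u q.2)⁻¹) ?_
    exact (hk.comp measurable_swap).mul (hu.comp measurable_snd).inv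
  calc ∫⁻ x, (u x)⁻¹ * sinkhornStep P Q k u x ∂P
      = ∫⁻ x, ∫⁻ y, (u x)⁻¹ * (k x y * (∫⁻ z, k z y * (u z)⁻¹ ∂P)⁻¹) ∂Q ∂P := by
        refine lintegral_congr fun x => ?_
        rw [sinkhornStep, lintegral_const_mul]
        exact (hk.comp measurable_prodMk_left).mul h1.inv
    _ = ∫⁻ y, ∫⁻ x, (u x)⁻¹ * (k x y * (∫⁻ z, k z y * (u z)⁻¹ ∂P)⁻¹) ∂P ∂Q := by
        refine lintegral_lintegral_swap (Measurable.aemeasurable ?_)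
        exact (hu.comp measurable_fst).inv.mul (hk.mul (h1.comp measurable_snd).inv)
    _ = _ := by
        refine lintegral_congr fun y => ?_
        rw [← lintegral_mul_const _ (by fun_prop)]
        refine lintegral_congr fun x => ?_
        ring

/-- With N(y) = ∫ k / u dP the integral equals ∫ N N⁻¹ dQ, and N N⁻¹ is 1 except where N is 0 or ∞,
where it is 0. -/
lemma lintegral_inv_mul_sinkhornStep_le_one [SFinite P] [IsProbabilityMeasure Q]
    (hk : Measurable (Function.uncurry k)) (hu : Measurable u) :
    ∫⁻ x, (u x)⁻¹ * sinkhornStep P Q k u x ∂P ≤ 1 := by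
  rw [lintegral_inv_mul_sinkhornStep hk hu]
  calc _ ≤ ∫⁻ _, 1 ∂Q := lintegral_mono fun y => ENNReal.mul_inv_le_one _
    _ = 1 := by simp

variable [IsProbabilityMeasure P] [IsProbabilityMeasure Q] {δ : ℝ≥0∞}

/-- Induction: u⁻¹ S(u) is integrable and u is finite almost everywhere, so S(u) is finite almost
everywhere. -/
lemma potIter_lt_top (hk : Measurable (Function.uncurry k)) (hc : c ≠ ∞) (n : ℕ) :
    ∀ᵐ x ∂P, potIter P Q k c n x < ∞ := by
  induction n with
  | zero => simp [potIter]
  | succ n ih =>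
    have h := lintegral_inv_mul_sinkhornStep_le_one (P := P) (Q := Q) hk
      (measurable_potIter (P := P) (Q := Q) (c := c) hk n)
    have h2 := ae_lt_top ((measurable_potIter hk n).inv.mul
      (measurable_sinkhornStep hk (measurable_potIter hk n))) (h.trans_lt ENNReal.one_lt_top).ne
    filter_upwards [ih, h2] with x hx hx2
    have : sinkhornStep P Q k (potIter P Q k c n) x ≠ ∞ := by
      intro hS
      simp [hS, ENNReal.mul_top, hx.ne] at hx2
    simp only [potIter]
    exact ENNReal.add_lt_top.2 ⟨ENNReal.one_lt_top, ENNReal.mul_lt_top hc.lt_top this.lt_top⟩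

/-- Mass balance: 1 = ∫ u_{n+1}⁻¹ u_{n+1} is at most ∫ u_{n+1}⁻¹ + c ∫ u_n⁻¹ S(u_n), because
u_{n+1}⁻¹ ≤ u_n⁻¹, and the last integral is at most 1. This prevents the iterates from diverging
everywhere. -/
lemma le_lintegral_inv_potIter (hk : Measurable (Function.uncurry k)) (hc : c + δ = 1) (n : ℕ) :
    δ ≤ ∫⁻ x, (potIter P Q k c n x)⁻¹ ∂P := by
  have hcT : c ≠ ∞ := fun h => by simp [h] at hc
  cases n with
  | zero =>
    simp only [potIter, inv_one, lintegral_const, measure_univ, mul_one]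
    exact hc ▸ le_add_self
  | succ n =>
    have h1 : (1 : ℝ≥0∞) = ∫⁻ x, (potIter P Q k c (n + 1) x)⁻¹ * potIter P Q k c (n + 1) x ∂P := by
      have : ∫⁻ _, (1 : ℝ≥0∞) ∂P = 1 := by simp
      rw [← this]
      refine lintegral_congr_ae ?_
      filter_upwards [potIter_lt_top (P := P) (Q := Q) hk hcT (n + 1)] with x hx
      rw [ENNReal.inv_mul_cancel _ hx.ne]
      exact (zero_lt_one.trans_le (one_le_potIter _ _)).ne'
    have h2 : ∫⁻ x, (potIter P Q k c (n + 1) x)⁻¹ * potIter P Q k c (n + 1) x ∂P ≤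
        ∫⁻ x, (potIter P Q k c (n + 1) x)⁻¹ ∂P + c := by
      calc _ ≤ ∫⁻ x, ((potIter P Q k c (n + 1) x)⁻¹ + c * ((potIter P Q k c n x)⁻¹ *
            sinkhornStep P Q k (potIter P Q k c n) x)) ∂P := by
            refine lintegral_mono fun x => ?_
            nth_rewrite 2 [potIter]
            rw [mul_add, mul_one, ← mul_assoc, mul_comm _ c, mul_assoc]
            have := monotone_potIter (P := P) (Q := Q) (k := k) (c := c) (Nat.le_succ n) x
            gcongr
        _ = ∫⁻ x, (potIter P Q k c (n + 1) x)⁻¹ ∂P + c * ∫⁻ x, ((potIter P Q k c n x)⁻¹ *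
            sinkhornStep P Q k (potIter P Q k c n) x) ∂P := by
            have m1 := measurable_potIter (P := P) (Q := Q) (c := c) hk (n + 1)
            have m2 := measurable_potIter (P := P) (Q := Q) (c := c) hk n
            have m3 := measurable_sinkhornStep (P := P) (Q := Q) hk m2
            rw [lintegral_add_left (by fun_prop), lintegral_const_mul _ (by fun_prop)]
        _ ≤ _ := by
            gcongr
            exact mul_le_of_le_one_right' (lintegral_inv_mul_sinkhornStep_le_one hk
              (measurable_potIter hk n))
    rw [← h1, ← hc, add_comm] at h2
    exact (ENNReal.add_le_add_iff_right hcT).1 h2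

lemma le_lintegral_inv_pot (hk : Measurable (Function.uncurry k)) (hc : c + δ = 1) :
    δ ≤ ∫⁻ x, (pot P Q k c x)⁻¹ ∂P := by
  have : ∫⁻ x, (pot P Q k c x)⁻¹ ∂P = ⨅ n, ∫⁻ x, (potIter P Q k c n x)⁻¹ ∂P := by
    have hm := fun n => measurable_potIter (P := P) (Q := Q) (c := c) hk n
    rw [← lintegral_iInf (f := fun n x => (potIter P Q k c n x)⁻¹) (fun n => by fun_prop)]
    · refine lintegral_congr fun z => ?_
      rw [pot, ENNReal.inv_iSup]
    · intro m n hmn z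
      exact ENNReal.inv_le_inv.2 (monotone_potIter hmn z)
    · simp [potIter]
  rw [this]
  exact le_iInf fun n => le_lintegral_inv_potIter hk hc n

variable (hk : Measurable (Function.uncurry k)) (hk0 : ∀ x y, 0 < k x y) (hk1 : ∀ x y, k x y ≤ 1)
  (hδ : 0 < δ) (hc : c + δ = 1)

-- Since k > 0, a vanishing integral would force the potential to be infinite almost everywhere,
-- against ∫ u⁻¹ ≥ δ > 0.
include hk hk0 hδ hc in
lemma lintegral_mul_inv_pot_pos (y : Y) : 0 < ∫⁻ z, k z y * (pot P Q k c z)⁻¹ ∂P := by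
  rw [pos_iff_ne_zero]
  intro h
  have hm := measurable_pot (P := P) (Q := Q) (c := c) hk
  rw [lintegral_eq_zero_iff (by fun_prop)] at h
  have h2 : ∫⁻ x, (pot P Q k c x)⁻¹ ∂P = 0 := by
    rw [lintegral_eq_zero_iff (by fun_prop)]
    filter_upwards [h] with x hx
    simpa [(hk0 x y).ne'] using hx
  exact absurd (h2 ▸ le_lintegral_inv_pot (P := P) (Q := Q) hk hc) (not_le.2 hδ)

include hk hk0 hk1 hδ hc in
lemma lintegral_inv_pot_mul_sinkhornStep :
    ∫⁻ x, (pot P Q k c x)⁻¹ * sinkhornStep P Q k (pot P Q k c) x ∂P = 1 := by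
  rw [lintegral_inv_mul_sinkhornStep hk (measurable_pot hk)]
  have : ∀ y, (∫⁻ z, k z y * (pot P Q k c z)⁻¹ ∂P) * (∫⁻ z, k z y * (pot P Q k c z)⁻¹ ∂P)⁻¹ = 1 :=
    fun y => ENNReal.mul_inv_cancel (lintegral_mul_inv_pot_pos hk hk0 hδ hc y).ne'
      ((lintegral_inv_mul_le_one hk1 one_le_pot y).trans_lt ENNReal.one_lt_top).ne
  simp [this]

include hk hk0 hk1 hδ hc in
lemma lintegral_inv_pot_mul_pot :
    ∫⁻ x, (pot P Q k c x)⁻¹ * pot P Q k c x ∂P = ∫⁻ x, (pot P Q k c x)⁻¹ ∂P + c := by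
  have hm := measurable_sinkhornStep (P := P) (Q := Q) hk
    (measurable_pot (P := P) (Q := Q) (c := c) hk)
  calc _ = ∫⁻ x, ((pot P Q k c x)⁻¹ + c * ((pot P Q k c x)⁻¹ *
            sinkhornStep P Q k (pot P Q k c) x)) ∂P := by
        refine lintegral_congr fun x => ?_
        nth_rewrite 2 [pot_eq hk hk1]
        ring
    _ = _ := by
        have hm' := measurable_pot (P := P) (Q := Q) (c := c) hk
        rw [lintegral_add_left (by fun_prop), lintegral_const_mul _ (by fun_prop), lintegral_inv_pot_mul_sinkhornStep hk hk0 hk1 hδ hc,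
          mul_one]

-- In [0, ∞] the product u⁻¹ u is at most the indicator of {u < ∞}, while its integral is ∫ u⁻¹ + c
-- ≥ δ + c = 1.
include hk hk0 hk1 hδ hc in
lemma pot_lt_top : ∀ᵐ x ∂P, pot P Q k c x < ∞ := by
  have h := lintegral_inv_pot_mul_pot (P := P) (Q := Q) hk hk0 hk1 hδ hc
  have h2 : (1 : ℝ≥0∞) ≤ P {x | pot P Q k c x < ∞} := by
    calc (1 : ℝ≥0∞) = δ + c := by rw [add_comm, hc]
      _ ≤ ∫⁻ x, (pot P Q k c x)⁻¹ ∂P + c := by gcongr; exact le_lintegral_inv_pot hk hc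
      _ = ∫⁻ x, (pot P Q k c x)⁻¹ * pot P Q k c x ∂P := h.symm
      _ ≤ ∫⁻ x, {x | pot P Q k c x < ∞}.indicator 1 x ∂P := by
          refine lintegral_mono fun x => ?_
          by_cases hx : pot P Q k c x < ∞
          · simp only [Set.indicator, Set.mem_ofPred_eq, hx, if_true, Pi.one_apply]
            exact ENNReal.inv_mul_le_one _
          · simp only [not_lt, top_le_iff] at hx
            simp [hx]
      _ = _ := by rw [lintegral_indicator_one]; exact measurable_pot hk measurableSet_Iio
  exact (prob_compl_eq_zero_iff (measurable_pot hk measurableSet_Iio)).2 (le_antisymm prob_le_one h2)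

-- Once u is finite almost everywhere, the balance holds with left side 1. The value δ is the mass
-- missing from the first marginal of the approximate coupling.
include hk hk0 hk1 hδ hc in
lemma lintegral_inv_pot : ∫⁻ x, (pot P Q k c x)⁻¹ ∂P = δ := by
  have hcT : c ≠ ∞ := fun h => by simp [h] at hc
  have h := lintegral_inv_pot_mul_pot (P := P) (Q := Q) hk hk0 hk1 hδ hc
  have h1 : ∫⁻ x, (pot P Q k c x)⁻¹ * pot P Q k c x ∂P = 1 := by
    have : ∫⁻ _, (1 : ℝ≥0∞) ∂P = 1 := by simp
    rw [← this]
    refine lintegral_congr_ae ?_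
    filter_upwards [pot_lt_top (P := P) (Q := Q) hk hk0 hk1 hδ hc] with x hx
    rw [ENNReal.inv_mul_cancel _ hx.ne]
    exact (zero_lt_one.trans_le (one_le_pot _)).ne'
  rw [h1, ← hc, add_comm] at h
  exact ((ENNReal.add_left_inj hcT).1 h).symm

end Approximants

end CondSchrodinger

/-! ### Approximate couplings of product form form a Cauchy family -/

namespace CondSchrodinger

open Filter Topology Set

section Cauchy

variable {X Y : Type*} [MeasurableSpace X] [MeasurableSpace Y]

/-- `π` is dominated by `P` and `Q` on cylinders, and its marginals are `δ`-close to `P`, `Q`. -/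
structure IsApproxCoupling (P : Measure X) (Q : Measure Y) (δ : ℝ) (π : Measure (X × Y)) :
    Prop where
  finite : IsFiniteMeasure π
  fst_le : ∀ S, MeasurableSet S → π.real (S ×ˢ univ) ≤ P.real S
  le_fst : ∀ S, MeasurableSet S → P.real S - δ ≤ π.real (S ×ˢ univ)
  snd_le : ∀ S, MeasurableSet S → π.real (univ ×ˢ S) ≤ Q.real S
  le_snd : ∀ S, MeasurableSet S → Q.real S - δ ≤ π.real (univ ×ˢ S)

variable {P : Measure X} {Q : Measure Y} {δ : ℝ} {π π' : Measure (X × Y)}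

/-- Inclusion-exclusion, in the form that shows π(S × S') - π(Sᶜ × S'ᶜ) to depend on the marginals
and the total mass only. -/
lemma measureReal_prod_add_compl [IsFiniteMeasure π] {S : Set X} {S' : Set Y} (hS : MeasurableSet S)
    (hS' : MeasurableSet S') :
    π.real (S ×ˢ univ) + π.real (univ ×ˢ S') + π.real (Sᶜ ×ˢ S'ᶜ) =
      π.real univ + π.real (S ×ˢ S') := by
  have h1 : π.real (S ×ˢ univ) = π.real (S ×ˢ S') + π.real (S ×ˢ S'ᶜ) := by
    rw [← measureReal_union _ (hS.prod hS'.compl)]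
    · rw [← prod_union, union_compl_self]
    · exact Set.disjoint_prod.2 (Or.inr disjoint_compl_right)
  have h2 : π.real (univ ×ˢ S') + π.real (univ ×ˢ S'ᶜ) = π.real univ := by
    rw [← measureReal_union _ (MeasurableSet.univ.prod hS'.compl)]
    · rw [← prod_union, union_compl_self, univ_prod_univ]
    · exact Set.disjoint_prod.2 (Or.inr disjoint_compl_right)
  have h3 : π.real (univ ×ˢ S'ᶜ) = π.real (S ×ˢ S'ᶜ) + π.real (Sᶜ ×ˢ S'ᶜ) := by
    rw [← measureReal_union _ (hS.compl.prod hS'.compl)]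
    · rw [← union_prod, union_compl_self]
    · exact Set.disjoint_prod.2 (Or.inl disjoint_compl_right)
  linarith

/-- The left side is a difference of marginal terms and total masses; each of the three contributes
at most δ. -/
lemma IsApproxCoupling.four_corners [IsProbabilityMeasure P] (h : IsApproxCoupling P Q δ π)
    (h' : IsApproxCoupling P Q δ π') {S : Set X} {S' : Set Y}
    (hS : MeasurableSet S) (hS' : MeasurableSet S') :
    π'.real (S ×ˢ S') - π.real (S ×ˢ S') + (π.real (Sᶜ ×ˢ S'ᶜ) - π'.real (Sᶜ ×ˢ S'ᶜ)) ≤ 3 * δ := by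
  have := h.finite
  have := h'.finite
  have e := measureReal_prod_add_compl (π := π) hS hS'
  have e' := measureReal_prod_add_compl (π := π') hS hS'
  have u1 := h.fst_le univ .univ
  have u2 := h'.le_fst univ .univ
  rw [univ_prod_univ] at u1 u2
  have := h.le_fst S hS
  have := h'.fst_le S hS
  have := h.le_snd S' hS'
  have := h'.snd_le S' hS'
  linarith

lemma IsApproxCoupling.le_real_prod [IsProbabilityMeasure P] [IsProbabilityMeasure Q]
    (h : IsApproxCoupling P Q δ π) {S : Set X} {S' : Set Y}
    (hS : MeasurableSet S) (hS' : MeasurableSet S') :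
    P.real S + Q.real S' - 1 - δ ≤ π.real (S ×ˢ S') := by
  have := h.finite
  have e := measureReal_prod_add_compl (π := π) hS.compl hS'.compl
  simp only [compl_compl] at e
  have h1 := h.fst_le Sᶜ hS.compl
  have h2 := h.snd_le S'ᶜ hS'.compl
  have h3 := h.le_fst univ .univ
  rw [univ_prod_univ] at h3
  rw [probReal_compl_eq_one_sub hS] at h1
  rw [probReal_compl_eq_one_sub hS'] at h2
  simp only [probReal_univ] at h3
  have : 0 ≤ π.real (Sᶜ ×ˢ S'ᶜ) := measureReal_nonneg
  linarith

lemma IsApproxCoupling.real_compl_prod_le [IsProbabilityMeasure P] [IsProbabilityMeasure Q]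
    (h : IsApproxCoupling P Q δ π) {S : Set X} {S' : Set Y}
    (hS : MeasurableSet S) (hS' : MeasurableSet S') :
    π.real (S ×ˢ S')ᶜ ≤ (1 - P.real S) + (1 - Q.real S') := by
  have := h.finite
  have h1 := h.fst_le Sᶜ hS.compl
  have h2 := h.snd_le S'ᶜ hS'.compl
  rw [probReal_compl_eq_one_sub hS] at h1
  rw [probReal_compl_eq_one_sub hS'] at h2
  refine le_trans ?_ (add_le_add h1 h2)
  refine (measureReal_mono ?_).trans (measureReal_union_le _ _)
  rintro ⟨x, y⟩ hxy
  by_cases hx : x ∈ S <;> simp_all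

/-- Existence of a median of the ratio of two functions. -/
lemma exists_median_ratio [IsProbabilityMeasure P] {φ φ' : X → ℝ≥0∞} (hφ : Measurable φ)
    (hφ' : Measurable φ') (h : ∀ᵐ x ∂P, φ x ≠ 0 ∧ φ x ≠ ∞) (h' : ∀ᵐ x ∂P, φ' x ≠ 0 ∧ φ' x ≠ ∞) :
    ∃ r : ℝ≥0, 0 < r ∧ 1 / 2 ≤ P.real {x | r * φ x ≤ φ' x} ∧
      1 / 2 ≤ P.real {x | φ' x ≤ r * φ x} := by
  set a : X → ℝ := fun x => (φ' x / φ x).toReal with ha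
  have ham : Measurable a := by fun_prop
  have hprob : IsProbabilityMeasure (P.map a) := Measure.isProbabilityMeasure_map ham.aemeasurable
  set F := ProbabilityTheory.cdf (P.map a) with hF
  set T := {s : ℝ | 1 / 2 ≤ F s} with hT
  have hFle : ∀ s, F s = P.real {x | a x ≤ s} := by
    intro s
    rw [hF, ProbabilityTheory.cdf_eq_real, map_measureReal_apply ham measurableSet_Iic]
    rfl
  have hne : T.Nonempty := by
    have := (ProbabilityTheory.tendsto_cdf_atTop (P.map a)).eventually
      (eventually_ge_nhds (show (1 / 2 : ℝ) < 1 by norm_num))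
    exact this.exists
  have ha0 : ∀ᵐ x ∂P, 0 < a x := by
    filter_upwards [h, h'] with x hx hx'
    exact ENNReal.toReal_pos (ENNReal.div_ne_zero.2 ⟨hx'.1, hx.2⟩) (ENNReal.div_ne_top hx'.2 hx.1)
  have hTpos : ∀ s ∈ T, 0 ≤ s := by
    intro s hs
    by_contra hs0
    push Not at hs0
    have : F s = 0 := by
      rw [hFle, measureReal_eq_zero_iff]
      refine measure_mono_null (t := {x | ¬ 0 < a x}) ?_ ha0
      intro x hx
      simp only [mem_ofPred_eq] at hx ⊢
      linarith
    simp only [hT, mem_ofPred_eq, this] at hs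
    norm_num at hs
  have hbdd : BddBelow T := ⟨0, hTpos⟩
  -- The median is the left end of {F ≥ 1/2}: right continuity of F puts r itself in this set, and
  -- the mass strictly below r is at most 1/2.
  set r := sInf T with hr
  have hr1 : 1 / 2 ≤ F r := by
    have hc : Tendsto F (𝓝[>] r) (𝓝 (F r)) :=
      (F.right_continuous r).tendsto.mono_left (nhdsWithin_mono _ Ioi_subset_Ici_self)
    refine ge_of_tendsto hc ?_
    filter_upwards [self_mem_nhdsWithin] with s hs
    obtain ⟨t, ht, hts⟩ := exists_lt_of_csInf_lt hne hs
    exact le_trans ht (F.mono hts.le)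
  have hr2 : 1 / 2 ≤ P.real {x | r ≤ a x} := by
    have hlt : P.real {x | a x < r} ≤ 1 / 2 := by
      have hU : {x | a x < r} = ⋃ n : ℕ, {x | a x ≤ r - 1 / ((n : ℝ) + 1)} := by
        ext x
        simp only [mem_ofPred_eq, mem_iUnion]
        constructor
        · intro hx
          obtain ⟨n, hn⟩ := exists_nat_one_div_lt (sub_pos.2 hx)
          exact ⟨n, by linarith⟩
        · rintro ⟨n, hn⟩
          have : 0 < 1 / ((n : ℝ) + 1) := Nat.one_div_pos_of_nat
          linarith
      have hmono : Monotone fun n : ℕ => {x | a x ≤ r - 1 / ((n : ℝ) + 1)} := by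
        intro m n hmn x hx
        simp only [mem_ofPred_eq] at hx ⊢
        have := Nat.one_div_le_one_div (α := ℝ) hmn
        linarith
      have ht := tendsto_measure_iUnion_atTop (μ := P) hmono
      rw [← hU] at ht
      have ht' := (ENNReal.tendsto_toReal (measure_ne_top P _)).comp ht
      refine le_of_tendsto' ht' fun n => ?_
      have hn : r - 1 / ((n : ℝ) + 1) ∉ T := by
        intro hn
        have := csInf_le hbdd hn
        have : 0 < 1 / ((n : ℝ) + 1) := Nat.one_div_pos_of_nat
        linarith
      simp only [hT, mem_ofPred_eq, not_le, hFle] at hn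
      exact hn.le
    have hc : {x | r ≤ a x} = {x | a x < r}ᶜ := by ext; simp
    rw [hc, probReal_compl_eq_one_sub (measurableSet_lt ham measurable_const)]
    linarith
  have hr0 : 0 < r := by
    by_contra hr0
    have : F r = 0 := by
      rw [hFle, measureReal_eq_zero_iff]
      refine measure_mono_null (t := {x | ¬ 0 < a x}) ?_ ha0
      intro x hx
      simp only [mem_ofPred_eq] at hx ⊢
      linarith
    linarith
  have key : ∀ x, φ x ≠ 0 ∧ φ x ≠ ∞ → φ' x ≠ 0 ∧ φ' x ≠ ∞ →
      φ' x = ENNReal.ofReal (a x) * φ x := by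
    intro x hx hx'
    rw [ha, ENNReal.ofReal_toReal (ENNReal.div_ne_top hx'.2 hx.1),
      ENNReal.div_mul_cancel hx.1 hx.2]
  refine ⟨r.toNNReal, Real.toNNReal_pos.2 hr0, hr2.trans ?_, (hFle r ▸ hr1).trans ?_⟩
  · refine ENNReal.toReal_mono (measure_ne_top _ _) (measure_mono_ae ?_)
    filter_upwards [h, h'] with x hx hx' hxr
    change (r.toNNReal : ℝ≥0∞) * φ x ≤ φ' x
    rw [key x hx hx']
    gcongr
    exact ENNReal.ofReal_le_ofReal hxr
  · refine ENNReal.toReal_mono (measure_ne_top _ _) (measure_mono_ae ?_)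
    filter_upwards [h, h'] with x hx hx' hxr
    change φ' x ≤ (r.toNNReal : ℝ≥0∞) * φ x
    rw [key x hx hx']
    gcongr
    exact ENNReal.ofReal_le_ofReal hxr

variable {k : X → Y → ℝ≥0∞} {φ φ' : X → ℝ≥0∞} {b b' : Y → ℝ≥0∞}

/-- The measure with density `k(x, y) φ(x) b(y)` with respect to `P ⊗ Q`. -/
noncomputable def prodForm (P : Measure X) (Q : Measure Y) (k : X → Y → ℝ≥0∞) (φ : X → ℝ≥0∞)
    (b : Y → ℝ≥0∞) : Measure (X × Y) :=
  (P.prod Q).withDensity fun q => k q.1 q.2 * φ q.1 * b q.2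

lemma prodForm_prod [SFinite P] [SFinite Q]
    (hk : Measurable (Function.uncurry k)) (hφ : Measurable φ) (hb : Measurable b)
    {S : Set X} {S' : Set Y} (hS : MeasurableSet S) (hS' : MeasurableSet S') :
    prodForm P Q k φ b (S ×ˢ S') = ∫⁻ x in S, ∫⁻ y in S', k x y * φ x * b y ∂Q ∂P := by
  rw [prodForm, withDensity_apply _ (hS.prod hS'), ← Measure.prod_restrict,
    lintegral_prod _ (by fun_prop)]

lemma smul_prodForm_le {U : Set X} {V : Set Y}
    {s : ℝ≥0∞} (h : ∀ x ∈ U, ∀ y ∈ V, s * (φ x * b y) ≤ φ' x * b' y)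
    (hk : Measurable (Function.uncurry k)) (hφ : Measurable φ) (hb : Measurable b)
    {Z : Set (X × Y)} (hZ : MeasurableSet Z) (hZU : Z ⊆ U ×ˢ V) :
    s * prodForm P Q k φ b Z ≤ prodForm P Q k φ' b' Z := by
  rw [prodForm, prodForm, withDensity_apply _ hZ, withDensity_apply _ hZ,
    ← lintegral_const_mul _ (by fun_prop)]
  refine setLIntegral_mono_ae' hZ (Eventually.of_forall ?_)
  rintro ⟨x, y⟩ hxy
  have := h x (hZU hxy).1 y (hZU hxy).2
  calc s * (k x y * φ x * b y) = k x y * (s * (φ x * b y)) := by ring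
    _ ≤ k x y * (φ' x * b' y) := by gcongr
    _ = _ := by ring

/-! ### Comparison of two product densities on rectangles -/

section Estimate

variable [IsProbabilityMeasure P]
  (hk : Measurable (Function.uncurry k)) (hφ : Measurable φ) (hφ' : Measurable φ')
  (hb : Measurable b) (hb' : Measurable b')
  (hπ : IsApproxCoupling P Q δ (prodForm P Q k φ b))
  (hπ' : IsApproxCoupling P Q δ (prodForm P Q k φ' b'))

include hk hφ hφ' hb hb' hπ hπ'

/-- On S × S' one has φ b ≤ φ' b', and the reverse on Sᶜ × S'ᶜ, so both brackets of the four-corner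
bound are nonnegative. On the part S × V the first bracket gains at least θ times the mass. -/
lemma mul_real_prodForm_le_of_excess {s : ℝ≥0} (hs : 0 < s) {θ : ℝ} (hθ : 0 ≤ θ) {V : Set Y}
    (hV : MeasurableSet V) (hVb : ∀ y ∈ V, ENNReal.ofReal (1 + θ) * b y ≤ s * b' y) :
    θ * (prodForm P Q k φ b).real ({x | s * φ x ≤ φ' x} ×ˢ V) ≤ 3 * δ := by
  have := hπ.finite
  have := hπ'.finite
  set S := {x | s * φ x ≤ φ' x} with hSdef
  set S' := {y | b y ≤ s * b' y} with hSdef'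
  have hS : MeasurableSet S := measurableSet_le (by fun_prop) hφ'
  have hS' : MeasurableSet S' := measurableSet_le hb (by fun_prop)
  have hs0 : (s : ℝ≥0∞) ≠ 0 := by exact_mod_cast hs.ne'
  have hVS : V ⊆ S' := by
    intro y hy
    refine le_trans ?_ (hVb y hy)
    exact le_mul_of_one_le_left' (by simpa using hθ)
  have four := hπ.four_corners hπ' hS hS'
  have c1 : (prodForm P Q k φ' b').real (Sᶜ ×ˢ S'ᶜ) ≤ (prodForm P Q k φ b).real (Sᶜ ×ˢ S'ᶜ) := by
    refine ENNReal.toReal_mono (measure_ne_top _ _) ?_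
    rw [← one_mul (prodForm P Q k φ' b' _)]
    refine smul_prodForm_le ?_ hk hφ' hb' (hS.compl.prod hS'.compl) subset_rfl
    intro x hx y hy
    simp only [hSdef, hSdef', mem_compl_iff, mem_ofPred_eq, not_le] at hx hy
    calc 1 * (φ' x * b' y) ≤ s * φ x * b' y := by rw [one_mul]; gcongr
      _ = φ x * (s * b' y) := by ring
      _ ≤ φ x * b y := by gcongr
  have hle : ∀ x ∈ S, ∀ y ∈ S', 1 * (φ x * b y) ≤ φ' x * b' y := by
    intro x hx y hy
    calc 1 * (φ x * b y) ≤ φ x * (s * b' y) := by rw [one_mul]; gcongr; exact hy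
      _ = (s * φ x) * b' y := by ring
      _ ≤ _ := by gcongr; exact hx
  have c2 : (prodForm P Q k φ b).real (S ×ˢ (S' \ V)) ≤
      (prodForm P Q k φ' b').real (S ×ˢ (S' \ V)) := by
    refine ENNReal.toReal_mono (measure_ne_top _ _) ?_
    rw [← one_mul (prodForm P Q k φ b _)]
    exact smul_prodForm_le hle hk hφ hb (hS.prod (hS'.diff hV))
      (prod_mono subset_rfl sdiff_subset)
  have c3 : (1 + θ) * (prodForm P Q k φ b).real (S ×ˢ V) ≤
      (prodForm P Q k φ' b').real (S ×ˢ V) := by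
    have := smul_prodForm_le (P := P) (Q := Q) (s := ENNReal.ofReal (1 + θ)) (φ' := φ') (b' := b')
      (U := S) (V := V) ?_ hk hφ hb (hS.prod hV) subset_rfl
    · have := ENNReal.toReal_mono (measure_ne_top _ _) this
      rwa [ENNReal.toReal_mul, ENNReal.toReal_ofReal (by linarith)] at this
    · intro x hx y hy
      calc ENNReal.ofReal (1 + θ) * (φ x * b y) = φ x * (ENNReal.ofReal (1 + θ) * b y) := by ring
        _ ≤ φ x * (s * b' y) := mul_le_mul_right (hVb y hy) _
        _ = (s * φ x) * b' y := by ring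
        _ ≤ _ := by gcongr; exact hx
  have split : ∀ ρ : Measure (X × Y), IsFiniteMeasure ρ →
      ρ.real (S ×ˢ S') = ρ.real (S ×ˢ V) + ρ.real (S ×ˢ (S' \ V)) := by
    intro ρ _
    rw [← measureReal_union _ (hS.prod (hS'.diff hV)), ← prod_union, union_sdiff_cancel hVS]
    exact Set.disjoint_prod.2 (Or.inr disjoint_sdiff_right)
  rw [split _ hπ.finite, split _ hπ'.finite] at four
  linarith

/-- The mirror image: with strict inequalities defining S and S', the rectangle U × V lies in Sᶜ ×
S'ᶜ, and it is the second bracket that gains θ times the mass. -/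
lemma mul_real_prodForm_le_of_deficit {s : ℝ≥0} (hs : 0 < s) {θ : ℝ} (hθ1 : θ ≤ 1)
    {U : Set X} {V : Set Y} (hU : MeasurableSet U)
    (hV : MeasurableSet V) (hUφ : ∀ x ∈ U, φ' x ≤ s * φ x) (hVb : ∀ y ∈ V, s * b' y ≤ b y)
    (hUV : ∀ x ∈ U, ∀ y ∈ V, φ' x * b' y ≤ ENNReal.ofReal (1 - θ) * (φ x * b y)) :
    θ * (prodForm P Q k φ b).real (U ×ˢ V) ≤ 3 * δ := by
  have := hπ.finite
  have := hπ'.finite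
  set S := {x | s * φ x < φ' x} with hSdef
  set S' := {y | b y < s * b' y} with hSdef'
  have hS : MeasurableSet S := measurableSet_lt (by fun_prop) hφ'
  have hS' : MeasurableSet S' := measurableSet_lt hb (by fun_prop)
  have hs0 : (s : ℝ≥0∞) ≠ 0 := by exact_mod_cast hs.ne'
  have hUS : U ×ˢ V ⊆ Sᶜ ×ˢ S'ᶜ := by
    refine prod_mono (fun x hx => ?_) (fun y hy => ?_)
    · simpa [hSdef] using hUφ x hx
    · simpa [hSdef'] using hVb y hy
  have four := hπ.four_corners hπ' hS hS'
  have c1 : (prodForm P Q k φ b).real (S ×ˢ S') ≤ (prodForm P Q k φ' b').real (S ×ˢ S') := by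
    refine ENNReal.toReal_mono (measure_ne_top _ _) ?_
    rw [← one_mul (prodForm P Q k φ b _)]
    refine smul_prodForm_le ?_ hk hφ hb (hS.prod hS') subset_rfl
    intro x hx y hy
    simp only [hSdef, hSdef', mem_ofPred_eq] at hx hy
    calc 1 * (φ x * b y) ≤ φ x * (s * b' y) := by rw [one_mul]; gcongr
      _ = (s * φ x) * b' y := by ring
      _ ≤ _ := by gcongr
  have hle : ∀ x ∈ Sᶜ, ∀ y ∈ S'ᶜ, 1 * (φ' x * b' y) ≤ φ x * b y := by
    intro x hx y hy
    simp only [hSdef, hSdef', mem_compl_iff, mem_ofPred_eq, not_lt] at hx hy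
    calc 1 * (φ' x * b' y) ≤ s * φ x * b' y := by rw [one_mul]; gcongr
      _ = φ x * (s * b' y) := by ring
      _ ≤ φ x * b y := by gcongr
  have hZ := (hS.compl.prod hS'.compl).diff (hU.prod hV)
  have c2 : (prodForm P Q k φ' b').real ((Sᶜ ×ˢ S'ᶜ) \ (U ×ˢ V)) ≤
      (prodForm P Q k φ b).real ((Sᶜ ×ˢ S'ᶜ) \ (U ×ˢ V)) := by
    refine ENNReal.toReal_mono (measure_ne_top _ _) ?_
    rw [← one_mul (prodForm P Q k φ' b' _)]
    exact smul_prodForm_le hle hk hφ' hb' hZ sdiff_subset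
  have c3 : (prodForm P Q k φ' b').real (U ×ˢ V) ≤
      (1 - θ) * (prodForm P Q k φ b).real (U ×ˢ V) := by
    have h1 : prodForm P Q k φ' b' (U ×ˢ V) ≤
        ENNReal.ofReal (1 - θ) * prodForm P Q k φ b (U ×ˢ V) := by
      rw [prodForm, prodForm, withDensity_apply _ (hU.prod hV), withDensity_apply _ (hU.prod hV),
        ← lintegral_const_mul _ (by fun_prop)]
      refine setLIntegral_mono_ae' (hU.prod hV) (Eventually.of_forall ?_)
      rintro ⟨x, y⟩ hxy
      calc k x y * φ' x * b' y = k x y * (φ' x * b' y) := by ring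
        _ ≤ k x y * (ENNReal.ofReal (1 - θ) * (φ x * b y)) := 
          mul_le_mul_right (hUV x hxy.1 y hxy.2) _
        _ = _ := by ring
    have := ENNReal.toReal_mono (ENNReal.mul_ne_top ENNReal.ofReal_ne_top (measure_ne_top _ _)) h1
    rwa [ENNReal.toReal_mul, ENNReal.toReal_ofReal (by linarith)] at this
  have split : ∀ ρ : Measure (X × Y), IsFiniteMeasure ρ →
      ρ.real (Sᶜ ×ˢ S'ᶜ) = ρ.real (U ×ˢ V) + ρ.real ((Sᶜ ×ˢ S'ᶜ) \ (U ×ˢ V)) := by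
    intro ρ _
    rw [← measureReal_union disjoint_sdiff_right hZ, union_sdiff_cancel hUS]
  rw [split _ hπ.finite, split _ hπ'.finite] at four
  linarith

end Estimate

lemma mul_le_real_prodForm [IsProbabilityMeasure P] [IsProbabilityMeasure Q]
    [IsFiniteMeasure (prodForm P Q k φ b)] {U : Set X} {V : Set Y} (hU : MeasurableSet U)
    (hV : MeasurableSet V) {c : ℝ} (hc : 0 ≤ c)
    (h : ∀ x ∈ U, ∀ y ∈ V, ENNReal.ofReal c ≤ k x y * φ x * b y) :
    c * (P.real U * Q.real V) ≤ (prodForm P Q k φ b).real (U ×ˢ V) := by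
  have h1 : ENNReal.ofReal c * (P U * Q V) ≤ prodForm P Q k φ b (U ×ˢ V) := by
    rw [prodForm, withDensity_apply _ (hU.prod hV), ← Measure.prod_prod, ← setLIntegral_const]
    refine setLIntegral_mono_ae' (hU.prod hV) (Eventually.of_forall ?_)
    rintro ⟨x, y⟩ hxy
    exact h x hxy.1 y hxy.2
  have := ENNReal.toReal_mono (measure_ne_top _ _) h1
  rwa [ENNReal.toReal_mul, ENNReal.toReal_ofReal hc, ENNReal.toReal_mul] at this

/-- On a rectangle of almost full measure the density of an approximate coupling is bounded below,
if the kernel is. -/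
lemma IsApproxCoupling.exists_le_density [IsProbabilityMeasure P] [IsProbabilityMeasure Q]
    (hk : Measurable (Function.uncurry k)) (hk1 : ∀ x y, k x y ≤ 1) (hφ : Measurable φ)
    (hb : Measurable b) (hπ : IsApproxCoupling P Q δ (prodForm P Q k φ b)) {K : Set X} {L : Set Y}
    (hK : MeasurableSet K) (hL : MeasurableSet L) {c ε : ℝ} (hc : 0 < c)
    (hKL : ∀ x ∈ K, ∀ y ∈ L, ENNReal.ofReal c ≤ k x y) (hPK : 1 - ε ≤ P.real K)
    (hQL : 1 - ε ≤ Q.real L) :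
    ∃ A B, MeasurableSet A ∧ MeasurableSet B ∧ 1 - 2 * δ - 4 * ε ≤ P.real A ∧
      1 - 2 * δ - 4 * ε ≤ Q.real B ∧
      ∀ x ∈ A, ∀ y ∈ B, ENNReal.ofReal (c ^ 2 / 4) ≤ k x y * φ x * b y := by
  have hfin := hπ.finite
  set π := prodForm P Q k φ b with hπdef
  set m : X → ℝ≥0∞ := fun x => ∫⁻ y in L, k x y * φ x * b y ∂Q with hm
  set m' : Y → ℝ≥0∞ := fun y => ∫⁻ x in K, k x y * φ x * b y ∂P with hm'
  have hmm : Measurable m :=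
    Measurable.lintegral_prod_right' (f := fun q : X × Y => k q.1 q.2 * φ q.1 * b q.2) (by fun_prop)
  have hmm' : Measurable m' :=
    Measurable.lintegral_prod_left' (f := fun q : X × Y => k q.1 q.2 * φ q.1 * b q.2) (by fun_prop)
  -- A and B keep the points whose section carries mass at least 1/2. As K \ A contributes at most
  -- half its P-mass, P(A) ≥ 2 π(K × L) - P(K) ≥ 2 (1 - 2ε - δ) - 1, and likewise for B.
  have hA : MeasurableSet (K ∩ {x | 1 / 2 ≤ m x}) := hK.inter (hmm measurableSet_Ici)
  have hB : MeasurableSet (L ∩ {y | 1 / 2 ≤ m' y}) := hL.inter (hmm' measurableSet_Ici)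
  have hKLπ := hπ.le_real_prod hK hL
  have hdA : MeasurableSet (K \ {x | 1 / 2 ≤ m x}) := hK.diff (hmm measurableSet_Ici)
  have hdB : MeasurableSet (L \ {y | 1 / 2 ≤ m' y}) := hL.diff (hmm' measurableSet_Ici)
  have half : ENNReal.toReal (1 / 2) = 1 / 2 := by simp
  refine ⟨_, _, hA, hB, ?_, ?_, ?_⟩
  · have h1 : π ((K \ {x | 1 / 2 ≤ m x}) ×ˢ L) ≤ 1 / 2 * P (K \ {x | 1 / 2 ≤ m x}) := by
      rw [hπdef, prodForm_prod hk hφ hb hdA hL, ← setLIntegral_const]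
      refine setLIntegral_mono_ae' hdA (Eventually.of_forall ?_)
      intro x hx
      simp only [Set.mem_sdiff, mem_ofPred_eq, not_le] at hx
      exact hx.2.le
    have h1' := ENNReal.toReal_mono (ENNReal.mul_ne_top (by simp) (measure_ne_top _ _)) h1
    rw [ENNReal.toReal_mul, half] at h1'
    have h2 : π.real ((K ∩ {x | 1 / 2 ≤ m x}) ×ˢ L) ≤ P.real (K ∩ {x | 1 / 2 ≤ m x}) :=
      (measureReal_mono (prod_mono subset_rfl (subset_univ L))).trans (hπ.fst_le _ hA)
    have h3 : π.real (K ×ˢ L) ≤ π.real ((K ∩ {x | 1 / 2 ≤ m x}) ×ˢ L) +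
        π.real ((K \ {x | 1 / 2 ≤ m x}) ×ˢ L) := by
      refine (measureReal_mono ?_).trans (measureReal_union_le _ _)
      rw [← union_prod, inter_union_sdiff]
    have h4 := measureReal_inter_add_sdiff (μ := P) (s := K) (t := {x | 1 / 2 ≤ m x})
      (hmm measurableSet_Ici)
    have h5 : P.real K ≤ 1 := measureReal_le_one
    simp only [measureReal_def] at *
    linarith
  · have h1 : π (K ×ˢ (L \ {y | 1 / 2 ≤ m' y})) ≤ 1 / 2 * Q (L \ {y | 1 / 2 ≤ m' y}) := by
      rw [hπdef, prodForm_prod hk hφ hb hK hdB, lintegral_lintegral_swap (by fun_prop),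
        ← setLIntegral_const]
      refine setLIntegral_mono_ae' hdB (Eventually.of_forall ?_)
      intro y hy
      simp only [Set.mem_sdiff, mem_ofPred_eq, not_le] at hy
      exact hy.2.le
    have h1' := ENNReal.toReal_mono (ENNReal.mul_ne_top (by simp) (measure_ne_top _ _)) h1
    rw [ENNReal.toReal_mul, half] at h1'
    have h2 : π.real (K ×ˢ (L ∩ {y | 1 / 2 ≤ m' y})) ≤ Q.real (L ∩ {y | 1 / 2 ≤ m' y}) :=
      (measureReal_mono (prod_mono (subset_univ K) subset_rfl)).trans (hπ.snd_le _ hB)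
    have h3 : π.real (K ×ˢ L) ≤ π.real (K ×ˢ (L ∩ {y | 1 / 2 ≤ m' y})) +
        π.real (K ×ˢ (L \ {y | 1 / 2 ≤ m' y})) := by
      refine (measureReal_mono ?_).trans (measureReal_union_le _ _)
      rw [← prod_union, inter_union_sdiff]
    have h4 := measureReal_inter_add_sdiff (μ := Q) (s := L) (t := {y | 1 / 2 ≤ m' y})
      (hmm' measurableSet_Ici)
    have h5 : Q.real L ≤ 1 := measureReal_le_one
    simp only [measureReal_def] at *
    linarith
  · rintro x ⟨hxK, hx⟩ y ⟨hyL, hy⟩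
    simp only [mem_ofPred_eq] at hx hy
    -- From k ≤ 1 one gets 1/2 ≤ φ(x) β and 1/2 ≤ α b(y), while k ≥ c on K × L gives c α β ≤ 1.
    -- Multiplying, c/4 ≤ φ(x) b(y), and one more factor k ≥ c gives c²/4.
    set α := ∫⁻ x in K, φ x ∂P
    set β := ∫⁻ y in L, b y ∂Q
    have e1 : m x ≤ φ x * β := by
      rw [← lintegral_const_mul _ hb]
      refine lintegral_mono fun y => ?_
      gcongr
      exact mul_le_of_le_one_left' (hk1 x y)
    have e2 : m' y ≤ α * b y := by
      rw [← lintegral_mul_const _ hφ]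
      refine lintegral_mono fun x => ?_
      gcongr
      exact mul_le_of_le_one_left' (hk1 x y)
    have e3 : ENNReal.ofReal c * (α * β) ≤ 1 := by
      have hle : ENNReal.ofReal c * (α * β) ≤ π (K ×ˢ L) := by
        rw [hπdef, prodForm_prod hk hφ hb hK hL, ← lintegral_mul_const _ hφ,
          ← lintegral_const_mul _ (by fun_prop)]
        refine setLIntegral_mono_ae' hK (Eventually.of_forall fun x hx => ?_)
        rw [← lintegral_const_mul _ hb, ← lintegral_const_mul _ (by fun_prop)]
        refine setLIntegral_mono_ae' hL (Eventually.of_forall fun y hy => ?_)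
        rw [mul_assoc (k x y)]
        gcongr
        exact hKL x hx y hy
      refine hle.trans ?_
      rw [← ENNReal.toReal_le_toReal (measure_ne_top _ _) ENNReal.one_ne_top, ENNReal.toReal_one]
      refine ((measureReal_mono (prod_mono subset_rfl (subset_univ L))).trans
        (hπ.fst_le K hK)).trans measureReal_le_one
    have e4 : ENNReal.ofReal c * (1 / 2 * (1 / 2)) ≤ φ x * b y := by
      calc ENNReal.ofReal c * (1 / 2 * (1 / 2)) ≤ ENNReal.ofReal c * ((φ x * β) * (α * b y)) := by
            gcongr
            · exact hx.trans e1
            · exact hy.trans e2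
        _ = (ENNReal.ofReal c * (α * β)) * (φ x * b y) := by ring
        _ ≤ _ := mul_le_of_le_one_left' e3
    calc ENNReal.ofReal (c ^ 2 / 4) = ENNReal.ofReal c * (ENNReal.ofReal c * (1 / 2 * (1 / 2))) := by
          have : (1 / 2 : ℝ≥0∞) = ENNReal.ofReal (1 / 2) := by
            rw [ENNReal.ofReal_div_of_pos (by norm_num)]; simp
          rw [this, ← ENNReal.ofReal_mul (by norm_num), ← ENNReal.ofReal_mul hc.le,
            ← ENNReal.ofReal_mul hc.le]
          congr 1
          ring
      _ ≤ k x y * (φ x * b y) := by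
          gcongr
          exact hKL x hxK y hyL
      _ = _ := by ring

/-- Two approximate couplings of product form are close. -/
lemma lintegral_sub_prodForm_le [IsProbabilityMeasure P] [IsProbabilityMeasure Q]
    (hk : Measurable (Function.uncurry k)) (hφ : Measurable φ) (hφ' : Measurable φ')
    (hb : Measurable b) (hb' : Measurable b')
    (hφ0 : ∀ᵐ x ∂P, φ x ≠ 0 ∧ φ x ≠ ∞) (hφ0' : ∀ᵐ x ∂P, φ' x ≠ 0 ∧ φ' x ≠ ∞)
    (hπ : IsApproxCoupling P Q δ (prodForm P Q k φ b))
    (hπ' : IsApproxCoupling P Q δ (prodForm P Q k φ' b'))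
    {A : Set X} {B : Set Y} (hA : MeasurableSet A) (hB : MeasurableSet B) {c ε θ : ℝ} (hc : 0 < c)
    (hε : ε ≤ 1 / 6) (hPA : 1 - ε ≤ P.real A) (hQB : 1 - ε ≤ Q.real B)
    (hAB : ∀ x ∈ A, ∀ y ∈ B, ENNReal.ofReal c ≤ k x y * φ x * b y) (hθ : 0 < θ) (hθ1 : θ < 1)
    (hδ : 9 * δ / (c * θ) ≤ 1 / 6) :
    ∫⁻ q, (k q.1 q.2 * φ q.1 * b q.2 - k q.1 q.2 * φ' q.1 * b' q.2) ∂(P.prod Q) ≤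
      ENNReal.ofReal (3 * θ + 2 * (ε + 9 * δ / (c * θ))) := by
  have hfin := hπ.finite
  obtain ⟨r, hr, hr1, hr2⟩ := exists_median_ratio hφ hφ' hφ0 hφ0'
  set κ := 9 * δ / (c * θ) with hκ
  have hcθ : 0 < c * θ := mul_pos hc hθ
  have h1θ : (0 : ℝ) < 1 - θ := by linarith
  -- Half of the space minus the at most 1/6 that A misses leaves 1/3.
  have hinter : ∀ {S : Set X}, MeasurableSet S → 1 / 2 ≤ P.real S → 1 / 3 ≤ P.real (S ∩ A) := by
    intro S hS h
    have := measureReal_inter_add_sdiff (μ := P) (s := S) (t := A) hA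
    have h2 : P.real (S \ A) ≤ P.real Aᶜ := measureReal_mono (fun x hx => hx.2)
    rw [probReal_compl_eq_one_sub hA] at h2
    linarith
  -- Origin of κ: a rectangle with one side of measure at least 1/3 has mass at least c z / 3, and θ
  -- times this mass is at most 3δ.
  have hbound : ∀ {q z : ℝ}, 1 / 3 ≤ q → 0 ≤ z → θ * (c * (q * z)) ≤ 3 * δ → z ≤ κ := by
    intro q z hq hz h
    rw [hκ, le_div_iff₀ hcθ]
    have : 1 / 3 * z ≤ q * z := by gcongr
    have := mul_le_mul_of_nonneg_left this hcθ.le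
    linarith
  -- V₁ is where b' exceeds b / r by the factor 1 + θ, and V₂ below is where it falls short by the
  -- factor 1 - θ. The two halves of the median property make each of them small.
  set V₁ := B ∩ {y | ENNReal.ofReal (1 + θ) * b y ≤ r * b' y} with hV₁
  have hV₁m : MeasurableSet V₁ := hB.inter (measurableSet_le (by fun_prop) (by fun_prop))
  have hS₁ : MeasurableSet {x | r * φ x ≤ φ' x} := measurableSet_le (by fun_prop) (by fun_prop)
  have b₁ : Q.real V₁ ≤ κ := by
    refine hbound (hinter hS₁ hr1) measureReal_nonneg
      (le_trans ?_ (mul_real_prodForm_le_of_excess hk hφ hφ' hb hb' hπ hπ' hr hθ.le hV₁m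
        fun y hy => hy.2))
    gcongr
    refine (mul_le_real_prodForm (hS₁.inter hA) hV₁m hc.le
      fun x hx y hy => hAB x hx.2 y hy.1).trans ?_
    exact measureReal_mono (prod_mono inter_subset_left subset_rfl)
  set V₂ := B ∩ {y | r * b' y ≤ ENNReal.ofReal (1 - θ) * b y} with hV₂
  have hV₂m : MeasurableSet V₂ := hB.inter (measurableSet_le (by fun_prop) (by fun_prop))
  have hS₂ : MeasurableSet {x | φ' x ≤ r * φ x} := measurableSet_le (by fun_prop) (by fun_prop)
  have b₂ : Q.real V₂ ≤ κ := by
    refine hbound (hinter hS₂ hr2) measureReal_nonneg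
      (le_trans ?_ (mul_real_prodForm_le_of_deficit hk hφ hφ' hb hb' hπ hπ' hr hθ1.le
        (hS₂.inter hA) hV₂m (fun x hx => hx.1) (fun y hy => ?_) fun x hx y hy => ?_))
    · gcongr
      exact mul_le_real_prodForm (hS₂.inter hA) hV₂m hc.le fun x hx y hy => hAB x hx.2 y hy.1
    · refine le_trans hy.2 (mul_le_of_le_one_left' ?_)
      simpa using hθ.le
    · calc φ' x * b' y ≤ r * φ x * b' y := by gcongr; exact hx.1
        _ = φ x * (r * b' y) := by ring
        _ ≤ φ x * (ENNReal.ofReal (1 - θ) * b y) := mul_le_mul_right hy.2 _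
        _ = _ := by ring
  -- The roles of X and Y are now exchanged to bound φ' / φ from below. No median is available in Y,
  -- but off V₁ the inequality r b' ≤ (1 + θ) b holds, and the level s gives s b' ≤ (1 - θ²) b ≤ b
  -- there.
  set s : ℝ≥0 := (1 - θ).toNNReal * r with hs
  have hs0 : 0 < s := mul_pos (Real.toNNReal_pos.2 h1θ) hr
  have hscoe : (s : ℝ≥0∞) = ENNReal.ofReal (1 - θ) * r := by rw [hs, ENNReal.coe_mul]; rfl
  set U₃ := A ∩ {x | φ' x ≤ ENNReal.ofReal (1 - θ) * (s * φ x)} with hU₃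
  have hU₃m : MeasurableSet U₃ := hA.inter (measurableSet_le (by fun_prop) (by fun_prop))
  have hofle : ENNReal.ofReal (1 - θ) ≤ 1 := by simpa using hθ.le
  have hBV : 1 / 3 ≤ Q.real (B \ V₁) := by
    have := measureReal_sdiff_add_inter (μ := Q) (s := B) (t := V₁) hV₁m
    have h2 : Q.real (B ∩ V₁) ≤ Q.real V₁ := measureReal_mono inter_subset_right
    linarith
  have hsb : ∀ y ∈ B \ V₁, s * b' y ≤ b y := by
    intro y hy
    have : r * b' y ≤ ENNReal.ofReal (1 + θ) * b y := by
      by_contra h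
      exact hy.2 ⟨hy.1, (not_le.1 h).le⟩
    calc s * b' y = ENNReal.ofReal (1 - θ) * (r * b' y) := by rw [hscoe]; ring
      _ ≤ ENNReal.ofReal (1 - θ) * (ENNReal.ofReal (1 + θ) * b y) := mul_le_mul_right this _
      _ = ENNReal.ofReal ((1 - θ) * (1 + θ)) * b y := by rw [ENNReal.ofReal_mul h1θ.le]; ring
      _ ≤ b y := by
        refine mul_le_of_le_one_left' ?_
        rw [ENNReal.ofReal_le_one]
        nlinarith
  have b₃ : P.real U₃ ≤ κ := by
    refine hbound hBV measureReal_nonneg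
      (le_trans ?_ (mul_real_prodForm_le_of_deficit hk hφ hφ' hb hb' hπ hπ' hs0 hθ1.le
        hU₃m (hB.diff hV₁m) (fun x hx => ?_) hsb fun x hx y hy => ?_))
    · rw [mul_comm (Q.real _)]
      gcongr
      exact mul_le_real_prodForm hU₃m (hB.diff hV₁m) hc.le fun x hx y hy => hAB x hx.1 y hy.1
    · exact le_trans hx.2 (mul_le_of_le_one_left' hofle)
    · calc φ' x * b' y ≤ ENNReal.ofReal (1 - θ) * (s * φ x) * b' y := by gcongr; exact hx.2
        _ = ENNReal.ofReal (1 - θ) * (φ x * (s * b' y)) := by ring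
        _ ≤ _ := by gcongr; exact hsb y hy
  have hA' : MeasurableSet (A \ U₃) := hA.diff hU₃m
  have hB' : MeasurableSet (B \ V₂) := hB.diff hV₂m
  have hPA' : 1 - ε - κ ≤ P.real (A \ U₃) := by
    have := measureReal_sdiff_add_inter (μ := P) (s := A) (t := U₃) hU₃m
    have h2 : P.real (A ∩ U₃) ≤ P.real U₃ := measureReal_mono inter_subset_right
    linarith
  have hQB' : 1 - ε - κ ≤ Q.real (B \ V₂) := by
    have := measureReal_sdiff_add_inter (μ := Q) (s := B) (t := V₂) hV₂m
    have h2 : Q.real (B ∩ V₂) ≤ Q.real V₂ := measureReal_mono inter_subset_right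
    linarith
  have hR : MeasurableSet ((A \ U₃) ×ˢ (B \ V₂)) := hA'.prod hB'
  have hcomp := hπ.real_compl_prod_le hA' hB'
  set t := ENNReal.ofReal (1 - θ) with ht
  have hpt : ∀ q ∈ (A \ U₃) ×ˢ (B \ V₂),
      k q.1 q.2 * φ q.1 * b q.2 - k q.1 q.2 * φ' q.1 * b' q.2 ≤
        ENNReal.ofReal (3 * θ) * (k q.1 q.2 * φ q.1 * b q.2) := by
    rintro ⟨x, y⟩ ⟨hx, hy⟩
    have e1 : t * (s * φ x) ≤ φ' x := by
      by_contra h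
      exact hx.2 ⟨hx.1, (not_le.1 h).le⟩
    have e2 : t * b y ≤ r * b' y := by
      by_contra h
      exact hy.2 ⟨hy.1, (not_le.1 h).le⟩
    -- Two factors 1 - θ come from φ' and one from b'; then 1 - (1 - θ)³ ≤ 3θ bounds the relative
    -- loss on the good rectangle.
    have e3 : t ^ 3 * (φ x * b y) ≤ φ' x * b' y := by
      calc t ^ 3 * (φ x * b y) = t ^ 2 * φ x * (t * b y) := by ring
        _ ≤ t ^ 2 * φ x * (r * b' y) := mul_le_mul_right e2 _
        _ = t * ((t * r) * φ x) * b' y := by ring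
        _ ≤ φ' x * b' y := by rw [← hscoe]; gcongr
    rw [tsub_le_iff_right]
    calc k x y * φ x * b y
        = 1 * (k x y * φ x * b y) := (one_mul _).symm
      _ ≤ (ENNReal.ofReal (3 * θ) + t ^ 3) * (k x y * φ x * b y) := by
          gcongr
          rw [ht, ← ENNReal.ofReal_pow h1θ.le, ← ENNReal.ofReal_add (by positivity) (by positivity),
            ENNReal.one_le_ofReal]
          nlinarith [mul_pos hθ hθ, mul_pos hθ h1θ, mul_pos (mul_pos hθ hθ) hθ,
            mul_pos (mul_pos hθ hθ) h1θ]
      _ = ENNReal.ofReal (3 * θ) * (k x y * φ x * b y) + k x y * (t ^ 3 * (φ x * b y)) := by ring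
      _ ≤ ENNReal.ofReal (3 * θ) * (k x y * φ x * b y) + k x y * (φ' x * b' y) := by gcongr
      _ = _ := by ring
  rw [← lintegral_add_compl _ hR]
  have hle1 : prodForm P Q k φ b univ ≤ 1 := by
    rw [← ENNReal.toReal_le_toReal (measure_ne_top _ _) ENNReal.one_ne_top, ENNReal.toReal_one]
    have := hπ.fst_le univ .univ
    rw [univ_prod_univ] at this
    exact this.trans measureReal_le_one
  calc _ ≤ ENNReal.ofReal (3 * θ) * 1 +
        ENNReal.ofReal ((prodForm P Q k φ b).real ((A \ U₃) ×ˢ (B \ V₂))ᶜ) := by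
        gcongr
        · refine (setLIntegral_mono_ae' hR (Eventually.of_forall hpt)).trans ?_
          rw [lintegral_const_mul _ (by fun_prop)]
          gcongr
          refine le_trans ?_ hle1
          rw [prodForm, withDensity_apply _ .univ, setLIntegral_univ]
          exact setLIntegral_le_lintegral _ _
        · rw [ofReal_measureReal, prodForm, withDensity_apply _ hR.compl]
          exact lintegral_mono fun q => tsub_le_self
    _ ≤ ENNReal.ofReal (3 * θ) + ENNReal.ofReal (2 * (ε + κ)) := by
        rw [mul_one]
        gcongr
        linarith
    _ = _ := by
        rw [← ENNReal.ofReal_add (by positivity)]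
        have : 0 ≤ (prodForm P Q k φ b).real ((A \ U₃) ×ˢ (B \ V₂))ᶜ := measureReal_nonneg
        linarith

end Cauchy

end CondSchrodinger

/-! ### Convergence of the approximate solutions -/

namespace CondSchrodinger

open Filter Topology Set

section Limit

variable {X Y : Type*} [MeasurableSpace X] [MeasurableSpace Y]

/-- The factor in `y` of the approximate solution. -/
noncomputable def dualPot (P : Measure X) (Q : Measure Y) (k : X → Y → ℝ≥0∞) (c : ℝ≥0∞) (y : Y) :
    ℝ≥0∞ :=
  c * (∫⁻ z, k z y * (pot P Q k c z)⁻¹ ∂P)⁻¹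

/-- The mass defect `1 / (n + 2)` of the `n`-th approximate solution. -/
noncomputable def defect (n : ℕ) : ℝ≥0∞ := ((n + 2 : ℕ) : ℝ≥0∞)⁻¹

/-- The density of the `n`-th approximate solution. -/
noncomputable def approxDensity (P : Measure X) (Q : Measure Y) (k : X → Y → ℝ≥0∞) (n : ℕ)
    (x : X) (y : Y) : ℝ≥0∞ :=
  k x y * (pot P Q k (1 - defect n) x)⁻¹ * dualPot P Q k (1 - defect n) y

lemma defect_pos (n : ℕ) : 0 < defect n := by simp [defect]

lemma one_sub_defect_add (n : ℕ) : 1 - defect n + defect n = 1 := by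
  refine tsub_add_cancel_of_le ?_
  rw [defect, ENNReal.inv_le_one]
  exact_mod_cast Nat.le_add_left 1 (n + 1)

lemma tendsto_defect : Tendsto (fun n => (defect n).toReal) atTop (𝓝 0) := by
  have h := (tendsto_inv_atTop_nhds_zero_nat (𝕜 := ℝ)).comp (tendsto_add_atTop_nat 2)
  refine h.congr fun n => ?_
  rw [defect, ENNReal.toReal_inv, ENNReal.toReal_natCast]
  rfl

variable {P : Measure X} {Q : Measure Y} {k : X → Y → ℝ≥0∞}

lemma measurable_dualPot [SFinite P] [SFinite Q] {c : ℝ≥0∞} (hk : Measurable (Function.uncurry k)) :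
    Measurable (dualPot P Q k c) := by
  have hm := measurable_pot (P := P) (Q := Q) (c := c) hk
  have h1 : Measurable fun y => ∫⁻ z, k z y * (pot P Q k c z)⁻¹ ∂P :=
    Measurable.lintegral_prod_left' (f := fun q : X × Y => k q.1 q.2 * (pot P Q k c q.1)⁻¹)
      (by fun_prop)
  unfold dualPot
  fun_prop

lemma measurable_approxDensity [SFinite P] [SFinite Q] (hk : Measurable (Function.uncurry k))
    (n : ℕ) : Measurable (Function.uncurry (approxDensity P Q k n)) := by
  have hm := measurable_pot (P := P) (Q := Q) (c := 1 - defect n) hk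
  have hm' := measurable_dualPot (P := P) (Q := Q) (c := 1 - defect n) hk
  unfold approxDensity Function.uncurry
  fun_prop

lemma IsApproxCoupling.mono {δ δ' : ℝ} {π : Measure (X × Y)} (h : IsApproxCoupling P Q δ π)
    (hδ : δ ≤ δ') : IsApproxCoupling P Q δ' π :=
  ⟨h.finite, h.fst_le, fun S hS => by linarith [h.le_fst S hS], h.snd_le,
    fun S hS => by linarith [h.le_snd S hS]⟩

variable [IsProbabilityMeasure P] [IsProbabilityMeasure Q]

lemma dualPot_lt_top (hk : Measurable (Function.uncurry k)) (hk0 : ∀ x y, 0 < k x y) (n : ℕ)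
    (y : Y) : dualPot P Q k (1 - defect n) y < ∞ :=
  ENNReal.mul_lt_top (tsub_le_self.trans_lt ENNReal.one_lt_top) (ENNReal.inv_lt_top.2
    (lintegral_mul_inv_pot_pos hk hk0 (defect_pos n) (one_sub_defect_add n) y))

lemma approxDensity_lt_top (hk : Measurable (Function.uncurry k)) (hk0 : ∀ x y, 0 < k x y)
    (hk1 : ∀ x y, k x y ≤ 1) (n : ℕ) (x : X) (y : Y) : approxDensity P Q k n x y < ∞ := by
  refine ENNReal.mul_lt_top (ENNReal.mul_lt_top ((hk1 x y).trans_lt ENNReal.one_lt_top) ?_)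
    (dualPot_lt_top hk hk0 n y)
  exact (ENNReal.inv_le_one.2 (one_le_pot x)).trans_lt ENNReal.one_lt_top

/-- The fixed point equation u⁻¹ (1 + c S(u)) = 1 says that the first marginal is P minus u⁻¹ P,
which misses mass δ; the choice of the dual factor makes the second marginal equal to c Q. -/
lemma isApproxCoupling_approxDensity (hk : Measurable (Function.uncurry k))
    (hk0 : ∀ x y, 0 < k x y) (hk1 : ∀ x y, k x y ≤ 1) (n : ℕ) :
    IsApproxCoupling P Q (defect n).toReal (prodForm P Q k (fun x => (pot P Q k (1 - defect n) x)⁻¹)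
      (dualPot P Q k (1 - defect n))) := by
  have hδ := defect_pos n
  have hc := one_sub_defect_add n
  set δ := defect n
  set c := 1 - δ
  have hcT : c ≠ ∞ := fun h => by simp [h] at hc
  have hδT : δ ≠ ∞ := fun h => by simp [h] at hc
  have hm := measurable_pot (P := P) (Q := Q) (c := c) hk
  have hm' := measurable_dualPot (P := P) (Q := Q) (c := c) hk
  have hmS := measurable_sinkhornStep (P := P) (Q := Q) hk hm
  set π := prodForm P Q k (fun x => (pot P Q k c x)⁻¹) (dualPot P Q k c) with hπ
  have h1 : ∀ S, MeasurableSet S → π (S ×ˢ univ) + ∫⁻ x in S, (pot P Q k c x)⁻¹ ∂P = P S := by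
    intro S hS
    rw [hπ, prodForm_prod hk (by fun_prop) hm' hS .univ, ← lintegral_add_right _ (by fun_prop),
      ← setLIntegral_one]
    refine setLIntegral_congr_fun_ae hS ?_
    filter_upwards [pot_lt_top (P := P) (Q := Q) hk hk0 hk1 hδ hc] with x hx _
    have : ∫⁻ y in univ, k x y * (pot P Q k c x)⁻¹ * dualPot P Q k c y ∂Q =
        (pot P Q k c x)⁻¹ * (c * sinkhornStep P Q k (pot P Q k c) x) := by
      have h1 : Measurable fun y => ∫⁻ z, k z y * (pot P Q k c z)⁻¹ ∂P :=
        Measurable.lintegral_prod_left' (f := fun q : X × Y => k q.1 q.2 * (pot P Q k c q.1)⁻¹)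
          (by fun_prop)
      rw [setLIntegral_univ, sinkhornStep, ← lintegral_const_mul _ (by fun_prop),
        ← lintegral_const_mul _ (by fun_prop)]
      refine lintegral_congr fun y => ?_
      rw [dualPot]
      ring
    rw [this]
    calc _ = (pot P Q k c x)⁻¹ * (1 + c * sinkhornStep P Q k (pot P Q k c) x) := by ring
      _ = 1 := by
        rw [← pot_eq hk hk1]
        exact ENNReal.inv_mul_cancel (zero_lt_one.trans_le (one_le_pot _)).ne' hx.ne
  have h2 : ∀ S, MeasurableSet S → π (univ ×ˢ S) = c * Q S := by
    intro S hS
    rw [hπ, prodForm_prod hk (by fun_prop) hm' .univ hS, lintegral_lintegral_swap (by fun_prop),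
      ← setLIntegral_const]
    refine lintegral_congr fun y => ?_
    rw [setLIntegral_univ, lintegral_mul_const _ (by fun_prop), dualPot, mul_comm c, ← mul_assoc,
      ENNReal.mul_inv_cancel (lintegral_mul_inv_pot_pos hk hk0 hδ hc y).ne'
      ((lintegral_inv_mul_le_one hk1 one_le_pot y).trans_lt ENNReal.one_lt_top).ne, one_mul]
  have hint : ∀ S, ∫⁻ x in S, (pot P Q k c x)⁻¹ ∂P ≤ δ := fun S =>
    (setLIntegral_le_lintegral _ _).trans (lintegral_inv_pot hk hk0 hk1 hδ hc).le
  have hfin : IsFiniteMeasure π := by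
    refine ⟨?_⟩
    rw [← univ_prod_univ, h2 univ .univ]
    exact ENNReal.mul_lt_top hcT.lt_top (measure_lt_top _ _)
  have hcr : c.toReal + δ.toReal = 1 := by
    rw [← ENNReal.toReal_add hcT hδT, hc, ENNReal.toReal_one]
  have hδ0 : 0 ≤ δ.toReal := ENNReal.toReal_nonneg
  have h1r : ∀ S, MeasurableSet S →
      π.real (S ×ˢ univ) + (∫⁻ x in S, (pot P Q k c x)⁻¹ ∂P).toReal = P.real S := by
    intro S hS
    rw [measureReal_def, measureReal_def, ← h1 S hS,
      ENNReal.toReal_add (measure_ne_top _ _) ((hint S).trans_lt hδT.lt_top).ne]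
  have h2r : ∀ S, MeasurableSet S → π.real (univ ×ˢ S) = c.toReal * Q.real S := by
    intro S hS
    rw [measureReal_def, h2 S hS, ENNReal.toReal_mul, measureReal_def]
  refine ⟨hfin, fun S hS => ?_, fun S hS => ?_, fun S hS => ?_, fun S hS => ?_⟩
  · have := h1r S hS
    have : 0 ≤ (∫⁻ x in S, (pot P Q k c x)⁻¹ ∂P).toReal := ENNReal.toReal_nonneg
    linarith
  · have := h1r S hS
    have := ENNReal.toReal_mono hδT (hint S)
    linarith
  · rw [h2r S hS]
    have : 0 ≤ Q.real S := measureReal_nonneg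
    nlinarith
  · rw [h2r S hS]
    have : 0 ≤ Q.real S := measureReal_nonneg
    have : Q.real S ≤ 1 := measureReal_le_one
    nlinarith

omit [MeasurableSpace Y] [IsProbabilityMeasure Q] in
lemma exists_le_real_setOf_le {ρ : X → ℝ≥0∞} (hρ0 : ∀ x, 0 < ρ x) {ε : ℝ}
    (hε : 0 < ε) : ∃ r : ℝ, 0 < r ∧ 1 - ε ≤ P.real {x | ENNReal.ofReal r ≤ ρ x} := by
  have hmono : Monotone fun n : ℕ => {x | ENNReal.ofReal (1 / ((n : ℝ) + 1)) ≤ ρ x} := by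
    intro m n hmn x hx
    simp only [mem_ofPred_eq] at hx ⊢
    exact (ENNReal.ofReal_le_ofReal (Nat.one_div_le_one_div (α := ℝ) hmn)).trans hx
  have hU : ⋃ n : ℕ, {x | ENNReal.ofReal (1 / ((n : ℝ) + 1)) ≤ ρ x} = univ := by
    refine eq_univ_of_forall fun x => mem_iUnion.2 ?_
    obtain ⟨s, hs, hsx⟩ := ENNReal.lt_iff_exists_nnreal_btwn.1 (hρ0 x)
    have hs0 : (0 : ℝ) < s := by exact_mod_cast hs
    obtain ⟨n, hn⟩ := exists_nat_one_div_lt hs0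
    refine ⟨n, le_trans ?_ hsx.le⟩
    rw [ENNReal.ofReal_le_iff_le_toReal ENNReal.coe_ne_top]
    exact hn.le
  have ht := tendsto_measure_iUnion_atTop (μ := P) hmono
  rw [hU] at ht
  have ht' := (ENNReal.tendsto_toReal (measure_ne_top P _)).comp ht
  have : (1 - ε) < (P univ).toReal := by simpa using hε
  obtain ⟨n, hn⟩ := (ht'.eventually (eventually_ge_nhds this)).exists
  exact ⟨_, Nat.one_div_pos_of_nat, hn⟩

/-- The approximate densities form a Cauchy sequence in `L¹(P ⊗ Q)`. -/
theorem exists_lintegral_sub_approxDensity_le (hk : Measurable (Function.uncurry k))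
    (hk1 : ∀ x y, k x y ≤ 1) {ρ : X → ℝ≥0∞} {σ : Y → ℝ≥0∞} (hρ : Measurable ρ) (hσ : Measurable σ)
    (hρ0 : ∀ x, 0 < ρ x) (hσ0 : ∀ y, 0 < σ y) (hρσ : ∀ x y, ρ x * σ y ≤ k x y) {ε : ℝ}
    (hε : 0 < ε) :
    ∃ N, ∀ n ≥ N, ∀ m ≥ N, ∫⁻ q, (approxDensity P Q k n q.1 q.2 - approxDensity P Q k m q.1 q.2)
      ∂(P.prod Q) ≤ ENNReal.ofReal ε := by
  have hk0 : ∀ x y, 0 < k x y := fun x y =>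
    (ENNReal.mul_pos (hρ0 x).ne' (hσ0 y).ne').trans_le (hρσ x y)
  -- Budget: 3θ ≤ ε/4 and 2(ε₁ + κ) ≤ 4ε₁ ≤ ε/2. The sets K and L miss at most ε₁/8 each, so A and B
  -- miss at most 2δ + 4 (ε₁/8) ≤ ε₁.
  set θ := min (ε / 12) (1 / 2) with hθdef
  have hθ : 0 < θ := by positivity
  have hθ1 : θ < 1 := (min_le_right _ _).trans_lt (by norm_num)
  set ε₁ := min (ε / 8) (1 / 6) with hε₁
  have hε₁0 : 0 < ε₁ := by positivity
  obtain ⟨r, hr, hPr⟩ := exists_le_real_setOf_le (P := P) hρ0 (ε := ε₁ / 8) (by positivity)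
  obtain ⟨s, hs, hQs⟩ := exists_le_real_setOf_le (P := Q) hσ0 (ε := ε₁ / 8) (by positivity)
  -- This lower bound for the density does not depend on the index n, which is why the estimate is
  -- uniform as the defect tends to 0.
  set c := (r * s) ^ 2 / 4 with hc
  have hc0 : 0 < c := by positivity
  have hev : ∀ᶠ n in atTop, (defect n).toReal < min (ε₁ / 4) (c * θ * ε₁ / 9) :=
    tendsto_defect.eventually (gt_mem_nhds (by positivity))
  obtain ⟨N, hN⟩ := eventually_atTop.1 hev
  refine ⟨N, fun n hn m hm => ?_⟩
  set δ := min (ε₁ / 4) (c * θ * ε₁ / 9) with hδ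
  have hπn := (isApproxCoupling_approxDensity (P := P) (Q := Q) hk hk0 hk1 n).mono (hN n hn).le
  have hπm := (isApproxCoupling_approxDensity (P := P) (Q := Q) hk hk0 hk1 m).mono (hN m hm).le
  have hmeas : ∀ n, Measurable fun x => (pot P Q k (1 - defect n) x)⁻¹ :=
    fun n => (measurable_pot hk).inv
  have hpos : ∀ n, ∀ᵐ x ∂P, (pot P Q k (1 - defect n) x)⁻¹ ≠ 0 ∧
      (pot P Q k (1 - defect n) x)⁻¹ ≠ ∞ := by
    intro n
    filter_upwards [pot_lt_top (P := P) (Q := Q) hk hk0 hk1 (defect_pos n)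
      (one_sub_defect_add n)] with x hx
    exact ⟨ENNReal.inv_ne_zero.2 hx.ne,
      ENNReal.inv_ne_top.2 (zero_lt_one.trans_le (one_le_pot _)).ne'⟩
  obtain ⟨A, B, hA, hB, hPA, hQB, hAB⟩ := hπn.exists_le_density hk hk1 (hmeas n)
    (measurable_dualPot hk) (K := {x | ENNReal.ofReal r ≤ ρ x}) (L := {y | ENNReal.ofReal s ≤ σ y})
    (hρ measurableSet_Ici) (hσ measurableSet_Ici) (c := r * s) (ε := ε₁ / 8) (by positivity)
    (fun x hx y hy => by
      rw [ENNReal.ofReal_mul hr.le]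
      exact (mul_le_mul' hx hy).trans (hρσ x y)) hPr hQs
  have hδ1 : δ ≤ ε₁ / 4 := min_le_left _ _
  have hδ2 : δ ≤ c * θ * ε₁ / 9 := min_le_right _ _
  have hκ : 9 * δ / (c * θ) ≤ ε₁ := by
    rw [div_le_iff₀ (by positivity)]
    linarith
  have h6 : ε₁ ≤ 1 / 6 := min_le_right _ _
  have := lintegral_sub_prodForm_le hk (hmeas n) (hmeas m) (measurable_dualPot hk)
    (measurable_dualPot hk) (hpos n) (hpos m) hπn hπm hA hB hc0 h6 (by linarith) (by linarith)
    hAB hθ hθ1 (hκ.trans h6)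
  refine this.trans (ENNReal.ofReal_le_ofReal ?_)
  have : θ ≤ ε / 12 := min_le_left _ _
  have : ε₁ ≤ ε / 8 := min_le_left _ _
  linarith

/-- An almost everywhere limit of approximate densities solves the Schrödinger system. -/
theorem exists_factors_of_tendsto (hk : Measurable (Function.uncurry k))
    (hk1 : ∀ x y, k x y ≤ 1) {ρ : X → ℝ≥0∞} {σ : Y → ℝ≥0∞} (hρ : Measurable ρ) (hσ : Measurable σ)
    (hρ0 : ∀ x, 0 < ρ x) (hσ0 : ∀ y, 0 < σ y) (hρσ : ∀ x y, ρ x * σ y ≤ k x y)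
    {w : X → Y → ℝ≥0∞} (hw : Measurable (Function.uncurry w)) {ns : ℕ → ℕ}
    (hns : Tendsto ns atTop atTop)
    (hlim : ∀ᵐ q ∂(P.prod Q), Tendsto (fun j => approxDensity P Q k (ns j) q.1 q.2) atTop
      (𝓝 (w q.1 q.2))) :
    ∃ ψ : X → ℝ≥0∞, ∃ χ : Y → ℝ≥0∞, Measurable ψ ∧ Measurable χ ∧
      (∀ᵐ q ∂(P.prod Q), w q.1 q.2 = k q.1 q.2 * ψ q.1 * χ q.2) ∧
      (∀ᵐ x ∂P, ψ x * ∫⁻ y, k x y * χ y ∂Q = 1) ∧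
      (∀ᵐ y ∂Q, χ y * ∫⁻ x, k x y * ψ x ∂P = 1) := by
  have hk0 : ∀ x y, 0 < k x y := fun x y =>
    (ENNReal.mul_pos (hρ0 x).ne' (hσ0 y).ne').trans_le (hρσ x y)
  have hwn := fun n => measurable_approxDensity (P := P) (Q := Q) hk n
  set W : ℕ → X × Y → ℝ≥0∞ := fun n q => approxDensity P Q k n q.1 q.2 with hW
  have hWm : ∀ n, Measurable (W n) := hwn
  set w' : X × Y → ℝ≥0∞ := fun q => w q.1 q.2 with hw'
  have hwm : Measurable w' := hw
  have hWfin : ∀ n q, W n q ≠ ∞ := fun n q => (approxDensity_lt_top hk hk0 hk1 n q.1 q.2).ne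
  -- closeness in `L¹`
  have hclose : ∀ ε : ℝ, 0 < ε → ∀ᶠ n in atTop,
      ∫⁻ q, (W n q - w' q) ∂(P.prod Q) ≤ ENNReal.ofReal ε ∧
      ∫⁻ q, (w' q - W n q) ∂(P.prod Q) ≤ ENNReal.ofReal ε := by
    intro ε hε
    obtain ⟨N, hN⟩ := exists_lintegral_sub_approxDensity_le (P := P) (Q := Q) hk hk1 hρ hσ hρ0 hσ0
      hρσ hε
    filter_upwards [eventually_ge_atTop N] with n hn
    constructor
    -- Fatou's lemma along the subsequence transfers the Cauchy bound to the limit, here and in the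
    -- symmetric case.
    · calc ∫⁻ q, (W n q - w' q) ∂(P.prod Q)
          = ∫⁻ q, liminf (fun j => W n q - W (ns j) q) atTop ∂(P.prod Q) := by
            refine lintegral_congr_ae ?_
            filter_upwards [hlim] with q hq
            exact ((ENNReal.Tendsto.sub tendsto_const_nhds hq (Or.inl (hWfin n q))).liminf_eq).symm
        _ ≤ liminf (fun j => ∫⁻ q, (W n q - W (ns j) q) ∂(P.prod Q)) atTop :=
            lintegral_liminf_le fun j => (hWm n).sub (hWm _)
        _ ≤ _ := by
            refine liminf_le_of_frequently_le' (Eventually.frequently ?_)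
            filter_upwards [hns.eventually_ge_atTop N] with j hj using hN n hn _ hj
    · calc ∫⁻ q, (w' q - W n q) ∂(P.prod Q)
          = ∫⁻ q, liminf (fun j => W (ns j) q - W n q) atTop ∂(P.prod Q) := by
            refine lintegral_congr_ae ?_
            filter_upwards [hlim] with q hq
            exact ((ENNReal.Tendsto.sub hq tendsto_const_nhds (Or.inr (hWfin n q))).liminf_eq).symm
        _ ≤ liminf (fun j => ∫⁻ q, (W (ns j) q - W n q) ∂(P.prod Q)) atTop :=
            lintegral_liminf_le fun j => (hWm _).sub (hWm n)
        _ ≤ _ := by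
            refine liminf_le_of_frequently_le' (Eventually.frequently ?_)
            filter_upwards [hns.eventually_ge_atTop N] with j hj using hN _ hj n hn
  -- If the approximate masses of Z are within the defect of z, the limit gives Z the mass z. On
  -- cylinders this yields exact marginals.
  have hset : ∀ (Z : Set (X × Y)) (z : ℝ), MeasurableSet Z → 0 ≤ z →
      (∀ n, |((P.prod Q).withDensity (W n)).real Z - z| ≤ (defect n).toReal) →
      ∫⁻ q in Z, w' q ∂(P.prod Q) = ENNReal.ofReal z := by
    intro Z z hZ hz0 hz
    have hWn : ∀ n, ENNReal.ofReal (((P.prod Q).withDensity (W n)).real Z) =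
        ∫⁻ q in Z, W n q ∂(P.prod Q) := by
      intro n
      have : IsFiniteMeasure ((P.prod Q).withDensity (W n)) :=
        (isApproxCoupling_approxDensity (P := P) (Q := Q) hk hk0 hk1 n).finite
      rw [ofReal_measureReal, withDensity_apply _ hZ]
    refine le_antisymm ?_ ?_
    · refine ENNReal.le_of_forall_pos_le_add fun ε hε _ => ?_
      have hε' : (0 : ℝ) < ε / 2 := by positivity
      obtain ⟨n, ⟨-, h2⟩, h3⟩ := ((hclose _ hε').and
        (tendsto_defect.eventually (gt_mem_nhds hε'))).exists
      calc ∫⁻ q in Z, w' q ∂(P.prod Q)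
          ≤ ∫⁻ q in Z, (W n q + (w' q - W n q)) ∂(P.prod Q) :=
            lintegral_mono fun q => le_add_tsub
        _ = ∫⁻ q in Z, W n q ∂(P.prod Q) + ∫⁻ q in Z, (w' q - W n q) ∂(P.prod Q) :=
            lintegral_add_left (hWm n) _
        _ ≤ ENNReal.ofReal (z + ε / 2) + ENNReal.ofReal (ε / 2) := by
            gcongr
            · rw [← hWn]
              refine ENNReal.ofReal_le_ofReal ?_
              linarith [(abs_le.1 (hz n)).2]
            · exact (setLIntegral_le_lintegral _ _).trans h2
        _ = ENNReal.ofReal z + ε := by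
            rw [ENNReal.ofReal_add hz0 hε'.le, add_assoc, ← ENNReal.ofReal_add hε'.le hε'.le,
              add_halves, ENNReal.ofReal_coe_nnreal]
    · refine ENNReal.le_of_forall_pos_le_add fun ε hε _ => ?_
      have hε' : (0 : ℝ) < ε / 2 := by positivity
      obtain ⟨n, ⟨h2, -⟩, h3⟩ := ((hclose _ hε').and
        (tendsto_defect.eventually (gt_mem_nhds hε'))).exists
      calc ENNReal.ofReal z
          ≤ ENNReal.ofReal (((P.prod Q).withDensity (W n)).real Z + ε / 2) := by
            refine ENNReal.ofReal_le_ofReal ?_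
            linarith [(abs_le.1 (hz n)).1]
        _ = ∫⁻ q in Z, W n q ∂(P.prod Q) + ENNReal.ofReal (ε / 2) := by
            rw [ENNReal.ofReal_add measureReal_nonneg hε'.le, hWn]
        _ ≤ ∫⁻ q in Z, (w' q + (W n q - w' q)) ∂(P.prod Q) + ENNReal.ofReal (ε / 2) := by
            gcongr with q
            exact le_add_tsub
        _ = ∫⁻ q in Z, w' q ∂(P.prod Q) + ∫⁻ q in Z, (W n q - w' q) ∂(P.prod Q) +
            ENNReal.ofReal (ε / 2) := by rw [lintegral_add_left hwm]
        _ ≤ ∫⁻ q in Z, w' q ∂(P.prod Q) + ENNReal.ofReal (ε / 2) + ENNReal.ofReal (ε / 2) := by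
            gcongr
            exact (setLIntegral_le_lintegral _ _).trans h2
        _ = _ := by
            rw [add_assoc, ← ENNReal.ofReal_add hε'.le hε'.le, add_halves,
              ENNReal.ofReal_coe_nnreal]
  have marg1 : ∀ᵐ x ∂P, ∫⁻ y, w x y ∂Q = 1 := by
    have hm : Measurable fun x => ∫⁻ y, w x y ∂Q :=
      Measurable.lintegral_prod_right' (f := w') hwm
    refine ae_eq_of_forall_setLIntegral_eq_of_sigmaFinite hm measurable_const fun S hS _ => ?_
    have := hset (S ×ˢ univ) (P.real S) (hS.prod .univ) measureReal_nonneg fun n => by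
      have h := isApproxCoupling_approxDensity (P := P) (Q := Q) hk hk0 hk1 n
      have h1 := h.fst_le S hS
      have h2 := h.le_fst S hS
      simp only [prodForm] at h1 h2
      simp only [hW, approxDensity]
      rw [abs_le]
      constructor <;> linarith [ENNReal.toReal_nonneg (a := defect n)]
    rw [← Measure.prod_restrict, Measure.restrict_univ, lintegral_prod _ hwm.aemeasurable,
      ofReal_measureReal] at this
    rw [setLIntegral_one, ← this]
  have marg2 : ∀ᵐ y ∂Q, ∫⁻ x, w x y ∂P = 1 := by
    have hm : Measurable fun y => ∫⁻ x, w x y ∂P :=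
      Measurable.lintegral_prod_left' (f := w') hwm
    refine ae_eq_of_forall_setLIntegral_eq_of_sigmaFinite hm measurable_const fun S hS _ => ?_
    have := hset (univ ×ˢ S) (Q.real S) (MeasurableSet.univ.prod hS) measureReal_nonneg fun n => by
      have h := isApproxCoupling_approxDensity (P := P) (Q := Q) hk hk0 hk1 n
      have h1 := h.snd_le S hS
      have h2 := h.le_snd S hS
      simp only [prodForm] at h1 h2
      simp only [hW, approxDensity]
      rw [abs_le]
      constructor <;> linarith [ENNReal.toReal_nonneg (a := defect n)]
    rw [← Measure.prod_restrict, Measure.restrict_univ, lintegral_prod_symm _ hwm.aemeasurable,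
      ofReal_measureReal] at this
    rw [setLIntegral_one, ← this]
  -- factorisation
  have hprod : ∃ ψ : X → ℝ≥0∞, ∃ χ : Y → ℝ≥0∞, Measurable ψ ∧ Measurable χ ∧
      (∀ᵐ q ∂(P.prod Q), w q.1 q.2 = k q.1 q.2 * ψ q.1 * χ q.2) := by
    set g : X → Y → ℝ≥0∞ := fun x y => w x y / k x y with hg
    have hgm : Measurable (Function.uncurry g) := hw.div hk
    have hkT : ∀ x y, k x y ≠ ∞ := fun x y => ((hk1 x y).trans_lt ENNReal.one_lt_top).ne
    have hx : ∀ᵐ x ∂P, ∀ᵐ y ∂Q, Tendsto (fun j => approxDensity P Q k (ns j) x y) atTop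
      (𝓝 (w x y)) := Measure.ae_ae_of_ae_prod hlim
    have hy : ∀ᵐ y ∂Q, ∀ᵐ x ∂P, Tendsto (fun j => approxDensity P Q k (ns j) x y) atTop
      (𝓝 (w x y)) := by
      have := Measure.measurePreserving_swap.quasiMeasurePreserving.ae (μa := Q.prod P) hlim
      exact Measure.ae_ae_of_ae_prod this
    have hwT : ∀ᵐ x ∂P, ∀ᵐ y ∂Q, w x y < ∞ := by
      filter_upwards [marg1] with x hx1
      exact ae_lt_top (hw.comp measurable_prodMk_left) (by rw [hx1]; exact ENNReal.one_ne_top)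
    have hwT' : ∀ᵐ y ∂Q, ∀ᵐ x ∂P, w x y < ∞ := by
      filter_upwards [marg2] with y hy1
      exact ae_lt_top (hw.comp measurable_prodMk_right) (by rw [hy1]; exact ENNReal.one_ne_top)
    obtain ⟨x₀, hx₀, hx₁, hx₂⟩ := (hx.and (marg1.and hwT)).exists
    -- The base point (x₀, y₀) must have w positive and finite there, so that one may divide by the
    -- limit.
    have hfr : ∃ᶠ y in ae Q, w x₀ y ≠ 0 := by
      intro h
      rw [lintegral_congr_ae (g := fun _ => 0) (h.mono fun y hy => by simpa using hy)] at hx₁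
      simp at hx₁
    obtain ⟨y₀, hw0, hy₀, hy₁, hx₀y₀, hwlt⟩ :=
      (hfr.and_eventually (hy.and (hwT'.and (hx₀.and hx₂)))).exists
    set a : ℕ → X → ℝ≥0∞ := fun j x => (pot P Q k (1 - defect (ns j)) x)⁻¹ with ha
    set b : ℕ → Y → ℝ≥0∞ := fun j => dualPot P Q k (1 - defect (ns j)) with hb
    have conv : ∀ x y, Tendsto (fun j => approxDensity P Q k (ns j) x y) atTop (𝓝 (w x y)) →
        Tendsto (fun j => a j x * b j y) atTop (𝓝 (g x y)) := by
      intro x y h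
      have := ENNReal.Tendsto.div_const h (b := k x y) (Or.inr (hk0 x y).ne')
      refine this.congr fun j => ?_
      rw [approxDensity, mul_assoc, mul_comm, mul_div_assoc,
        ENNReal.div_self (hk0 x y).ne' (hkT x y), mul_one]
    have hg0 : g x₀ y₀ ≠ 0 := ENNReal.div_ne_zero.2 ⟨hw0, hkT _ _⟩
    have hgT : g x₀ y₀ ≠ ∞ := ENNReal.div_ne_top hwlt.ne (hk0 _ _).ne'
    refine ⟨fun x => g x y₀, fun y => g x₀ y / g x₀ y₀, hgm.comp measurable_prodMk_right,
      (hgm.comp measurable_prodMk_left).div_const _, ?_⟩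
    have e1 : ∀ᵐ q ∂(P.prod Q), w q.1 y₀ < ∞ ∧ Tendsto
        (fun j => approxDensity P Q k (ns j) q.1 y₀) atTop (𝓝 (w q.1 y₀)) :=
      Measure.quasiMeasurePreserving_fst.ae (hy₁.and hy₀)
    have e2 : ∀ᵐ q ∂(P.prod Q), w x₀ q.2 < ∞ ∧ Tendsto
        (fun j => approxDensity P Q k (ns j) x₀ q.2) atTop (𝓝 (w x₀ q.2)) :=
      Measure.quasiMeasurePreserving_snd.ae (hx₂.and hx₀)
    filter_upwards [hlim, e1, e2] with q hq hq1 hq2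
    have t1 := conv _ _ hq
    have t2 := conv _ _ hq1.2
    have t3 := conv _ _ hq2.2
    have t4 := conv _ _ hx₀y₀
    have hf2 : g q.1 y₀ ≠ ∞ := ENNReal.div_ne_top hq1.1.ne (hk0 _ _).ne'
    have hf3 : g x₀ q.2 ≠ ∞ := ENNReal.div_ne_top hq2.1.ne (hk0 _ _).ne'
    -- The functions a_j and b_j need not converge separately. The identity a(x) b(y) = a(x) b(y₀) ·
    -- a(x₀) b(y) / (a(x₀) b(y₀)) involves products only, and it survives in the limit.
    have t5 : Tendsto (fun j => a j q.1 * b j y₀ * ((a j x₀ * b j q.2) / (a j x₀ * b j y₀))) atTop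
        (𝓝 (g q.1 y₀ * (g x₀ q.2 / g x₀ y₀))) := by
      refine ENNReal.Tendsto.mul t2 (Or.inr ?_) (ENNReal.Tendsto.div t3 (Or.inr hg0) t4 (Or.inr hf3))
        (Or.inr hf2)
      exact ENNReal.div_ne_top hf3 hg0
    have t6 : Tendsto (fun j => a j q.1 * b j y₀ * ((a j x₀ * b j q.2) / (a j x₀ * b j y₀))) atTop
        (𝓝 (g q.1 q.2)) := by
      refine t1.congr' ?_
      filter_upwards [t4.eventually_ne hg0] with j hj
      have hb0 : b j y₀ ≠ 0 := right_ne_zero_of_mul hj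
      have ha0 : a j x₀ ≠ 0 := left_ne_zero_of_mul hj
      have hbT : b j y₀ ≠ ∞ := (dualPot_lt_top hk hk0 _ _).ne
      have haT : a j x₀ ≠ ∞ := ENNReal.inv_ne_top.2 (zero_lt_one.trans_le (one_le_pot _)).ne'
      rw [ENNReal.mul_div_mul_left _ _ ha0 haT, div_eq_mul_inv]
      calc a j q.1 * b j q.2 = a j q.1 * b j q.2 * (b j y₀ * (b j y₀)⁻¹) := by
            rw [ENNReal.mul_inv_cancel hb0 hbT, mul_one]
        _ = _ := by ring
    have := tendsto_nhds_unique t6 t5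
    rw [mul_assoc, ← this, hg, ENNReal.mul_div_cancel (hk0 _ _).ne' (hkT _ _)]
  obtain ⟨ψ, χ, hψ, hχ, hfac⟩ := hprod
  refine ⟨ψ, χ, hψ, hχ, hfac, ?_, ?_⟩
  · filter_upwards [marg1, Measure.ae_ae_of_ae_prod hfac] with x hx hx2
    rw [← hx, ← lintegral_const_mul _ (by fun_prop)]
    refine lintegral_congr_ae ?_
    filter_upwards [hx2] with y hy
    rw [hy]
    ring
  · have hfac' := Measure.measurePreserving_swap.quasiMeasurePreserving.ae (μa := Q.prod P) hfac
    filter_upwards [marg2, Measure.ae_ae_of_ae_prod hfac'] with y hy hy2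
    rw [← hy, ← lintegral_const_mul _ (by fun_prop)]
    refine lintegral_congr_ae ?_
    filter_upwards [hy2] with x hx
    simp only [Prod.swap] at hx
    rw [hx]
    ring

end Limit

end CondSchrodinger

/-! ### Solutions depending measurably on a parameter -/

namespace CondSchrodinger

open Filter Topology Set ProbabilityTheory

section Parametric

variable {T X Y : Type*} [MeasurableSpace T] [MeasurableSpace X] [MeasurableSpace Y]
  {P : Kernel T X} {Q : Kernel T Y} [IsMarkovKernel P] [IsMarkovKernel Q]
  {k : T → X → Y → ℝ≥0∞}

lemma measurable_lintegral_fst_kernel {Z : Type*} [MeasurableSpace Z] {R : Kernel T Z}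
    [IsSFiniteKernel R] {A : Type*} [MeasurableSpace A] {f : T × A → Z → ℝ≥0∞}
    (hf : Measurable (Function.uncurry f)) : Measurable fun a => ∫⁻ z, f a z ∂(R a.1) :=
  hf.lintegral_kernel_prod_right (κ := R.comap Prod.fst measurable_fst)

omit [IsMarkovKernel Q] in
lemma measurable_lintegral_mul_inv {u : T → X → ℝ≥0∞}
    (hk : Measurable fun q : T × X × Y => k q.1 q.2.1 q.2.2)
    (hu : Measurable fun q : T × X => u q.1 q.2) :
    Measurable fun q : T × Y => ∫⁻ z, k q.1 z q.2 * (u q.1 z)⁻¹ ∂(P q.1) := by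
  refine measurable_lintegral_fst_kernel (R := P)
    (f := fun q z => k q.1 z q.2 * (u q.1 z)⁻¹) ?_
  have h1 : Measurable fun q : (T × Y) × X => k q.1.1 q.2 q.1.2 :=
    hk.comp
      (f := fun q : (T × Y) × X => (q.1.1, q.2, q.1.2)) (by fun_prop)
  have h2 : Measurable fun q : (T × Y) × X => u q.1.1 q.2 :=
    hu.comp (f := fun q : (T × Y) × X => (q.1.1, q.2)) (by fun_prop)
  unfold Function.uncurry
  fun_prop

lemma measurable_potIter_param (hk : Measurable fun q : T × X × Y => k q.1 q.2.1 q.2.2) (c : ℝ≥0∞)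
    (n : ℕ) : Measurable fun q : T × X => potIter (P q.1) (Q q.1) (k q.1) c n q.2 := by
  induction n with
  | zero => exact measurable_const
  | succ n ih =>
    simp only [potIter]
    have h1 := measurable_lintegral_mul_inv (P := P) (u := fun t x =>
      potIter (P t) (Q t) (k t) c n x) hk ih
    have h2 : Measurable fun q : T × X =>
        sinkhornStep (P q.1) (Q q.1) (k q.1) (potIter (P q.1) (Q q.1) (k q.1) c n) q.2 := by
      unfold sinkhornStep
      refine measurable_lintegral_fst_kernel (R := Q) (f := fun q y => k q.1 q.2 y *
        (∫⁻ z, k q.1 z y * (potIter (P q.1) (Q q.1) (k q.1) c n z)⁻¹ ∂(P q.1))⁻¹) ?_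
      have m1 : Measurable fun q : (T × X) × Y => k q.1.1 q.1.2 q.2 :=
        hk.comp
          (f := fun q : (T × X) × Y => (q.1.1, q.1.2, q.2)) (by fun_prop)
      have m2 := h1.comp (f := fun q : (T × X) × Y => (q.1.1, q.2)) (by fun_prop)
      exact m1.mul m2.inv
    fun_prop

lemma measurable_pot_param (hk : Measurable fun q : T × X × Y => k q.1 q.2.1 q.2.2) (c : ℝ≥0∞) :
    Measurable fun q : T × X => pot (P q.1) (Q q.1) (k q.1) c q.2 :=
  Measurable.iSup fun n => measurable_potIter_param hk c n

lemma measurable_approxDensity_param (hk : Measurable fun q : T × X × Y => k q.1 q.2.1 q.2.2)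
    (n : ℕ) : Measurable fun q : T × X × Y =>
      approxDensity (P q.1) (Q q.1) (k q.1) n q.2.1 q.2.2 := by
  have h1 := measurable_pot_param (P := P) (Q := Q) hk (1 - defect n)
  have h2 := measurable_lintegral_mul_inv (P := P) (u := fun t x =>
      pot (P t) (Q t) (k t) (1 - defect n) x) hk h1
  have m1 := h1.comp (f := fun q : T × X × Y => (q.1, q.2.1)) (by fun_prop)
  have m2 := h2.comp (f := fun q : T × X × Y => (q.1, q.2.2)) (by fun_prop)
  unfold approxDensity dualPot
  exact (hk.mul m1.inv).mul (m2.inv.const_mul _)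

lemma enorm_toReal_sub_toReal {a b : ℝ≥0∞} (ha : a ≠ ∞) (hb : b ≠ ∞) :
    ‖a.toReal - b.toReal‖ₑ = (a - b) + (b - a) := by
  rcases le_total a b with h | h
  · rw [tsub_eq_zero_of_le h, zero_add, ← enorm_neg, neg_sub, ← ENNReal.toReal_sub_of_le h hb,
      Real.enorm_of_nonneg ENNReal.toReal_nonneg, ENNReal.ofReal_toReal (ENNReal.sub_ne_top hb)]
  · rw [tsub_eq_zero_of_le h, add_zero, ← ENNReal.toReal_sub_of_le h ha,
      Real.enorm_of_nonneg ENNReal.toReal_nonneg, ENNReal.ofReal_toReal (ENNReal.sub_ne_top ha)]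

/-- A subsequence of the approximate densities converges almost everywhere, jointly in the
parameter. -/
lemma exists_tendsto_approxDensity_param {τ : Measure T} [IsFiniteMeasure τ]
    (hk : Measurable fun q : T × X × Y => k q.1 q.2.1 q.2.2)
    (hk0 : ∀ t x y, 0 < k t x y) (hk1 : ∀ t x y, k t x y ≤ 1)
    (hcauchy : ∀ t, ∀ ε : ℝ, 0 < ε → ∃ N, ∀ n ≥ N, ∀ m ≥ N,
      ∫⁻ q, (approxDensity (P t) (Q t) (k t) n q.1 q.2 - approxDensity (P t) (Q t) (k t) m q.1 q.2)
      ∂((P t).prod (Q t)) ≤ ENNReal.ofReal ε) :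
    ∃ w : T × X × Y → ℝ≥0∞, ∃ ns : ℕ → ℕ, Measurable w ∧ Tendsto ns atTop atTop ∧
      ∀ᵐ t ∂τ, ∀ᵐ q ∂((P t).prod (Q t)),
        Tendsto (fun j => approxDensity (P t) (Q t) (k t) (ns j) q.1 q.2) atTop (𝓝 (w (t, q))) := by
  have hkt : ∀ t, Measurable (Function.uncurry (k t)) := fun t =>
    hk.comp measurable_prodMk_left
  set W : ℕ → T × X × Y → ℝ≥0∞ :=
    fun n q => approxDensity (P q.1) (Q q.1) (k q.1) n q.2.1 q.2.2 with hW
  have hWm : ∀ n, Measurable (W n) := fun n => measurable_approxDensity_param hk n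
  have hWfin : ∀ n q, W n q ≠ ∞ := fun n q =>
    (approxDensity_lt_top (hkt q.1) (hk0 q.1) (hk1 q.1) n q.2.1 q.2.2).ne
  set M := τ ⊗ₘ (P ×ₖ Q) with hM
  -- For each t the inner integrals tend to 0 and are at most 1, so dominated convergence in t gives
  -- the Cauchy property on the whole space. A single subsequence then serves almost every t.
  have hD : Tendsto (fun z : ℕ × ℕ => ∫⁻ q, (W z.1 q - W z.2 q) ∂M) atTop (𝓝 0) := by
    have hF : ∀ z : ℕ × ℕ, ∫⁻ q, (W z.1 q - W z.2 q) ∂M =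
        ∫⁻ t, ∫⁻ q, (W z.1 (t, q) - W z.2 (t, q)) ∂((P t).prod (Q t)) ∂τ := by
      intro z
      have hz : Measurable fun q => W z.1 q - W z.2 q := (hWm _).sub (hWm _)
      rw [hM, Measure.lintegral_compProd hz]
      simp only [Kernel.prod_apply]
    simp only [hF]
    have h0 : (0 : ℝ≥0∞) = ∫⁻ _, 0 ∂τ := by simp
    rw [h0]
    refine tendsto_lintegral_filter_of_dominated_convergence (fun _ => 1) ?_ ?_ ?_ ?_
    · refine Eventually.of_forall fun z => ?_
      have := ((hWm z.1).sub (hWm z.2)).lintegral_kernel_prod_right' (κ := P ×ₖ Q)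
      simpa only [Kernel.prod_apply, Pi.sub_apply] using this
    · refine Eventually.of_forall fun z => Eventually.of_forall fun t => ?_
      refine (lintegral_mono fun q => tsub_le_self).trans ?_
      have h := isApproxCoupling_approxDensity (P := P t) (Q := Q t) (hkt t) (hk0 t) (hk1 t) z.1
      have h1 := h.fst_le univ .univ
      have := h.finite
      rw [univ_prod_univ, probReal_univ (μ := P t), measureReal_def,
        ← ENNReal.toReal_one, ENNReal.toReal_le_toReal (measure_ne_top _ _) ENNReal.one_ne_top,
        prodForm, withDensity_apply _ .univ, setLIntegral_univ] at h1
      exact h1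
    · simp
    · refine Eventually.of_forall fun t => ?_
      rw [ENNReal.tendsto_nhds_zero]
      intro ε hε
      obtain ⟨s, hs, hsε⟩ := ENNReal.lt_iff_exists_nnreal_btwn.1 hε
      obtain ⟨N, hN⟩ := hcauchy t s (by exact_mod_cast hs)
      filter_upwards [eventually_ge_atTop ((N, N) : ℕ × ℕ)] with z hz
      refine (hN z.1 hz.1 z.2 hz.2).trans ?_
      rw [ENNReal.ofReal_coe_nnreal]
      exact hsε.le
  have hex : ∀ j : ℕ, ∃ N : ℕ, ∀ n ≥ N, ∀ m ≥ N,
      ∫⁻ q, (W n q - W m q) ∂M ≤ (2⁻¹ : ℝ≥0∞) ^ j := by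
    intro j
    have := (ENNReal.tendsto_nhds_zero.1 hD) ((2⁻¹ : ℝ≥0∞) ^ j)
      (ENNReal.pow_pos (by simp) j)
    obtain ⟨z, hz⟩ := eventually_atTop.1 this
    exact ⟨max z.1 z.2, fun n hn m hm =>
      hz (n, m) ⟨(le_max_left _ _).trans hn, (le_max_right _ _).trans hm⟩⟩
  choose N hN using hex
  -- The summand j forces divergence, and the sum dominates N J for every J ≤ j without assuming N
  -- monotone.
  set ns : ℕ → ℕ := fun j => j + ∑ i ∈ Finset.range (j + 1), N i with hns
  have hnsN : ∀ J j, J ≤ j → N J ≤ ns j := by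
    intro J j hJ
    have : N J ≤ ∑ i ∈ Finset.range (j + 1), N i :=
      Finset.single_le_sum (f := N) (fun i _ => Nat.zero_le _) (Finset.mem_range.2 (by omega))
    simp only [hns]
    omega
  have hnsT : Tendsto ns atTop atTop :=
    tendsto_atTop_mono (fun j => Nat.le_add_right _ _) tendsto_id
  have hae : ∀ᵐ q ∂M, ∃ l : ℝ, Tendsto (fun j => (W (ns j) q).toReal) atTop (𝓝 l) := by
    -- The two one-sided bounds add up to 2 · 2⁻ᴶ; the constant 3 makes the inequality strict.
    refine Lp.ae_tendsto_of_cauchy_eLpNorm (p := 1) (B := fun j => 3 * (2⁻¹ : ℝ≥0∞) ^ j)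
      (fun j => (hWm _).ennreal_toReal.aestronglyMeasurable) le_rfl ?_ ?_
    · rw [ENNReal.tsum_mul_left]
      exact ENNReal.mul_ne_top (by simp) (by simp [ENNReal.tsum_geometric])
    · intro J n m hn hm
      have h1 := hN J _ (hnsN J n hn) _ (hnsN J m hm)
      have h2 := hN J _ (hnsN J m hm) _ (hnsN J n hn)
      rw [eLpNorm_one_eq_lintegral_enorm]
      simp only [Pi.sub_apply, enorm_toReal_sub_toReal (hWfin _ _) (hWfin _ _)]
      have hz : Measurable fun q => W (ns n) q - W (ns m) q := (hWm _).sub (hWm _)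
      rw [lintegral_add_left hz]
      calc _ ≤ (2⁻¹ : ℝ≥0∞) ^ J + (2⁻¹ : ℝ≥0∞) ^ J := add_le_add h1 h2
        _ = 2 * (2⁻¹ : ℝ≥0∞) ^ J := (two_mul _).symm
        _ < _ := by
          refine ENNReal.mul_lt_mul_left ?_ ?_ (by norm_num)
          · exact (ENNReal.pow_pos (by simp) J).ne'
          · exact ENNReal.pow_ne_top (by simp)
  -- The limsup is measurable everywhere and equals the limit wherever there is one.
  refine ⟨fun q => limsup (fun j => W (ns j) q) atTop, ns, Measurable.limsup fun j => hWm _, hnsT, ?_⟩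
  have hae' := Measure.ae_ae_of_ae_compProd hae
  simp only [Kernel.prod_apply] at hae'
  filter_upwards [hae'] with t ht
  filter_upwards [ht] with q hq
  obtain ⟨l, hl⟩ := hq
  have h := ENNReal.tendsto_ofReal hl
  simp only [ENNReal.ofReal_toReal (hWfin _ _)] at h
  rw [h.limsup_eq]
  exact h

/-- Schrödinger systems with a kernel between `ρ(x) σ(y)` and `1` have solutions, which can be
chosen measurably in a parameter. -/
theorem exists_measurable_solution {τ : Measure T} [IsFiniteMeasure τ]
    (hk : Measurable fun q : T × X × Y => k q.1 q.2.1 q.2.2) (hk1 : ∀ t x y, k t x y ≤ 1)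
    {ρ : T → X → ℝ≥0∞} {σ : T → Y → ℝ≥0∞} (hρ : Measurable (Function.uncurry ρ))
    (hσ : Measurable (Function.uncurry σ)) (hρ0 : ∀ t x, 0 < ρ t x) (hσ0 : ∀ t y, 0 < σ t y)
    (hρσ : ∀ t x y, ρ t x * σ t y ≤ k t x y) :
    ∃ b : T → Y → ℝ≥0∞, Measurable (Function.uncurry b) ∧ ∀ᵐ t ∂τ, ∀ᵐ y ∂(Q t),
      b t y * ∫⁻ x, k t x y / (∫⁻ z, b t z * k t x z ∂(Q t)) ∂(P t) = 1 := by
  have hk0 : ∀ t x y, 0 < k t x y := fun t x y =>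
    (ENNReal.mul_pos (hρ0 t x).ne' (hσ0 t y).ne').trans_le (hρσ t x y)
  have hkt : ∀ t, Measurable (Function.uncurry (k t)) := fun t =>
    hk.comp measurable_prodMk_left
  have hρt : ∀ t, Measurable (ρ t) := fun t => hρ.comp measurable_prodMk_left
  have hσt : ∀ t, Measurable (σ t) := fun t => hσ.comp measurable_prodMk_left
  obtain ⟨w, ns, hw, hns, hlim⟩ := exists_tendsto_approxDensity_param (P := P) (Q := Q) (τ := τ)
    hk hk0 hk1 fun t ε hε => exists_lintegral_sub_approxDensity_le (hkt t) (hk1 t) (hρt t) (hσt t)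
      (hρ0 t) (hσ0 t) (hρσ t) hε
  set g : T → X → Y → ℝ≥0∞ := fun t x y => w (t, x, y) / k t x y with hg
  have hgm : Measurable fun q : T × X × Y => g q.1 q.2.1 q.2.2 := hw.div hk
  set l : T → X → ℝ≥0∞ := fun t x => ∫⁻ y, σ t y * g t x y ∂(Q t) with hl
  have hlm : Measurable (Function.uncurry l) := by
    refine measurable_lintegral_fst_kernel (R := Q)
      (f := fun q : T × X => fun y => σ q.1 y * g q.1 q.2 y) ?_
    have m1 := hσ.comp (f := fun q : (T × X) × Y => (q.1.1, q.2)) (by fun_prop)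
    have m2 := hgm.comp (f := fun q : (T × X) × Y => (q.1.1, q.1.2, q.2)) (by fun_prop)
    exact m1.mul m2
  -- The factors ψ, χ found below for a fixed t come with no measurability in t. Dividing g = ψ χ by
  -- its σ-weighted integral l = ψ S over y cancels ψ and leaves χ / S, an expression in jointly
  -- measurable functions; averaging in x absorbs the exceptional null sets.
  refine ⟨fun t y => ∫⁻ x, g t x y / l t x ∂(P t), ?_, ?_⟩
  · refine measurable_lintegral_fst_kernel (R := P)
      (f := fun q : T × Y => fun x => g q.1 x q.2 / l q.1 x) ?_
    have m1 := hlm.comp (f := fun q : (T × Y) × X => (q.1.1, q.2)) (by fun_prop)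
    have m2 := hgm.comp (f := fun q : (T × Y) × X => (q.1.1, q.2, q.1.2)) (by fun_prop)
    exact m2.div m1
  filter_upwards [hlim] with t ht
  obtain ⟨ψ, χ, hψ, hχ, hfac, h1, h2⟩ := exists_factors_of_tendsto (hkt t) (hk1 t) (hρt t) (hσt t)
    (hρ0 t) (hσ0 t) (hρσ t) (w := fun x y => w (t, x, y)) (hw.comp measurable_prodMk_left) hns ht
  have hktx : ∀ x, Measurable (k t x) := fun x => (hkt t).comp measurable_prodMk_left
  have hkty : ∀ y, Measurable fun x => k t x y := fun y => (hkt t).comp measurable_prodMk_right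
  have hkT : ∀ x y, k t x y ≠ ∞ := fun x y => ((hk1 t x y).trans_lt ENNReal.one_lt_top).ne
  have hgf : ∀ᵐ q ∂((P t).prod (Q t)), g t q.1 q.2 = ψ q.1 * χ q.2 := by
    filter_upwards [hfac] with q hq
    rw [hg]
    simp only at hq ⊢
    rw [hq, mul_assoc, mul_comm, mul_div_assoc, ENNReal.div_self (hk0 _ _ _).ne' (hkT _ _), mul_one]
  have hψ0 : ∀ᵐ x ∂(P t), ψ x ≠ 0 ∧ ψ x ≠ ∞ := by
    filter_upwards [h1] with x hx
    refine ⟨fun h => by simp [h] at hx, fun h => ?_⟩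
    rw [h] at hx
    by_cases h0 : ∫⁻ y, k t x y * χ y ∂(Q t) = 0
    · simp [h0] at hx
    · simp [ENNReal.top_mul h0] at hx
  have hχ0 : ∀ᵐ y ∂(Q t), χ y ≠ 0 := by
    filter_upwards [h2] with y hy h
    simp [h] at hy
  set S := ∫⁻ y, σ t y * χ y ∂(Q t) with hS
  have hS0 : S ≠ 0 := by
    intro h
    rw [hS, lintegral_eq_zero_iff (by fun_prop)] at h
    obtain ⟨y, hy1, hy2⟩ := (h.and hχ0).exists
    simp [(hσ0 t y).ne', hy2] at hy1
  set R := ∫⁻ x, ρ t x * ψ x ∂(P t) with hR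
  have hR0 : R ≠ 0 := by
    intro h
    rw [hR, lintegral_eq_zero_iff (by fun_prop)] at h
    obtain ⟨x, hx1, hx2⟩ := (h.and hψ0).exists
    simp [(hρ0 t x).ne', hx2.1] at hx1
  -- The lower bound of the kernel enters here: σ χ ∫ ρ ψ ≤ χ ∫ k ψ = 1, so σ χ ≤ R⁻¹ almost
  -- everywhere.
  have hST : S ≠ ∞ := by
    have : S ≤ ∫⁻ _, R⁻¹ ∂(Q t) := by
      refine lintegral_mono_ae ?_
      filter_upwards [h2] with y hy
      rw [ENNReal.le_inv_iff_mul_le, ← hy, hR, mul_comm (σ t y), mul_assoc,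
        ← lintegral_const_mul _ (by fun_prop)]
      refine mul_le_mul_right (lintegral_mono fun x => ?_) _
      calc σ t y * (ρ t x * ψ x) = ρ t x * σ t y * ψ x := by ring
        _ ≤ k t x y * ψ x := by gcongr; exact hρσ t x y
    refine (this.trans_lt ?_).ne
    simpa using ENNReal.inv_lt_top.2 (pos_iff_ne_zero.2 hR0)
  have hlx : ∀ᵐ x ∂(P t), l t x = ψ x * S := by
    filter_upwards [Measure.ae_ae_of_ae_prod hgf] with x hx
    rw [hS, ← lintegral_const_mul _ (by fun_prop)]
    refine lintegral_congr_ae ?_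
    filter_upwards [hx] with y hy
    rw [hy]
    ring
  have hb : ∀ᵐ y ∂(Q t), ∫⁻ x, g t x y / l t x ∂(P t) = χ y / S := by
    have hgf' := Measure.measurePreserving_swap.quasiMeasurePreserving.ae (μa := (Q t).prod (P t)) hgf
    filter_upwards [Measure.ae_ae_of_ae_prod hgf'] with y hy
    have : ∫⁻ _, χ y / S ∂(P t) = χ y / S := by simp
    rw [← this]
    refine lintegral_congr_ae ?_
    filter_upwards [hy, hlx, hψ0] with x hx hx2 hx3
    simp only [Prod.swap] at hx
    rw [hx, hx2, ENNReal.mul_div_mul_left _ _ hx3.1 hx3.2]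
  have hu : ∀ᵐ x ∂(P t), ∫⁻ z, (∫⁻ x, g t x z / l t x ∂(P t)) * k t x z ∂(Q t) = (ψ x * S)⁻¹ := by
    filter_upwards [h1, hψ0] with x hx hx0
    have : ∫⁻ z, (∫⁻ x, g t x z / l t x ∂(P t)) * k t x z ∂(Q t) =
        S⁻¹ * ∫⁻ y, k t x y * χ y ∂(Q t) := by
      rw [← lintegral_const_mul _ (by fun_prop)]
      refine lintegral_congr_ae ?_
      filter_upwards [hb] with y hy
      rw [hy, div_eq_mul_inv]
      ring
    rw [this, ENNReal.mul_inv (Or.inl hx0.1) (Or.inl hx0.2), mul_comm,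
      ENNReal.eq_inv_of_mul_eq_one_left (a := ∫⁻ y, k t x y * χ y ∂(Q t)) (b := ψ x)
      (by rw [mul_comm]; exact hx)]
  filter_upwards [h2, hb] with y hy hby
  have : ∫⁻ x, k t x y / (∫⁻ z, (∫⁻ x, g t x z / l t x ∂(P t)) * k t x z ∂(Q t)) ∂(P t) =
      S * ∫⁻ x, k t x y * ψ x ∂(P t) := by
    rw [← lintegral_const_mul _ (by fun_prop)]
    refine lintegral_congr_ae ?_
    filter_upwards [hu] with x hx
    rw [hx, div_eq_mul_inv, inv_inv]
    ring
  rw [this, hby, ← hy, ← mul_assoc, ENNReal.div_mul_cancel hS0 hST]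

end Parametric

end CondSchrodinger

/-! ### Uniqueness for the Schrödinger functional equation -/

namespace CondSchrodinger

open Filter Topology Set

section Uniqueness

variable {X Y : Type*} [MeasurableSpace X] [MeasurableSpace Y]

/-- `h` solves the Schrödinger functional equation with kernel `k`, initial law `P` and terminal
density `f` with respect to `m`. -/
def IsSchrodingerSol (P : Measure X) (m : Measure Y) (f : Y → ℝ≥0∞) (k : X → Y → ℝ≥0∞)
    (h : Y → ℝ≥0∞) : Prop :=
  f =ᵐ[m] fun y => h y * ∫⁻ x, k x y / (∫⁻ z, h z * k x z ∂m) ∂P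

variable {P : Measure X} {m : Measure Y} {f : Y → ℝ≥0∞} {k : X → Y → ℝ≥0∞} {h g : Y → ℝ≥0∞}

lemma measurable_lintegral_mul_kernel [SFinite m] (hk : Measurable (Function.uncurry k))
    (hh : Measurable h) : Measurable fun x => ∫⁻ z, h z * k x z ∂m :=
  Measurable.lintegral_prod_right' (f := fun q : X × Y => h q.2 * k q.1 q.2) (by fun_prop)

/-- By Fubini ∫ f = 1 becomes ∫ u u⁻¹ dP = 1, and u u⁻¹ is 1 where 0 < u < ∞ and 0 elsewhere. -/
lemma IsSchrodingerSol.norm_ne [IsProbabilityMeasure P] [SFinite m]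
    (hs : IsSchrodingerSol P m f k h) (hk : Measurable (Function.uncurry k)) (hh : Measurable h)
    (hf : ∫⁻ y, f y ∂m = 1) :
    ∀ᵐ x ∂P, ∫⁻ z, h z * k x z ∂m ≠ 0 ∧ ∫⁻ z, h z * k x z ∂m ≠ ∞ := by
  set u : X → ℝ≥0∞ := fun x => ∫⁻ z, h z * k x z ∂m with hu
  have hum : Measurable u := measurable_lintegral_mul_kernel hk hh
  have h1 : ∫⁻ x, u x * (u x)⁻¹ ∂P = 1 := by
    rw [← hf, lintegral_congr_ae hs]
    have : ∀ y, h y * ∫⁻ x, k x y / u x ∂P = ∫⁻ x, h y * (k x y / u x) ∂P := fun y =>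
      (lintegral_const_mul _ (by fun_prop)).symm
    simp only [hu] at this ⊢
    simp only [this]
    rw [lintegral_lintegral_swap (f := fun y x => h y * (k x y / u x)) (by fun_prop)]
    refine lintegral_congr fun x => ?_
    rw [← lintegral_mul_const _ (by fun_prop)]
    refine lintegral_congr fun y => ?_
    rw [div_eq_mul_inv]
    ring
  have hms : MeasurableSet {x | u x ≠ 0 ∧ u x ≠ ∞} :=
    (hum (measurableSet_singleton 0)).compl.inter (hum (measurableSet_singleton ∞)).compl
  have h2 : P {x | u x ≠ 0 ∧ u x ≠ ∞} = 1 := by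
    rw [← h1, ← lintegral_indicator_one hms]
    refine lintegral_congr fun x => ?_
    by_cases hx : u x ≠ 0 ∧ u x ≠ ∞
    · rw [indicator_of_mem (s := {x | u x ≠ 0 ∧ u x ≠ ∞}) hx, ENNReal.mul_inv_cancel hx.1 hx.2]
      rfl
    · rw [indicator_of_notMem (s := {x | u x ≠ 0 ∧ u x ≠ ∞}) hx]
      rw [not_and_or, not_not, not_not] at hx
      rcases hx with hx | hx <;> simp [hx]
  exact (prob_compl_eq_zero_iff hms).2 h2

/-- Pointwise heart of uniqueness, with p, q the normalisations and a, b the values of the two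
solutions. It is (A + B - 1)(w_g - w_h) ≥ 0 written without subtraction; both factors have the sign
of p b - q a, whence the square. -/
lemma add_mul_add_le_of_ratio {p q a b s : ℝ≥0} (hp : 0 < p) (hq : 0 < q) (ha : 0 < a)
    (hb : 0 < b) :
    (p / (p + q) + b / (b + a)) * (a * s / p) + b * s / q ≤
      (p / (p + q) + b / (b + a)) * (b * s / q) + a * s / p := by
  rw [← NNReal.coe_le_coe]
  push_cast
  have hp' : (0 : ℝ) < p := hp
  have hq' : (0 : ℝ) < q := hq
  have ha' : (0 : ℝ) < a := ha
  have hb' : (0 : ℝ) < b := hb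
  have hs' : (0 : ℝ) ≤ s := s.2
  rw [← sub_nonneg]
  have : ((p : ℝ) / (p + q) + b / (b + a)) * (b * s / q) + a * s / p -
      (((p : ℝ) / (p + q) + b / (b + a)) * (a * s / p) + b * s / q) =
      s * (p * b - q * a) ^ 2 / (p * q * (p + q) * (b + a)) := by
    field_simp
    ring
  rw [this]
  positivity

lemma mul_eq_mul_of_ratio {p q a b s : ℝ≥0} (hp : 0 < p) (hq : 0 < q) (ha : 0 < a)
    (hb : 0 < b) (hs : 0 < s)
    (h : (p / (p + q) + b / (b + a)) * (a * s / p) + b * s / q =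
      (p / (p + q) + b / (b + a)) * (b * s / q) + a * s / p) : p * b = q * a := by
  rw [← NNReal.coe_inj] at h ⊢
  push_cast at h ⊢
  have hp' : (0 : ℝ) < p := hp
  have hq' : (0 : ℝ) < q := hq
  have ha' : (0 : ℝ) < a := ha
  have hb' : (0 : ℝ) < b := hb
  have hs' : (0 : ℝ) < s := hs
  have : ((p : ℝ) / (p + q) + b / (b + a)) * (b * s / q) + a * s / p -
      (((p : ℝ) / (p + q) + b / (b + a)) * (a * s / p) + b * s / q) =
      s * (p * b - q * a) ^ 2 / (p * q * (p + q) * (b + a)) := by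
    field_simp
    ring
  rw [← h, sub_self, eq_comm, div_eq_zero_iff, or_iff_left (by positivity), mul_eq_zero,
    or_iff_right hs'.ne', sq_eq_zero_iff, sub_eq_zero] at this
  exact this

/-- The coupling density attached to `h`. -/
noncomputable def couplingDensity (m : Measure Y) (k : X → Y → ℝ≥0∞) (h : Y → ℝ≥0∞) (x : X)
    (y : Y) : ℝ≥0∞ :=
  h y * k x y / ∫⁻ z, h z * k x z ∂m

lemma measurable_couplingDensity [SFinite m] (hk : Measurable (Function.uncurry k))
    (hh : Measurable h) : Measurable fun q : X × Y => couplingDensity m k h q.1 q.2 := by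
  have := measurable_lintegral_mul_kernel (m := m) hk hh
  unfold couplingDensity
  fun_prop

lemma IsSchrodingerSol.lintegral_fst [IsProbabilityMeasure P] [SFinite m]
    (hs : IsSchrodingerSol P m f k h) (hk : Measurable (Function.uncurry k)) (hh : Measurable h)
    (hf : ∫⁻ y, f y ∂m = 1) : ∀ᵐ x ∂P, ∫⁻ y, couplingDensity m k h x y ∂m = 1 := by
  filter_upwards [hs.norm_ne hk hh hf] with x hx
  simp only [couplingDensity, div_eq_mul_inv]
  rw [lintegral_mul_const _ (by fun_prop), ENNReal.mul_inv_cancel hx.1 hx.2]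

lemma IsSchrodingerSol.lintegral_snd [SFinite P] [SFinite m]
    (hs : IsSchrodingerSol P m f k h) (hk : Measurable (Function.uncurry k)) (hh : Measurable h) :
    ∀ᵐ y ∂m, ∫⁻ x, couplingDensity m k h x y ∂P = f y := by
  have := measurable_lintegral_mul_kernel (m := m) hk hh
  filter_upwards [hs] with y hy
  rw [hy, ← lintegral_const_mul _ (by fun_prop)]
  simp only [couplingDensity, mul_div_assoc]

lemma lintegral_mul_fst [SFinite P] [SFinite m] {w : X → Y → ℝ≥0∞}
    (hw : Measurable fun q : X × Y => w q.1 q.2) {A : X → ℝ≥0∞} (hA : Measurable A)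
    (h1 : ∀ᵐ x ∂P, ∫⁻ y, w x y ∂m = 1) :
    ∫⁻ q, A q.1 * w q.1 q.2 ∂(P.prod m) = ∫⁻ x, A x ∂P := by
  rw [lintegral_prod _ (by fun_prop)]
  refine lintegral_congr_ae ?_
  filter_upwards [h1] with x hx
  rw [lintegral_const_mul _ (by fun_prop), hx, mul_one]

lemma lintegral_mul_snd [SFinite P] [SFinite m] {w : X → Y → ℝ≥0∞}
    (hw : Measurable fun q : X × Y => w q.1 q.2) {B : Y → ℝ≥0∞} (hB : Measurable B)
    (h2 : ∀ᵐ y ∂m, ∫⁻ x, w x y ∂P = f y) :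
    ∫⁻ q, B q.2 * w q.1 q.2 ∂(P.prod m) = ∫⁻ y, B y * f y ∂m := by
  rw [lintegral_prod_symm _ (by fun_prop)]
  refine lintegral_congr_ae ?_
  filter_upwards [h2] with y hy
  rw [lintegral_const_mul _ (by fun_prop), hy]

/-- A positive kernel divided by an almost everywhere finite normalisation cannot integrate to zero.
Hence a solution vanishes exactly where f does, up to a null set. -/
lemma IsSchrodingerSol.pos [IsProbabilityMeasure P] [SFinite m]
    (hs : IsSchrodingerSol P m f k h) (hk : Measurable (Function.uncurry k))
    (hk0 : ∀ x y, k x y ≠ 0) (hh : Measurable h)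
    (hf : ∫⁻ y, f y ∂m = 1) (y : Y) : ∫⁻ x, k x y / (∫⁻ z, h z * k x z ∂m) ∂P ≠ 0 := by
  have hm := measurable_lintegral_mul_kernel (m := m) hk hh
  intro h0
  rw [lintegral_eq_zero_iff (by fun_prop)] at h0
  obtain ⟨x, hx, hx2⟩ := (h0.and (hs.norm_ne hk hh hf)).exists
  simp [ENNReal.div_eq_zero_iff, hk0, hx2.2] at hx

/-- Solutions of the Schrödinger functional equation are unique up to a constant factor. -/
theorem IsSchrodingerSol.unique [IsProbabilityMeasure P] [SFinite m]
    {h g : Y → ℝ≥0} (hs : IsSchrodingerSol P m f k (fun y => h y))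
    (gs : IsSchrodingerSol P m f k (fun y => g y)) (hk : Measurable (Function.uncurry k))
    (hk0 : ∀ x y, k x y ≠ 0) (hkT : ∀ x y, k x y ≠ ∞) (hh : Measurable h) (hg : Measurable g)
    (hf : ∫⁻ y, f y ∂m = 1) :
    ∃ c : ℝ≥0, 0 < c ∧ ∀ᵐ y ∂m, g y = c * h y := by
  set u : X → ℝ≥0∞ := fun x => ∫⁻ z, h z * k x z ∂m with hu
  set v : X → ℝ≥0∞ := fun x => ∫⁻ z, g z * k x z ∂m with hv
  have hhE : Measurable fun y => (h y : ℝ≥0∞) := by fun_prop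
  have hgE : Measurable fun y => (g y : ℝ≥0∞) := by fun_prop
  have hum : Measurable u := measurable_lintegral_mul_kernel hk hhE
  have hvm : Measurable v := measurable_lintegral_mul_kernel hk hgE
  have hu0 := hs.norm_ne hk hhE hf
  have hv0 := gs.norm_ne hk hgE hf
  have hwh := measurable_couplingDensity (m := m) hk hhE
  have hwg := measurable_couplingDensity (m := m) hk hgE
  -- The natural test function is log (w_g / w_h) = log (u / v) + log (g / h), which may fail to be
  -- integrable. Replacing log r by r / (1 + r) in each summand keeps the monotonicity and makes
  -- both bounded, so equality of marginals gives both couplings the same integral of A + B.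
  set A : X → ℝ≥0∞ := fun x =>
    (((u x).toNNReal / ((u x).toNNReal + (v x).toNNReal) : ℝ≥0) : ℝ≥0∞) with hA
  set B : Y → ℝ≥0∞ := fun y => ((g y / (g y + h y) : ℝ≥0) : ℝ≥0∞) with hB
  have hAm : Measurable A := by fun_prop
  have hBm : Measurable B := by fun_prop
  have hA1 : ∀ x, A x ≤ 1 := fun x => by
    simp only [hA]
    exact_mod_cast div_le_one_of_le₀ le_self_add zero_le
  have hB1 : ∀ y, B y ≤ 1 := fun y => by
    simp only [hB]
    exact_mod_cast div_le_one_of_le₀ le_self_add zero_le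
  set wh := couplingDensity m k (fun y => (h y : ℝ≥0∞)) with hwhdef
  set wg := couplingDensity m k (fun y => (g y : ℝ≥0∞)) with hwgdef
  have key : ∀ w : X → Y → ℝ≥0∞, (Measurable fun q : X × Y => w q.1 q.2) →
      (∀ᵐ x ∂P, ∫⁻ y, w x y ∂m = 1) → (∀ᵐ y ∂m, ∫⁻ x, w x y ∂P = f y) →
      ∫⁻ q, (A q.1 + B q.2) * w q.1 q.2 ∂(P.prod m) = ∫⁻ x, A x ∂P + ∫⁻ y, B y * f y ∂m ∧
      ∫⁻ q, w q.1 q.2 ∂(P.prod m) = 1 := by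
    intro w hw h1 h2
    constructor
    · simp only [add_mul]
      rw [lintegral_add_left (by fun_prop), lintegral_mul_fst hw hAm h1,
        lintegral_mul_snd hw hBm h2]
    · have := lintegral_mul_fst hw (A := fun _ => 1) measurable_const h1
      simpa using this
  obtain ⟨kh1, kh2⟩ := key wh hwh (hs.lintegral_fst hk hhE hf) (hs.lintegral_snd hk hhE)
  obtain ⟨kg1, kg2⟩ := key wg hwg (gs.lintegral_fst hk hgE hf) (gs.lintegral_snd hk hgE)
  have hfin : ∫⁻ x, A x ∂P + ∫⁻ y, B y * f y ∂m ≠ ∞ := by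
    refine ENNReal.add_ne_top.2 ⟨?_, ?_⟩
    · refine ((lintegral_mono hA1).trans_lt ?_).ne
      simp
    · refine ((lintegral_mono fun y => mul_le_of_le_one_left' (hB1 y)).trans_lt ?_).ne
      rw [hf]
      exact ENNReal.one_lt_top
  have hcase : ∀ᵐ y ∂m, (h y = 0 ∧ g y = 0) ∨ (0 < h y ∧ 0 < g y) := by
    filter_upwards [hs, gs] with y hy1 hy2
    have p1 := hs.pos hk hk0 hhE hf y
    have p2 := gs.pos hk hk0 hgE hf y
    by_cases h0 : f y = 0
    · left
      rw [h0, eq_comm, mul_eq_zero, or_iff_left p1] at hy1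
      rw [h0, eq_comm, mul_eq_zero, or_iff_left p2] at hy2
      exact ⟨by simpa using hy1, by simpa using hy2⟩
    · right
      constructor
      · rw [pos_iff_ne_zero]
        intro h
        simp [h] at hy1
        exact h0 hy1
      · rw [pos_iff_ne_zero]
        intro h
        simp [h] at hy2
        exact h0 hy2
  have hpt : ∀ᵐ q ∂(P.prod m), (A q.1 + B q.2) * wh q.1 q.2 + wg q.1 q.2 ≤
      (A q.1 + B q.2) * wg q.1 q.2 + wh q.1 q.2 ∧
      ((A q.1 + B q.2) * wh q.1 q.2 + wg q.1 q.2 =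
      (A q.1 + B q.2) * wg q.1 q.2 + wh q.1 q.2 → u q.1 * g q.2 = v q.1 * h q.2) := by
    filter_upwards [Measure.quasiMeasurePreserving_fst.ae (hu0.and hv0),
      Measure.quasiMeasurePreserving_snd.ae hcase] with q hq1 hq2
    obtain ⟨p, hp⟩ : ∃ r : ℝ≥0, (r : ℝ≥0∞) = _ := ⟨_, ENNReal.coe_toNNReal (hq1.1.2)⟩
    obtain ⟨r, hr⟩ : ∃ r : ℝ≥0, (r : ℝ≥0∞) = _ := ⟨_, ENNReal.coe_toNNReal (hq1.2.2)⟩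
    obtain ⟨s, hs⟩ : ∃ r : ℝ≥0, (r : ℝ≥0∞) = _ := ⟨_, ENNReal.coe_toNNReal (hkT q.1 q.2)⟩
    have hp0 : 0 < p := by
      rw [pos_iff_ne_zero]; rintro rfl; exact hq1.1.1 (by simpa using hp.symm)
    have hr0 : 0 < r := by
      rw [pos_iff_ne_zero]; rintro rfl; exact hq1.2.1 (by simpa using hr.symm)
    have hs0 : 0 < s := by
      rw [pos_iff_ne_zero]; rintro rfl; exact hk0 q.1 q.2 (by simpa using hs.symm)
    have eA : A q.1 = ((p / (p + r) : ℝ≥0) : ℝ≥0∞) := by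
      simp only [hA, hu, hv, ← hp, ← hr, ENNReal.toNNReal_coe]
    have eh : wh q.1 q.2 = ((h q.2 * s / p : ℝ≥0) : ℝ≥0∞) := by
      rw [hwhdef, couplingDensity, ← hp, ← hs, ENNReal.coe_div hp0.ne', ENNReal.coe_mul]
    have eg : wg q.1 q.2 = ((g q.2 * s / r : ℝ≥0) : ℝ≥0∞) := by
      rw [hwgdef, couplingDensity, ← hr, ← hs, ENNReal.coe_div hr0.ne', ENNReal.coe_mul]
    have eu : u q.1 = p := hp.symm
    have ev : v q.1 = r := hr.symm
    have eB : B q.2 = ((g q.2 / (g q.2 + h q.2) : ℝ≥0) : ℝ≥0∞) := rfl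
    rw [eA, eB, eh, eg, eu, ev]
    rcases hq2 with ⟨h0, g0⟩ | ⟨h0, g0⟩
    · simp [h0, g0]
    · constructor
      · exact_mod_cast add_mul_add_le_of_ratio hp0 hr0 h0 g0
      · intro heq
        have heq' : (p / (p + r) + g q.2 / (g q.2 + h q.2)) * (h q.2 * s / p) + g q.2 * s / r =
            (p / (p + r) + g q.2 / (g q.2 + h q.2)) * (g q.2 * s / r) + h q.2 * s / p := by
          exact_mod_cast heq
        exact_mod_cast mul_eq_mul_of_ratio hp0 hr0 h0 g0 hs0 heq'
  have hae := ae_eq_of_ae_le_of_lintegral_le (μ := P.prod m)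
    (f := fun q => (A q.1 + B q.2) * wh q.1 q.2 + wg q.1 q.2)
    (g := fun q => (A q.1 + B q.2) * wg q.1 q.2 + wh q.1 q.2)
    (hpt.mono fun q hq => hq.1) (by
      rw [lintegral_add_left (by fun_prop), kh1, kg2]
      exact ENNReal.add_ne_top.2 ⟨hfin, ENNReal.one_ne_top⟩) (by fun_prop) (by
      rw [lintegral_add_left (by fun_prop), lintegral_add_left (by fun_prop), kh1, kg1, kh2, kg2])
  have hfinal : ∀ᵐ q ∂(P.prod m), u q.1 * g q.2 = v q.1 * h q.2 := by
    filter_upwards [hpt, hae] with q hq hq2 using hq.2 hq2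
  -- One typical x turns u(x) g(y) = v(x) h(y) into proportionality, with factor v(x) / u(x).
  obtain ⟨x, hx, hxu, hxv⟩ := ((Measure.ae_ae_of_ae_prod hfinal).and (hu0.and hv0)).exists
  refine ⟨(v x).toNNReal / (u x).toNNReal, ?_, ?_⟩
  · exact div_pos (ENNReal.toNNReal_pos hxv.1 hxv.2) (ENNReal.toNNReal_pos hxu.1 hxu.2)
  · filter_upwards [hx] with y hy
    have hy' := congrArg ENNReal.toNNReal hy
    simp only [ENNReal.toNNReal_mul, ENNReal.toNNReal_coe] at hy'
    have := (ENNReal.toNNReal_pos hxu.1 hxu.2).ne'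
    change (u x).toNNReal ≠ 0 at this
    field_simp
    rw [mul_comm (g y), hy']

end Uniqueness

end CondSchrodinger

/-! ### Densities of product form minimise the relative entropy -/

namespace CondSchrodinger

open Filter Topology Set

section Entropy

/-- Truncation of a real number to `[-n, n]`. -/
noncomputable def clip (n : ℕ) (s : ℝ) : ℝ := max (-n) (min s n)

lemma measurable_clip (n : ℕ) : Measurable (clip n) := by
  unfold clip
  fun_prop

lemma neg_le_clip (n : ℕ) (s : ℝ) : -(n : ℝ) ≤ clip n s := le_max_left _ _

lemma clip_le (n : ℕ) (s : ℝ) : clip n s ≤ n :=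
  max_le (by have : (0 : ℝ) ≤ n := n.cast_nonneg
             linarith) (min_le_right _ _)

lemma clip_eq {n : ℕ} {s : ℝ} (h : |s| ≤ n) : clip n s = s := by
  rw [abs_le] at h
  rw [clip, min_eq_left h.2, max_eq_right h.1]

/-- `clip n s + clip n t` lies between `0` and `s + t`. -/
lemma clip_add_clip_between (n : ℕ) (s t : ℝ) :
    (0 ≤ clip n s + clip n t ∧ clip n s + clip n t ≤ s + t) ∨
      (clip n s + clip n t ≤ 0 ∧ s + t ≤ clip n s + clip n t) := by
  have hn : (0 : ℝ) ≤ n := n.cast_nonneg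
  unfold clip
  rcases le_total s n with h1 | h1 <;> rcases le_total t n with h2 | h2 <;>
  rcases le_total (-(n : ℝ)) s with h3 | h3 <;> rcases le_total (-(n : ℝ)) t with h4 | h4 <;>
  simp only [min_eq_left, min_eq_right, max_eq_left, max_eq_right, h1, h2, h3, h4] <;>
  (rcases le_total 0 (s + t) with h5 | h5
   · left; constructor <;> (try rw [max_def]) <;> (try split_ifs) <;> linarith
   · right; constructor <;> (try rw [max_def]) <;> (try split_ifs) <;> linarith)

/-- Young's inequality for `klFun`. -/
lemma klFun_sub_mul_add_exp_nonneg {x : ℝ} (hx : 0 ≤ x) (s : ℝ) :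
    0 ≤ klFun x - x * s + Real.exp s - 1 := by
  have h := mul_nonneg (Real.exp_pos s).le (klFun_nonneg (mul_nonneg hx (Real.exp_pos (-s)).le))
  rcases hx.eq_or_lt with rfl | hx
  · simp [klFun_apply, (Real.exp_pos s).le]
  · rw [klFun_apply, Real.log_mul hx.ne' (Real.exp_pos _).ne', Real.log_exp] at h
    have he : Real.exp s * Real.exp (-s) = 1 := by rw [← Real.exp_add]; simp
    rw [klFun_apply]
    have : Real.exp s * (x * Real.exp (-s) * (Real.log x + -s) + 1 - x * Real.exp (-s)) =
        x * (Real.log x - s) * (Real.exp s * Real.exp (-s)) + Real.exp s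
          - x * (Real.exp s * Real.exp (-s)) := by ring
    rw [this, he] at h
    linarith

/-- The expression is w times `klFun` of x / w, and `klFun` vanishes only at 1. -/
lemma eq_of_klFun_sub_eq_zero {x w : ℝ} (hx : 0 ≤ x) (hw : 0 < w)
    (h : klFun x - x * Real.log w + w - 1 = 0) : x = w := by
  have h2 : w * klFun (x / w) = klFun x - x * Real.log w + w - 1 := by
    rcases hx.eq_or_lt with rfl | hx
    · simp [klFun_apply]
    · rw [klFun_apply, klFun_apply, Real.log_div hx.ne' hw.ne']
      field_simp
      ring
  rw [h, mul_eq_zero, or_iff_right hw.ne', klFun_eq_zero_iff (by positivity),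
    div_eq_one_iff_eq hw.ne'] at h2
  exact h2

/-- At w = exp s the expression is `klFun` of exp s, which is nonnegative; as s lies between 0 and
log w, passing from exp s to w can only increase w s. -/
lemma mul_sub_exp_add_one_nonneg {w s : ℝ} (hw : 0 < w)
    (h : (0 ≤ s ∧ s ≤ Real.log w) ∨ (s ≤ 0 ∧ Real.log w ≤ s)) : 0 ≤ w * s - Real.exp s + 1 := by
  have h1 : 0 ≤ Real.exp s * s - Real.exp s + 1 := by
    have := klFun_nonneg (Real.exp_pos s).le
    rw [klFun_apply, Real.log_exp] at this
    linarith
  have h2 : Real.exp s * s ≤ w * s := by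
    rcases h with ⟨h0, h3⟩ | ⟨h0, h3⟩
    · exact mul_le_mul_of_nonneg_right ((Real.le_log_iff_exp_le hw).1 h3) h0
    · exact mul_le_mul_of_nonpos_right ((Real.log_le_iff_le_exp hw).1 h3) h0
  linarith

variable {Z Z₁ Z₂ : Type*} [MeasurableSpace Z] [MeasurableSpace Z₁] [MeasurableSpace Z₂]
  {M π : Measure Z} {α : Z → Z₁} {β : Z → Z₂} {a : Z₁ → ℝ≥0∞} {b : Z₂ → ℝ≥0∞}

/-- A measure with density `a(α z) b(β z)` with respect to `M` minimises the relative entropy among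
the measures with the same images under `α` and `β`, with a quantitative gap. -/
lemma lintegral_klFun_add_le [IsFiniteMeasure M] [IsProbabilityMeasure π] {w ρ : Z → ℝ≥0∞}
    (hα : Measurable α) (hβ : Measurable β) (ha : Measurable a) (hb : Measurable b)
    (ha0 : ∀ᵐ z ∂M, a (α z) ≠ 0 ∧ a (α z) ≠ ∞) (hb0 : ∀ᵐ z ∂M, b (β z) ≠ 0 ∧ b (β z) ≠ ∞)
    (hw : ∀ z, w z = a (α z) * b (β z)) (hρ : Measurable ρ) (hρT : ∀ᵐ z ∂M, ρ z ≠ ∞)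
    (hπ : π = M.withDensity ρ)
    (h1 : π.map α = (M.withDensity w).map α) (h2 : π.map β = (M.withDensity w).map β) :
    ∫⁻ z, ENNReal.ofReal (klFun (w z).toReal) ∂M +
      ∫⁻ z, ENNReal.ofReal (klFun (ρ z).toReal - (ρ z).toReal * Real.log (w z).toReal +
        (w z).toReal - 1) ∂M ≤ ∫⁻ z, ENNReal.ofReal (klFun (ρ z).toReal) ∂M := by
  have hwm : Measurable w := by
    rw [show w = fun z => a (α z) * b (β z) from funext hw]
    fun_prop
  set s : Z₁ → ℝ := fun z => Real.log (a z).toReal with hs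
  set t : Z₂ → ℝ := fun z => Real.log (b z).toReal with ht
  have hsm : Measurable s := by fun_prop
  have htm : Measurable t := by fun_prop
  have hcm := measurable_clip
  -- Each logarithm is truncated separately, so that φ_n remains a function of α plus a function of
  -- β, whose integrals the two laws determine.
  set φ : ℕ → Z → ℝ := fun n z => clip n (s (α z)) + clip n (t (β z)) with hφ
  have hφm : ∀ n, Measurable (φ n) := fun n => by
    have := hcm n
    fun_prop
  have hφ0 : ∀ n z, 0 ≤ φ n z + 2 * n := fun n z => by
    have := neg_le_clip n (s (α z))
    have := neg_le_clip n (t (β z))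
    simp only [hφ]
    linarith
  have hkm := measurable_klFun
  -- both measures give the same value to `φ n`
  have hval : ∀ n, ∫⁻ z, w z * ENNReal.ofReal (φ n z + 2 * n) ∂M =
      ∫⁻ z, ρ z * ENNReal.ofReal (φ n z + 2 * n) ∂M := by
    intro n
    have hcn := hcm n
    have hsplit : ∀ z, ENNReal.ofReal (φ n z + 2 * n) =
        ENNReal.ofReal (clip n (s (α z)) + n) + ENNReal.ofReal (clip n (t (β z)) + n) := by
      intro z
      rw [← ENNReal.ofReal_add (by linarith [neg_le_clip n (s (α z))])
        (by linarith [neg_le_clip n (t (β z))])]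
      congr 1
      simp only [hφ]
      ring
    have hgen : ∀ v : Z → ℝ≥0∞, Measurable v → ∫⁻ z, v z * ENNReal.ofReal (φ n z + 2 * n) ∂M =
        ∫⁻ z, ENNReal.ofReal (clip n (s z) + n) ∂((M.withDensity v).map α) +
        ∫⁻ z, ENNReal.ofReal (clip n (t z) + n) ∂((M.withDensity v).map β) := by
      intro v hv
      rw [lintegral_map (by fun_prop) hα, lintegral_map (by fun_prop) hβ,
        lintegral_withDensity_eq_lintegral_mul _ hv (by fun_prop),
        lintegral_withDensity_eq_lintegral_mul _ hv (by fun_prop), ← lintegral_add_left (by fun_prop)]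
      refine lintegral_congr fun z => ?_
      simp only [Pi.mul_apply, hsplit, mul_add]
    rw [hgen w hwm, hgen ρ hρ, ← h1, ← h2, hπ]
  have hρint : ∫⁻ z, ρ z ∂M ≠ ∞ := by
    have : π univ ≠ ∞ := measure_ne_top _ _
    rwa [hπ, withDensity_apply _ .univ, setLIntegral_univ] at this
  have hmass1 : ∫⁻ z, w z ∂M = ∫⁻ z, ρ z ∂M := by
    have := congrArg (fun m => m univ) h1
    simp only [Measure.map_apply hα .univ, preimage_univ, hπ, withDensity_apply _ MeasurableSet.univ,
      setLIntegral_univ] at this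
    exact this.symm
  have hvalT : ∀ n, ∫⁻ z, ρ z * ENNReal.ofReal (φ n z + 2 * n) ∂M ≠ ∞ := by
    intro n
    refine ne_top_of_le_ne_top (b := ∫⁻ z, ρ z * ENNReal.ofReal (4 * n) ∂M) ?_ ?_
    · rw [lintegral_mul_const _ hρ]
      exact ENNReal.mul_ne_top hρint ENNReal.ofReal_ne_top
    · refine lintegral_mono fun z => ?_
      gcongr
      have := clip_le n (s (α z))
      have := clip_le n (t (β z))
      simp only [hφ]
      linarith
  -- The terms exp φ_n cancel in A_n + K_n = `klFun` ρ + (w - ρ) φ_n, whose last part integrates to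
  -- zero. Their presence makes each of A_n and K_n nonnegative, as Fatou's lemma requires.
  set A : ℕ → Z → ℝ := fun n z => (w z).toReal * φ n z - Real.exp (φ n z) + 1 with hA
  set K : ℕ → Z → ℝ := fun n z =>
    klFun (ρ z).toReal - (ρ z).toReal * φ n z + Real.exp (φ n z) - 1 with hK
  have hAm : ∀ n, Measurable (A n) := fun n => by have := hφm n; fun_prop
  have hKm : ∀ n, Measurable (K n) := fun n => by have := hφm n; fun_prop
  have hgood : ∀ᵐ z ∂M, 0 < (w z).toReal ∧ w z ≠ ∞ ∧ ρ z ≠ ∞ ∧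
      Real.log (w z).toReal = s (α z) + t (β z) := by
    filter_upwards [ha0, hb0, hρT] with z hz1 hz2 hz3
    have hp1 := ENNReal.toReal_pos hz1.1 hz1.2
    have hp2 := ENNReal.toReal_pos hz2.1 hz2.2
    refine ⟨?_, ?_, hz3, ?_⟩
    · rw [hw, ENNReal.toReal_mul]
      positivity
    · rw [hw]
      exact ENNReal.mul_ne_top hz1.2 hz2.2
    · rw [hw, ENNReal.toReal_mul, Real.log_mul hp1.ne' hp2.ne']
  have hA0 : ∀ n, ∀ᵐ z ∂M, 0 ≤ A n z := by
    intro n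
    filter_upwards [hgood] with z hz
    refine mul_sub_exp_add_one_nonneg hz.1 ?_
    rw [hz.2.2.2]
    exact clip_add_clip_between n _ _
  have hK0 : ∀ n z, 0 ≤ K n z := fun n z => klFun_sub_mul_add_exp_nonneg ENNReal.toReal_nonneg _
  have hid : ∀ n, ∫⁻ z, (ENNReal.ofReal (A n z) + ENNReal.ofReal (K n z)) ∂M =
      ∫⁻ z, ENNReal.ofReal (klFun (ρ z).toReal) ∂M := by
    intro n
    have hφn := hφm n
    have hAn := hAm n
    have hKn := hKm n
    -- Adding 2n to φ_n, and compensating on the other side, keeps every integrand nonnegative; the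
    -- finite extra terms are cancelled afterwards.
    have hsum : ∫⁻ z, (ENNReal.ofReal (A n z) + ENNReal.ofReal (K n z)) ∂M +
        (∫⁻ z, ρ z * ENNReal.ofReal (φ n z + 2 * n) ∂M + ∫⁻ z, w z * ENNReal.ofReal (2 * n) ∂M) =
        ∫⁻ z, ENNReal.ofReal (klFun (ρ z).toReal) ∂M +
          (∫⁻ z, w z * ENNReal.ofReal (φ n z + 2 * n) ∂M + ∫⁻ z, ρ z * ENNReal.ofReal (2 * n) ∂M) := by
      have h2n : (0 : ℝ) ≤ 2 * n := by positivity
      rw [← lintegral_add_left (by fun_prop), ← lintegral_add_left (by fun_prop),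
        ← lintegral_add_left (by fun_prop), ← lintegral_add_left (by fun_prop)]
      refine lintegral_congr_ae ?_
      filter_upwards [hgood, hA0 n] with z hz hz2
      have hk := klFun_nonneg (ENNReal.toReal_nonneg (a := ρ z))
      have hc := hφ0 n z
      have hK' := hK0 n z
      have e1 : ∀ c, 0 ≤ c → ρ z * ENNReal.ofReal c = ENNReal.ofReal ((ρ z).toReal * c) :=
        fun c _ => by
          rw [ENNReal.ofReal_mul ENNReal.toReal_nonneg, ENNReal.ofReal_toReal hz.2.2.1]
      have e2 : ∀ c, 0 ≤ c → w z * ENNReal.ofReal c = ENNReal.ofReal ((w z).toReal * c) :=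
        fun c _ => by
          rw [ENNReal.ofReal_mul ENNReal.toReal_nonneg, ENNReal.ofReal_toReal hz.2.1]
      have p1 : ∀ c, 0 ≤ c → 0 ≤ (ρ z).toReal * c := fun c h => mul_nonneg ENNReal.toReal_nonneg h
      have p2 : ∀ c, 0 ≤ c → 0 ≤ (w z).toReal * c := fun c h => mul_nonneg ENNReal.toReal_nonneg h
      rw [e1 _ hc, e2 _ hc, e1 _ h2n, e2 _ h2n, ← ENNReal.ofReal_add hz2 hK',
        ← ENNReal.ofReal_add (p1 _ hc) (p2 _ h2n), ← ENNReal.ofReal_add (p2 _ hc) (p1 _ h2n),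
        ← ENNReal.ofReal_add (add_nonneg hz2 hK') (add_nonneg (p1 _ hc) (p2 _ h2n)),
        ← ENNReal.ofReal_add hk (add_nonneg (p2 _ hc) (p1 _ h2n))]
      congr 1
      simp only [hA, hK]
      ring
    have hmass : ∫⁻ z, w z * ENNReal.ofReal (2 * n) ∂M = ∫⁻ z, ρ z * ENNReal.ofReal (2 * n) ∂M := by
      rw [lintegral_mul_const _ hwm, lintegral_mul_const _ hρ, hmass1]
    have hmassT : ∫⁻ z, ρ z * ENNReal.ofReal (2 * n) ∂M ≠ ∞ := by
      rw [lintegral_mul_const _ hρ]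
      exact ENNReal.mul_ne_top hρint ENNReal.ofReal_ne_top
    rw [hval n, hmass] at hsum
    exact (ENNReal.add_left_inj (ENNReal.add_ne_top.2 ⟨hvalT n, hmassT⟩)).1 hsum
  rw [← lintegral_add_left (by fun_prop)]
  -- At almost every point the truncation is eventually inactive, so the sequences are eventually
  -- constant.
  calc _ = ∫⁻ z, liminf (fun n => ENNReal.ofReal (A n z) + ENNReal.ofReal (K n z)) atTop ∂M := by
        refine lintegral_congr_ae ?_
        filter_upwards [hgood] with z hz
        refine (Tendsto.liminf_eq ?_).symm
        refine tendsto_const_nhds.congr' ?_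
        filter_upwards [eventually_ge_atTop (max ⌈|s (α z)|⌉₊ ⌈|t (β z)|⌉₊)] with n hn
        have hφn : φ n z = Real.log (w z).toReal := by
          have e1 : |s (α z)| ≤ n := (Nat.le_ceil _).trans
            (by exact_mod_cast (le_max_left _ _).trans hn)
          have e2 : |t (β z)| ≤ n := (Nat.le_ceil _).trans
            (by exact_mod_cast (le_max_right _ _).trans hn)
          simp only [hφ, clip_eq e1, clip_eq e2, hz.2.2.2]
        simp only [hA, hK, hφn, Real.exp_log hz.1, klFun_apply]
        congr 2
        ring
    _ ≤ liminf (fun n => ∫⁻ z, (ENNReal.ofReal (A n z) + ENNReal.ofReal (K n z)) ∂M) atTop :=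
        lintegral_liminf_le fun n => by have := hAm n; have := hKm n; fun_prop
    _ = _ := by simp only [hid, liminf_const]

/-- The factors may be 0 or ∞, so the gap inequality is applied on the set G where both are positive
and finite. Both measures live on G, the competitor because its images agree, and off G both
densities vanish and contribute the same M(Gᶜ). Equal finite entropies make the gap vanish, which
forces the densities to agree. -/
theorem klDiv_withDensity_mul_le [IsFiniteMeasure M] [IsProbabilityMeasure π] {w : Z → ℝ≥0∞}
    [IsProbabilityMeasure (M.withDensity w)]
    (hα : Measurable α) (hβ : Measurable β) (ha : Measurable a) (hb : Measurable b)
    (hw : ∀ z, w z = a (α z) * b (β z))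
    (h1 : π.map α = (M.withDensity w).map α) (h2 : π.map β = (M.withDensity w).map β) :
    klDiv (M.withDensity w) M ≤ klDiv π M ∧
      (klDiv π M ≤ klDiv (M.withDensity w) M → klDiv π M ≠ ∞ → π = M.withDensity w) := by
  by_cases hac : π ≪ M
  swap
  · rw [klDiv_of_not_ac hac]
    exact ⟨le_top, fun _ h => absurd rfl h⟩
  have hwm : Measurable w := by
    rw [show w = fun z => a (α z) * b (β z) from funext hw]
    fun_prop
  set ρ := π.rnDeriv M with hρdef
  have hρ : Measurable ρ := Measure.measurable_rnDeriv _ _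
  have hπ : M.withDensity ρ = π := Measure.withDensity_rnDeriv_eq _ _ hac
  have hkm := measurable_klFun
  set S₁ : Set Z₁ := {z | a z ≠ 0 ∧ a z ≠ ∞} with hS₁
  set S₂ : Set Z₂ := {z | b z ≠ 0 ∧ b z ≠ ∞} with hS₂
  have hS₁m : MeasurableSet S₁ :=
    (ha (measurableSet_singleton 0)).compl.inter (ha (measurableSet_singleton ∞)).compl
  have hS₂m : MeasurableSet S₂ :=
    (hb (measurableSet_singleton 0)).compl.inter (hb (measurableSet_singleton ∞)).compl
  set G := α ⁻¹' S₁ ∩ β ⁻¹' S₂ with hG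
  have hGm : MeasurableSet G := (hα hS₁m).inter (hβ hS₂m)
  have hwT : ∀ᵐ z ∂M, w z < ∞ := by
    refine ae_lt_top hwm ?_
    have : (M.withDensity w) univ ≠ ∞ := measure_ne_top _ _
    rwa [withDensity_apply _ .univ, setLIntegral_univ] at this
  have hwG : ∀ᵐ z ∂(M.withDensity w), z ∈ G := by
    rw [ae_withDensity_iff hwm]
    filter_upwards [hwT] with z hz hz0
    rw [hw] at hz hz0
    have ha0 := left_ne_zero_of_mul hz0
    have hb0 := right_ne_zero_of_mul hz0
    refine ⟨⟨ha0, fun h => ?_⟩, ⟨hb0, fun h => ?_⟩⟩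
    · rw [h, ENNReal.top_mul hb0] at hz
      exact lt_irrefl _ hz
    · rw [h, ENNReal.mul_top ha0] at hz
      exact lt_irrefl _ hz
  have hπG : ∀ᵐ z ∂π, z ∈ G := by
    have e1 : ∀ᵐ z ∂π, α z ∈ S₁ := by
      rw [← ae_map_iff (p := fun z => z ∈ S₁) hα.aemeasurable hS₁m, h1,
        ae_map_iff (p := fun z => z ∈ S₁) hα.aemeasurable hS₁m]
      exact hwG.mono fun z hz => hz.1
    have e2 : ∀ᵐ z ∂π, β z ∈ S₂ := by
      rw [← ae_map_iff (p := fun z => z ∈ S₂) hβ.aemeasurable hS₂m, h2,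
        ae_map_iff (p := fun z => z ∈ S₂) hβ.aemeasurable hS₂m]
      exact hwG.mono fun z hz => hz.2
    exact e1.and e2
  have hrw : (M.restrict G).withDensity w = M.withDensity w := by
    rw [← restrict_withDensity hGm, Measure.restrict_eq_self_of_ae_mem hwG]
  have hrρ : (M.restrict G).withDensity ρ = π := by
    rw [← restrict_withDensity hGm, hπ, Measure.restrict_eq_self_of_ae_mem hπG]
  have hGR : ∀ᵐ z ∂(M.restrict G), z ∈ G := ae_restrict_mem hGm
  have key := lintegral_klFun_add_le (M := M.restrict G) (π := π) (w := w) (ρ := ρ) hα hβ ha hb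
    (hGR.mono fun z hz => hz.1) (hGR.mono fun z hz => hz.2) hw hρ
    (ae_restrict_of_ae ((Measure.rnDeriv_lt_top π M).mono fun z hz => hz.ne)) hrρ.symm
    (by rw [hrw, h1]) (by rw [hrw, h2])
  have hzero : ∀ v : Z → ℝ≥0∞, Measurable v → (∀ᵐ z ∂(M.withDensity v), z ∈ G) →
      ∫⁻ z in Gᶜ, ENNReal.ofReal (klFun (v z).toReal) ∂M = M Gᶜ := by
    intro v hv hvG
    rw [← setLIntegral_one]
    refine setLIntegral_congr_fun_ae hGm.compl ?_
    rw [ae_withDensity_iff hv] at hvG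
    filter_upwards [hvG] with z hz hzG
    have : v z = 0 := by
      by_contra h
      exact hzG (hz h)
    simp [this, klFun_zero]
  have hsplit : ∀ v : Z → ℝ≥0∞, Measurable v → (∀ᵐ z ∂(M.withDensity v), z ∈ G) →
      ∫⁻ z, ENNReal.ofReal (klFun (v z).toReal) ∂M =
        ∫⁻ z in G, ENNReal.ofReal (klFun (v z).toReal) ∂M + M Gᶜ := by
    intro v hv hvG
    rw [← lintegral_add_compl _ hGm, hzero v hv hvG]
  have kπ : klDiv π M = ∫⁻ z in G, ENNReal.ofReal (klFun (ρ z).toReal) ∂M + M Gᶜ := by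
    rw [klDiv_eq_lintegral_klFun_of_ac hac, ← hsplit ρ hρ (by rwa [hπ])]
  have kw : klDiv (M.withDensity w) M =
      ∫⁻ z in G, ENNReal.ofReal (klFun (w z).toReal) ∂M + M Gᶜ := by
    rw [klDiv_eq_lintegral_klFun_of_ac (withDensity_absolutelyContinuous _ _), ← hsplit w hwm hwG]
    refine lintegral_congr_ae ?_
    filter_upwards [Measure.rnDeriv_withDensity M hwm] with z hz
    rw [hz]
  refine ⟨?_, fun hle hT => ?_⟩
  · rw [kπ, kw]
    exact add_le_add_left (le_self_add.trans key) _
  · rw [kπ] at hT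
    have hT' := (ENNReal.add_ne_top.1 hT).1
    rw [kπ, kw, ENNReal.add_le_add_iff_right (measure_ne_top _ _)] at hle
    have hgap : ∫⁻ z in G, ENNReal.ofReal (klFun (ρ z).toReal - (ρ z).toReal *
        Real.log (w z).toReal + (w z).toReal - 1) ∂M = 0 := by
      have hwne := ne_top_of_le_ne_top hT' (le_self_add.trans key)
      have := key.trans hle
      exact le_antisymm ((ENNReal.add_le_add_iff_left hwne).1 (this.trans (add_zero _).ge)) zero_le
    rw [lintegral_eq_zero_iff (by fun_prop)] at hgap
    rw [← hrw, ← hrρ]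
    refine withDensity_congr_ae ?_
    filter_upwards [hgap, hGR, ae_restrict_of_ae (Measure.rnDeriv_lt_top π M),
      ae_restrict_of_ae hwT] with z hz hzG hz1 hz2
    have hw0 : 0 < (w z).toReal := by
      refine ENNReal.toReal_pos ?_ hz2.ne
      rw [hw]
      exact mul_ne_zero hzG.1.1 hzG.2.1
    have hnn := klFun_sub_mul_add_exp_nonneg (ENNReal.toReal_nonneg (a := ρ z))
      (Real.log (w z).toReal)
    rw [Real.exp_log hw0] at hnn
    have := eq_of_klFun_sub_eq_zero ENNReal.toReal_nonneg hw0
      (le_antisymm (ENNReal.ofReal_eq_zero.1 hz) hnn)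
    exact (ENNReal.toReal_eq_toReal_iff' hz1.ne hz2.ne).1 this

end Entropy

end CondSchrodinger

/-! ### Continuity of solutions -/

namespace CondSchrodinger

open Filter Topology Set

section Continuity

variable {X : Type*} [MeasurableSpace X] {n : ℕ} {P : Measure X} {k : X → (Fin n → ℝ) → ℝ}
  {ψ f : (Fin n → ℝ) → ℝ} {u : X → ℝ≥0∞}

lemma lintegral_exp_mul_eq (ψ : (Fin n → ℝ) → ℝ) (k : X → (Fin n → ℝ) → ℝ) (u : X → ℝ≥0∞)
    (y : Fin n → ℝ) :
    ∫⁻ x, ENNReal.ofReal (Real.exp (ψ y) * k x y) / u x ∂P =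
      ENNReal.ofReal (Real.exp (ψ y)) * ∫⁻ x, ENNReal.ofReal (k x y) / u x ∂P := by
  rw [← lintegral_const_mul' _ _ ENNReal.ofReal_ne_top]
  refine lintegral_congr fun x => ?_
  rw [ENNReal.ofReal_mul (Real.exp_pos _).le, mul_div_assoc]

/-- exp(ψ) k(x, ·) is the exponential of a convex function, hence convex, and convexity survives
integration in x. -/
lemma lintegral_exp_mul_convex (hkm : ∀ y, Measurable fun x => k x y) (hum : Measurable u)
    (hk0 : ∀ x y, 0 < k x y)
    (hconv : ∀ x, ConvexOn ℝ univ fun y => Real.log (k x y) + ψ y) (y z : Fin n → ℝ) {a b : ℝ}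
    (ha : 0 ≤ a) (hb : 0 ≤ b) (hab : a + b = 1) :
    ∫⁻ x, ENNReal.ofReal (Real.exp (ψ (a • y + b • z)) * k x (a • y + b • z)) / u x ∂P ≤
      ENNReal.ofReal a * ∫⁻ x, ENNReal.ofReal (Real.exp (ψ y) * k x y) / u x ∂P +
      ENNReal.ofReal b * ∫⁻ x, ENNReal.ofReal (Real.exp (ψ z) * k x z) / u x ∂P := by
  have hm1 := hkm y
  have hm2 := hkm z
  rw [← lintegral_const_mul _ (by fun_prop), ← lintegral_const_mul _ (by fun_prop),
    ← lintegral_add_left (by fun_prop)]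
  refine lintegral_mono fun x => ?_
  rw [← mul_div_assoc, ← mul_div_assoc, ENNReal.div_add_div_same, ← ENNReal.ofReal_mul ha,
    ← ENNReal.ofReal_mul hb]
  gcongr
  rw [← ENNReal.ofReal_add (mul_nonneg ha (mul_nonneg (Real.exp_pos _).le (hk0 _ _).le))
    (mul_nonneg hb (mul_nonneg (Real.exp_pos _).le (hk0 _ _).le))]
  refine ENNReal.ofReal_le_ofReal ?_
  have he : ∀ y, Real.exp (ψ y) * k x y = Real.exp (Real.log (k x y) + ψ y) := fun y => by
    rw [Real.exp_add, Real.exp_log (hk0 x y), mul_comm]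
  rw [he, he, he]
  have h1 := (hconv x).2 (mem_univ y) (mem_univ z) ha hb hab
  have h2 := convexOn_exp.2 (mem_univ (Real.log (k x y) + ψ y)) (mem_univ (Real.log (k x z) + ψ z))
    ha hb hab
  exact (Real.exp_le_exp.2 h1).trans h2

variable (hkm : ∀ y, Measurable fun x => k x y) (hum : Measurable u)
    (hk0 : ∀ x y, 0 < k x y) (hconv : ∀ x, ConvexOn ℝ univ fun y => Real.log (k x y) + ψ y)
    (hf : Continuous f) (hfin : ∀ᵐ y, 0 < f y → ∫⁻ x, ENNReal.ofReal (k x y) / u x ∂P ≠ ∞)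

include hkm hum hk0 hconv hf hfin

/-- Almost everywhere finiteness becomes finiteness everywhere on {f > 0}: y is the midpoint of y +
v and y - v, and arbitrarily small v make both points good. -/
lemma lintegral_kernel_div_ne_top {y : Fin n → ℝ} (hy : 0 < f y) :
    ∫⁻ x, ENNReal.ofReal (k x y) / u x ∂P ≠ ∞ := by
  have h1 : ∀ᵐ v, 0 < f (y + v) → ∫⁻ x, ENNReal.ofReal (k x (y + v)) / u x ∂P ≠ ∞ :=
    (measurePreserving_add_left volume y).quasiMeasurePreserving.ae hfin
  have h2 : ∀ᵐ v, 0 < f (y - v) → ∫⁻ x, ENNReal.ofReal (k x (y - v)) / u x ∂P ≠ ∞ :=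
    (Measure.measurePreserving_sub_left volume y).quasiMeasurePreserving.ae hfin
  have hopen : IsOpen {v : Fin n → ℝ | 0 < f (y + v) ∧ 0 < f (y - v)} :=
    have o1 : IsOpen {v : Fin n → ℝ | 0 < f (y + v)} := isOpen_lt continuous_const (by fun_prop)
    have o2 : IsOpen {v : Fin n → ℝ | 0 < f (y - v)} := isOpen_lt continuous_const (by fun_prop)
    o1.inter o2
  obtain ⟨v, ⟨hv1, hv2⟩, hv⟩ := (Measure.dense_of_ae (h1.and h2)).inter_open_nonempty _ hopen
    ⟨0, by simpa using hy⟩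
  have hc := lintegral_exp_mul_convex (P := P) hkm hum hk0 hconv (y + v) (y - v) (a := 1 / 2)
    (b := 1 / 2) (by norm_num) (by norm_num) (by norm_num)
  have he : (1 / 2 : ℝ) • (y + v) + (1 / 2 : ℝ) • (y - v) = y := by
    rw [← smul_add]
    simp [← two_smul ℝ y, smul_smul]
  rw [he, lintegral_exp_mul_eq, lintegral_exp_mul_eq, lintegral_exp_mul_eq] at hc
  intro htop
  rw [htop, ENNReal.mul_top (by simp [Real.exp_pos])] at hc
  refine absurd hc (not_le.2 ?_)
  refine ENNReal.add_lt_top.2 ⟨?_, ?_⟩ <;>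
  refine ENNReal.mul_lt_top ENNReal.ofReal_lt_top (ENNReal.mul_lt_top ENNReal.ofReal_lt_top ?_)
  · exact (hv.1 hv1).lt_top
  · exact (hv.2 hv2).lt_top

/-- A finite convex function on an open ball of a finite-dimensional space is continuous, and the
continuous factor exp(ψ) can be divided out. -/
lemma continuousAt_lintegral_kernel_div (hψ : Continuous ψ) {y : Fin n → ℝ} (hy : 0 < f y) :
    ContinuousAt (fun y => ∫⁻ x, ENNReal.ofReal (k x y) / u x ∂P) y := by
  set G : (Fin n → ℝ) → ℝ≥0∞ := fun y => ∫⁻ x, ENNReal.ofReal (k x y) / u x ∂P with hG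
  have hU : IsOpen {y | 0 < f y} := isOpen_lt continuous_const hf
  obtain ⟨r, hr, hball⟩ := Metric.isOpen_iff.1 hU y hy
  have hGfin : ∀ z ∈ Metric.ball y r, G z ≠ ∞ := fun z hz =>
    lintegral_kernel_div_ne_top hkm hum hk0 hconv hf hfin (hball hz)
  have hcx : ConvexOn ℝ (Metric.ball y r) fun z => Real.exp (ψ z) * (G z).toReal := by
    refine ⟨convex_ball y r, fun z hz z' hz' a b ha hb hab => ?_⟩
    have hc := lintegral_exp_mul_convex (P := P) hkm hum hk0 hconv z z' ha hb hab
    rw [lintegral_exp_mul_eq, lintegral_exp_mul_eq, lintegral_exp_mul_eq] at hc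
    have hT : ∀ z ∈ Metric.ball y r, ∀ a : ℝ,
        ENNReal.ofReal a * (ENNReal.ofReal (Real.exp (ψ z)) * G z) ≠ ∞ := fun z hz a =>
      ENNReal.mul_ne_top ENNReal.ofReal_ne_top
        (ENNReal.mul_ne_top ENNReal.ofReal_ne_top (hGfin z hz))
    have := ENNReal.toReal_mono (ENNReal.add_ne_top.2 ⟨hT z hz a, hT z' hz' b⟩) hc
    rw [ENNReal.toReal_add (hT z hz a) (hT z' hz' b)] at this
    simpa only [ENNReal.toReal_mul, ENNReal.toReal_ofReal ha, ENNReal.toReal_ofReal hb,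
      ENNReal.toReal_ofReal (Real.exp_pos _).le, smul_eq_mul] using this
  have hcont := (hcx.continuousOn Metric.isOpen_ball).continuousAt (Metric.ball_mem_nhds y hr)
  have hcont2 : ContinuousAt (fun z => Real.exp (-ψ z) * (Real.exp (ψ z) * (G z).toReal)) y :=
    ContinuousAt.mul (by fun_prop) hcont
  have hcont3 : ContinuousAt (fun z => ENNReal.ofReal (G z).toReal) y := by
    refine (ENNReal.continuous_ofReal.continuousAt.comp hcont2).congr (Eventually.of_forall fun z => ?_)
    simp only [Function.comp]
    rw [← mul_assoc, ← Real.exp_add, neg_add_cancel, Real.exp_zero, one_mul]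
  refine hcont3.congr ?_
  filter_upwards [Metric.ball_mem_nhds y hr] with z hz
  exact ENNReal.ofReal_toReal (hGfin z hz)

/-- The solution `f / ∫ k / u dP` of the functional equation is continuous. -/
theorem continuous_div_lintegral_kernel [IsProbabilityMeasure P] (hψ : Continuous ψ)
    (hkc : ∀ x, Continuous (k x)) (hf0 : ∀ y, 0 ≤ f y) (huT : ∀ᵐ x ∂P, u x ≠ ∞) :
    Continuous fun y =>
      (ENNReal.ofReal (f y) / ∫⁻ x, ENNReal.ofReal (k x y) / u x ∂P).toNNReal := by
  set G : (Fin n → ℝ) → ℝ≥0∞ := fun y => ∫⁻ x, ENNReal.ofReal (k x y) / u x ∂P with hG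
  have hG0 : ∀ y, G y ≠ 0 := by
    intro y h0
    have hm := hkm y
    rw [hG, lintegral_eq_zero_iff (by fun_prop)] at h0
    obtain ⟨x, hx, hx2⟩ := (h0.and huT).exists
    simp [ENNReal.div_eq_zero_iff, hx2, not_le.2 (hk0 x y)] at hx
  have hfc : Continuous fun y => ENNReal.ofReal (f y) := ENNReal.continuous_ofReal.comp hf
  have hne : ∀ y, ENNReal.ofReal (f y) / G y ≠ ∞ := fun y =>
    ENNReal.div_ne_top ENNReal.ofReal_ne_top (hG0 y)
  have hcont : Continuous fun y => ENNReal.ofReal (f y) / G y := by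
    rw [continuous_iff_continuousAt]
    intro y
    rcases (hf0 y).eq_or_lt with hy | hy
    -- At a zero of f the integral G may be infinite or discontinuous. By Fatou it is lower
    -- semicontinuous, so it stays above some c > 0 nearby, and f / G ≤ f / c tends to 0.
    · refine tendsto_of_seq_tendsto fun v hv => ?_
      simp only [← hy, ENNReal.ofReal_zero, ENNReal.zero_div]
      obtain ⟨c, hc0, hcG⟩ := ENNReal.lt_iff_exists_nnreal_btwn.1 (pos_iff_ne_zero.2 (hG0 y))
      have hlim : G y ≤ liminf (fun j => G (v j)) atTop := by
        calc G y = ∫⁻ x, liminf (fun j => ENNReal.ofReal (k x (v j)) / u x) atTop ∂P := by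
              refine lintegral_congr_ae ?_
              filter_upwards [huT] with x hx
              refine (Tendsto.liminf_eq ?_).symm
              refine ENNReal.Tendsto.div_const ?_ (Or.inl ?_)
              · exact ENNReal.tendsto_ofReal (((hkc x).tendsto y).comp hv)
              · simp [hk0 x y]
          _ ≤ _ := lintegral_liminf_le fun j => by have := hkm (v j); fun_prop
      have hev : ∀ᶠ j in atTop, (c : ℝ≥0∞) < G (v j) := eventually_lt_of_lt_liminf (hcG.trans_le hlim)
      have ht : Tendsto (fun j => ENNReal.ofReal (f (v j)) / c) atTop (𝓝 0) := by
        have := ENNReal.Tendsto.div_const ((hfc.tendsto y).comp hv) (b := (c : ℝ≥0∞))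
          (Or.inr hc0.ne')
        simpa [← hy] using this
      refine tendsto_of_tendsto_of_tendsto_of_le_of_le' tendsto_const_nhds ht
        (Eventually.of_forall fun _ => zero_le) ?_
      filter_upwards [hev] with j hj
      exact ENNReal.div_le_div_left hj.le _
    · exact ENNReal.Tendsto.div (hfc.tendsto y) (Or.inr (hG0 y))
        (continuousAt_lintegral_kernel_div hkm hum hk0 hconv hf hfin hψ hy)
        (Or.inr ENNReal.ofReal_ne_top)
  rw [continuous_iff_continuousAt]
  intro y
  exact (ENNReal.tendsto_toNNReal (hne y)).comp (hcont.tendsto y)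

end Continuity

end CondSchrodinger

/-! ### Splitting coordinates -/

namespace CondSchrodinger

open Filter Topology Set

section Coordinates

lemma measurable_finAppend {a b : ℕ} :
    Measurable fun q : (Fin a → ℝ) × (Fin b → ℝ) => Fin.append q.1 q.2 := by
  refine measurable_pi_lambda _ fun k => ?_
  refine Fin.addCases (fun j => ?_) (fun j => ?_) k
  · simp only [Fin.append_left]; fun_prop
  · simp only [Fin.append_right]; fun_prop

lemma measurePreserving_finAppend (a b : ℕ) :
    MeasurePreserving (fun q : (Fin a → ℝ) × (Fin b → ℝ) => Fin.append q.1 q.2)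
      (volume.prod volume) volume := by
  refine ⟨measurable_finAppend, (Measure.pi_eq fun s hs => ?_).symm⟩
  rw [Measure.map_apply measurable_finAppend (MeasurableSet.univ_pi hs)]
  have : (fun q : (Fin a → ℝ) × (Fin b → ℝ) => Fin.append q.1 q.2) ⁻¹' univ.pi s =
      (univ.pi fun i => s (Fin.castAdd b i)) ×ˢ (univ.pi fun i => s (Fin.natAdd a i)) := by
    ext q
    simp only [mem_preimage, mem_univ_pi, mem_prod]
    constructor
    · intro h
      exact ⟨fun i => by simpa using h (Fin.castAdd b i), fun i => by simpa using h (Fin.natAdd a i)⟩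
    · rintro ⟨h1, h2⟩ k
      refine Fin.addCases (fun j => ?_) (fun j => ?_) k
      · simpa using h1 j
      · simpa using h2 j
  rw [this, Measure.prod_prod, volume_pi_pi, volume_pi_pi, Fin.prod_univ_add]

lemma lintegral_finAppend {a b : ℕ} {g : (Fin (a + b) → ℝ) → ℝ≥0∞} (hg : Measurable g) :
    ∫⁻ y, g y = ∫⁻ u : Fin a → ℝ, ∫⁻ v : Fin b → ℝ, g (Fin.append u v) := by
  rw [← (measurePreserving_finAppend a b).lintegral_comp hg,
    lintegral_prod (fun q : (Fin a → ℝ) × (Fin b → ℝ) => g (Fin.append q.1 q.2))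
      (hg.comp measurable_finAppend).aemeasurable]

/-- Lebesgue integrals over `ℝ^c` split as iterated integrals over `ℝ^a` and `ℝ^b`. -/
lemma lintegral_cast_finAppend {a b c : ℕ} (h : c = a + b) {g : (Fin c → ℝ) → ℝ≥0∞}
    (hg : Measurable g) :
    ∫⁻ y, g y = ∫⁻ u : Fin a → ℝ, ∫⁻ v : Fin b → ℝ, g fun k => Fin.append u v (Fin.cast h k) := by
  subst h
  exact lintegral_finAppend hg

variable {d : ℕ → ℕ} {k₀ : ℕ} {i : ℕ}

@[simp]
lemma head_join (t : E d i) (z : B d (i + 1)) : head (join t z) = t := by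
  ext k
  exact Fin.append_left t z k

@[simp]
lemma lastBlock_join (t : E d i) (z : B d (i + 1)) : lastBlock (join t z) = z := by
  ext k
  exact Fin.append_right t z k

@[simp]
lemma join_head_lastBlock (y : E d (i + 1)) : join (head y) (lastBlock y) = y :=
  Fin.append_castAdd_natAdd

@[fun_prop]
lemma continuous_head : Continuous (head : E d (i + 1) → E d i) := by
  unfold head; fun_prop

@[fun_prop]
lemma continuous_lastBlock : Continuous (lastBlock : E d (i + 1) → B d (i + 1)) := by
  unfold lastBlock; fun_prop

lemma continuous_join : Continuous fun q : E d i × B d (i + 1) => join q.1 q.2 := by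
  refine continuous_pi fun k => ?_
  refine Fin.addCases (fun j => ?_) (fun j => ?_) k
  · simp only [join, Fin.append_left]; fun_prop
  · simp only [join, Fin.append_right]; fun_prop

@[fun_prop]
lemma measurable_head : Measurable (head : E d (i + 1) → E d i) := continuous_head.measurable

@[fun_prop]
lemma measurable_lastBlock : Measurable (lastBlock : E d (i + 1) → B d (i + 1)) :=
  continuous_lastBlock.measurable

@[fun_prop]
lemma Continuous.join {A : Type*} [TopologicalSpace A] {u : A → E d i} {v : A → B d (i + 1)}
    (hu : Continuous u) (hv : Continuous v) : Continuous fun a => join (u a) (v a) :=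
  continuous_join.comp (hu.prodMk hv)

@[fun_prop]
lemma Measurable.join {A : Type*} [MeasurableSpace A] {u : A → E d i} {v : A → B d (i + 1)}
    (hu : Measurable u) (hv : Measurable v) : Measurable fun a => join (u a) (v a) :=
  continuous_join.measurable.comp (hu.prodMk hv)

lemma measurePreserving_join :
    MeasurePreserving (fun q : E d i × B d (i + 1) => join q.1 q.2) (volume.prod volume) volume :=
  measurePreserving_finAppend _ _

lemma lintegral_join {g : E d (i + 1) → ℝ≥0∞} (hg : Measurable g) :
    ∫⁻ y, g y = ∫⁻ t : E d i, ∫⁻ z : B d (i + 1), g (join t z) :=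
  lintegral_finAppend hg

lemma ae_join_iff {q : E d (i + 1) → Prop} (hq : MeasurableSet {y | q y}) :
    (∀ᵐ y, q y) ↔ ∀ᵐ t : E d i, ∀ᵐ z : B d (i + 1), q (join t z) := by
  rw [← Measure.ae_prod_iff_ae_ae (p := fun a : E d i × B d (i + 1) => q (join a.1 a.2))
      (measurePreserving_join.measurable hq), ← measurePreserving_join.map_eq,
    ae_map_iff measurePreserving_join.measurable.aemeasurable hq]

lemma ae_ae_of_ae_join {q : E d (i + 1) → Prop} (h : ∀ᵐ y, q y) :
    ∀ᵐ t : E d i, ∀ᵐ z : B d (i + 1), q (join t z) :=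
  Measure.ae_ae_of_ae_prod (measurePreserving_join.quasiMeasurePreserving.ae h)

lemma nn_mono : Monotone (nn d) := monotone_nat_of_le_succ fun _ => Nat.le_add_right _ _

lemma isEmpty_fin_nn_zero : IsEmpty (Fin (nn d 0)) := by
  rw [nn]; infer_instance

lemma measurable_coords {N m : ℕ} : Measurable (coords m : (Fin N → ℝ) → Fin m → ℝ) := by
  refine measurable_pi_lambda _ fun k => ?_
  unfold coords
  split_ifs <;> fun_prop

@[simp]
lemma coords_self {N : ℕ} (x : Fin N → ℝ) : coords N x = x := by
  ext k
  simp [coords]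

lemma coords_coords {N m l : ℕ} (h : l ≤ m) (x : Fin N → ℝ) :
    coords l (coords m x) = coords l x := by
  ext k
  have : k.1 < m := by omega
  simp [coords, this]

lemma coords_coords_of_le {N m l : ℕ} (h : N ≤ m) (x : Fin N → ℝ) :
    coords l (coords m x) = coords l x := by
  ext k
  by_cases hk : k.1 < N
  · have : k.1 < m := by omega
    simp [coords, this, hk]
  · simp [coords, hk]

lemma head_eq_coords (x : E d (i + 1)) : head x = coords (nn d i) x := by
  ext k
  have : k.1 < nn d (i + 1) := k.2.trans_le (nn_mono (Nat.le_succ i))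
  simp only [head, coords, this, dif_pos]
  rfl

lemma coords_head {m : ℕ} (h : m ≤ nn d i) (x : E d (i + 1)) : coords m (head x) = coords m x := by
  rw [head_eq_coords, coords_coords h]

lemma glue_eq_append {m N : ℕ} (h : N = m + (N - m)) (y : Fin m → ℝ) (z : Fin (N - m) → ℝ) :
    glue y z = fun k : Fin N => Fin.append y z (Fin.cast h k) := by
  ext k
  by_cases hk : k.1 < m
  · have : Fin.cast h k = Fin.castAdd (N - m) ⟨k.1, hk⟩ := rfl
    rw [this, Fin.append_left]
    simp [glue, hk]
  · have : Fin.cast h k = Fin.natAdd m ⟨k.1 - m, by omega⟩ := by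
      ext; simp; omega
    rw [this, Fin.append_right]
    simp [glue, hk]

lemma continuous_glue {m N : ℕ} :
    Continuous fun q : (Fin m → ℝ) × (Fin (N - m) → ℝ) => (glue q.1 q.2 : Fin N → ℝ) := by
  refine continuous_pi fun k => ?_
  unfold glue
  split_ifs <;> fun_prop

lemma continuous_glue_right {m N : ℕ} (y : Fin m → ℝ) :
    Continuous fun z : Fin (N - m) → ℝ => (glue y z : Fin N → ℝ) :=
  continuous_glue.comp (Continuous.prodMk_right y)

lemma lintegral_glue {m N : ℕ} (h : m ≤ N) {g : (Fin N → ℝ) → ℝ≥0∞} (hg : Measurable g) :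
    ∫⁻ y, g y = ∫⁻ u : Fin m → ℝ, ∫⁻ v : Fin (N - m) → ℝ, g (glue u v) := by
  have hN : N = m + (N - m) := by omega
  rw [lintegral_cast_finAppend hN hg]
  simp only [glue_eq_append hN]

lemma coords_glue {m N : ℕ} (h : m ≤ N) (y : Fin m → ℝ) (z : Fin (N - m) → ℝ) :
    coords m (glue y z : Fin N → ℝ) = y := by
  ext k
  have : k.1 < N := by omega
  simp [coords, glue, this]

lemma glue_self {N : ℕ} (y : Fin N → ℝ) (z : Fin (N - N) → ℝ) : glue y z = y := by
  ext k
  simp [glue]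

lemma lintegral_glue_join (h : i + 1 ≤ k₀) (t : E d i) {g : E d k₀ → ℝ≥0∞} (hg : Measurable g) :
    ∫⁻ w : Fin (nn d k₀ - nn d i) → ℝ, g (glue t w) =
      ∫⁻ z : B d (i + 1), ∫⁻ v : Fin (nn d k₀ - nn d (i + 1)) → ℝ, g (glue (join t z) v) := by
  have h1 := nn_mono (d := d) h
  have h2 : nn d (i + 1) = nn d i + d (i + 1) := rfl
  have hc : nn d k₀ - nn d i = d (i + 1) + (nn d k₀ - nn d (i + 1)) := by omega
  rw [lintegral_cast_finAppend (g := fun w => g (glue t w)) hc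
    (hg.comp (continuous_glue_right t).measurable)]
  refine lintegral_congr fun z => lintegral_congr fun v => congrArg g ?_
  ext k
  by_cases hk : k.1 < nn d i
  · have hk' : k.1 < nn d (i + 1) := by omega
    simp only [glue, hk, hk', dif_pos]
    exact (Fin.append_left t z ⟨k.1, hk⟩).symm
  · by_cases hk' : k.1 < nn d (i + 1)
    · have e1 : (⟨k.1, hk'⟩ : Fin (nn d i + d (i + 1))) =
          Fin.natAdd (nn d i) ⟨k.1 - nn d i, by omega⟩ := by ext; simp; omega
      have e2 : Fin.cast hc ⟨k.1 - nn d i, by omega⟩ =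
          Fin.castAdd (nn d k₀ - nn d (i + 1)) ⟨k.1 - nn d i, by omega⟩ := rfl
      simp only [glue, hk, hk', dif_pos, dif_neg, not_false_eq_true]
      rw [e2, Fin.append_left]
      exact ((congrArg (Fin.append t z) e1).trans (Fin.append_right t z _)).symm
    · have e2 : Fin.cast hc ⟨k.1 - nn d i, by omega⟩ =
          Fin.natAdd (d (i + 1)) ⟨k.1 - nn d (i + 1), by omega⟩ := by ext; simp; omega
      simp only [glue, hk, hk', dif_neg, not_false_eq_true]
      rw [e2, Fin.append_right]

end Coordinates

/-! ### Marginals -/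

section Marginals

variable {d : ℕ → ℕ} {k₀ : ℕ} {i : ℕ} {p : E d k₀ → E d k₀ → ℝ} {f : E d k₀ → ℝ}

lemma pm_self (x y : E d k₀) : pm p k₀ x y = p x y := by
  simp only [pm, pFull, coords_self, glue_self]
  have : IsEmpty (Fin (nn d k₀ - nn d k₀)) := by rw [Nat.sub_self]; infer_instance
  simp [integral_const, volume_pi, Measure.real]

lemma fm_self (y : E d k₀) : fm f k₀ y = f y := by
  simp only [fm, glue_self]
  have : IsEmpty (Fin (nn d k₀ - nn d k₀)) := by rw [Nat.sub_self]; infer_instance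
  simp [integral_const, volume_pi, Measure.real]

lemma A0.continuous_pm (hp : A0 p) (h1 : 1 ≤ i) (hi : i ≤ k₀) :
    Continuous fun q : E d i × E d i => pm p i q.1 q.2 := by
  rcases hi.eq_or_lt with rfl | hi
  · simpa only [pm_self] using hp.cont
  · exact hp.marg_cont i h1 hi

lemma A0.integrable (hp : A0 p) (h1 : 1 ≤ i) (hi : i ≤ k₀) (x : E d k₀) (y : E d i) :
    Integrable fun z : Fin (nn d k₀ - nn d i) → ℝ => p x (glue y z) := by
  rcases hi.eq_or_lt with rfl | hi
  · have : IsEmpty (Fin (nn d i - nn d i)) := by rw [Nat.sub_self]; infer_instance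
    simp only [glue_self]
    have : IsFiniteMeasure (volume : Measure (Fin (nn d i - nn d i) → ℝ)) :=
      ⟨by simp [volume_pi]⟩
    exact integrable_const _
  · exact hp.marg_finite i h1 hi x y

lemma A0.ofReal_pFull (hp : A0 p) (h1 : 1 ≤ i) (hi : i ≤ k₀) (x : E d k₀) (y : E d i) :
    ENNReal.ofReal (pFull p i x y) =
      ∫⁻ z : Fin (nn d k₀ - nn d i) → ℝ, ENNReal.ofReal (p x (glue y z)) :=
  ofReal_integral_eq_lintegral_ofReal (hp.integrable h1 hi x y)
    (Eventually.of_forall fun _ => (hp.pos _ _).le)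

lemma A0.pm_pos (hp : A0 p) (h1 : 1 ≤ i) (hi : i ≤ k₀) (x y : E d i) : 0 < pm p i x y := by
  rw [pm, pFull, integral_pos_iff_support_of_nonneg (fun _ => (hp.pos _ _).le)
    (hp.integrable h1 hi _ y)]
  have : Function.support (fun z : Fin (nn d k₀ - nn d i) → ℝ =>
      p (coords (nn d k₀) x) (glue y z)) = univ := by
    ext z
    simp [(hp.pos _ _).ne']
  rw [this]
  exact isOpen_univ.measure_pos _ univ_nonempty

/-- Fubini over the tail coordinates gives the integral with the longer x; `marg_indep` then
discards its last block. This identifies the denominator of p_{i+1}(x, · | t) as p_i(x', t). -/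
lemma A0.lintegral_pm_join (hp : A0 p) (h1 : 1 ≤ i) (hi : i + 1 ≤ k₀) (x : E d (i + 1))
    (t : E d i) :
    ∫⁻ z : B d (i + 1), ENNReal.ofReal (pm p (i + 1) x (join t z)) =
      ENNReal.ofReal (pm p i (head x) t) := by
  have hm : Measurable fun y => ENNReal.ofReal (p (coords (nn d k₀) x) y) :=
    (hp.cont.comp (Continuous.prodMk_right (coords (nn d k₀) x))).measurable.ennreal_ofReal
  have h := lintegral_glue_join hi t hm
  simp only [pm, hp.ofReal_pFull (Nat.le_add_left 1 i) hi]
  rw [← h, ← hp.ofReal_pFull h1 (by omega),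
    hp.marg_indep i h1 (by omega) _ (coords (nn d k₀) (head x)) ?_]
  have h2 := nn_mono (d := d) hi
  rw [coords_coords_of_le h2, coords_coords_of_le (nn_mono (d := d) (by omega)), coords_self,
    head_eq_coords]

variable {ν : Measure (E d k₀)}

lemma A1.measurable (hν : A1 ν f) : Measurable f := hν.cont.measurable

lemma A1.lintegral_eq [IsProbabilityMeasure ν] (hν : A1 ν f) :
    ∫⁻ y, ENNReal.ofReal (f y) = 1 := by
  rw [← measure_univ (μ := ν), hν.density, withDensity_apply _ .univ, Measure.restrict_univ]

lemma lintegral_glue_zero (t : E d 0) {g : E d k₀ → ℝ≥0∞} (hg : Measurable g) :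
    ∫⁻ w : Fin (nn d k₀ - nn d 0) → ℝ, g (glue t w) = ∫⁻ y, g y := by
  have := isEmpty_fin_nn_zero (d := d)
  rw [lintegral_glue (m := nn d 0) (Nat.zero_le _) hg]
  rw [Subsingleton.elim t default]
  simp [lintegral_unique, volume_pi]
  rfl

lemma A1.integrable [IsProbabilityMeasure ν] (hν : A1 ν f) (hi : i ≤ k₀) (y : E d i) :
    Integrable fun z : Fin (nn d k₀ - nn d i) → ℝ => f (glue y z) := by
  rcases i.eq_zero_or_pos with rfl | h1
  · refine ⟨(hν.cont.comp (continuous_glue_right y)).aestronglyMeasurable, ?_⟩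
    rw [hasFiniteIntegral_iff_ofReal (Eventually.of_forall fun _ => hν.nonneg _),
      lintegral_glue_zero y hν.measurable.ennreal_ofReal, hν.lintegral_eq]
    exact ENNReal.one_lt_top
  rcases hi.eq_or_lt with rfl | hi
  · have : IsEmpty (Fin (nn d i - nn d i)) := by rw [Nat.sub_self]; infer_instance
    simp only [glue_self]
    have : IsFiniteMeasure (volume : Measure (Fin (nn d i - nn d i) → ℝ)) :=
      ⟨by simp [volume_pi]⟩
    exact integrable_const _
  · exact hν.marg_finite i h1 hi y

lemma A1.fm_nonneg (hν : A1 ν f) (y : E d i) : 0 ≤ fm f i y :=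
  integral_nonneg fun _ => hν.nonneg _

variable [IsProbabilityMeasure ν]

lemma A1.ofReal_fm (hν : A1 ν f) (hi : i ≤ k₀) (y : E d i) :
    ENNReal.ofReal (fm f i y) =
      ∫⁻ z : Fin (nn d k₀ - nn d i) → ℝ, ENNReal.ofReal (f (glue y z)) :=
  ofReal_integral_eq_lintegral_ofReal (hν.integrable hi y)
    (Eventually.of_forall fun _ => hν.nonneg _)

omit [IsProbabilityMeasure ν] in
lemma A1.continuous_fm (hν : A1 ν f) (hi : i ≤ k₀) : Continuous (fm f i) := by
  rcases i.eq_zero_or_pos with rfl | h1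
  · have := isEmpty_fin_nn_zero (d := d)
    exact continuous_of_const fun x y => by rw [Subsingleton.elim x y]
  rcases hi.eq_or_lt with rfl | hi
  · rw [show fm f i = f from funext fm_self]
    exact hν.cont
  · exact hν.marg_cont i h1 hi

omit [IsProbabilityMeasure ν] in
lemma A1.measurable_ofReal_fm (hν : A1 ν f) (hi : i ≤ k₀) :
    Measurable fun y => ENNReal.ofReal (fm f i y) :=
  (hν.continuous_fm hi).measurable.ennreal_ofReal

/-- At level 0 the space is a point carrying the total mass; this lets the first block be treated
like the others. -/
lemma A1.fm_zero (hν : A1 ν f) (t : E d 0) : fm f 0 t = 1 := by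
  have h := hν.ofReal_fm (Nat.zero_le _) t
  rw [lintegral_glue_zero t hν.measurable.ennreal_ofReal, hν.lintegral_eq] at h
  simpa using h

lemma A1.lintegral_fm_join (hν : A1 ν f) (hi : i + 1 ≤ k₀) (t : E d i) :
    ∫⁻ z : B d (i + 1), ENNReal.ofReal (fm f (i + 1) (join t z)) = ENNReal.ofReal (fm f i t) := by
  simp only [hν.ofReal_fm hi, hν.ofReal_fm (Nat.le_of_succ_le hi)]
  exact (lintegral_glue_join hi t hν.measurable.ennreal_ofReal).symm

lemma A1.marg_eq (hν : A1 ν f) (hi : i ≤ k₀) :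
    marg ν i = volume.withDensity fun y => ENNReal.ofReal (fm f i y) := by
  refine Measure.ext_of_lintegral _ fun g hg => ?_
  have hm := hν.measurable_ofReal_fm hi
  have hf := hν.measurable
  have hc : Measurable (coords (nn d i) : E d k₀ → E d i) := measurable_coords
  rw [marg, lintegral_map hg measurable_coords, lintegral_withDensity_eq_lintegral_mul _ hm hg,
    hν.density, lintegral_withDensity_eq_lintegral_mul _ (by fun_prop) (by fun_prop),
    lintegral_glue (nn_mono hi) (by fun_prop)]
  refine lintegral_congr fun y => ?_
  simp only [Pi.mul_apply, coords_glue (nn_mono hi)]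
  have : Measurable fun z => ENNReal.ofReal (f (glue y z)) :=
    (hf.comp (continuous_glue_right (N := nn d k₀) y).measurable).ennreal_ofReal
  rw [hν.ofReal_fm hi, ← lintegral_mul_const _ this]

end Marginals

/-! ### Disintegration of the marginals of μ -/

section FirstMarginals

variable {d : ℕ → ℕ} {k₀ : ℕ} {i : ℕ} {μ : Measure (E d k₀)} [IsProbabilityMeasure μ]

instance : IsProbabilityMeasure (marg μ i) :=
  Measure.isProbabilityMeasure_map measurable_coords.aemeasurable

omit [IsProbabilityMeasure μ] in
lemma marg_map_head : (marg μ (i + 1)).map head = marg μ i := by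
  rw [marg, Measure.map_map measurable_head measurable_coords]
  congr 1

instance : ProbabilityTheory.IsMarkovKernel (condLast μ i) := by
  unfold condLast; infer_instance

lemma marg_compProd_condLast :
    (marg μ i ⊗ₘ condLast μ i).map (fun q => join q.1 q.2) = marg μ (i + 1) := by
  have h1 : ((marg μ (i + 1)).map fun x => (head x, lastBlock x)).fst = marg μ i := by
    rw [Measure.fst, Measure.map_map measurable_fst (by fun_prop)]
    exact marg_map_head
  have h2 : marg μ i ⊗ₘ condLast μ i = (marg μ (i + 1)).map fun x => (head x, lastBlock x) := by
    rw [← h1]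
    exact Measure.disintegrate _ (Measure.condKernel _)
  rw [h2, Measure.map_map (by fun_prop) (by fun_prop)]
  simp [Function.comp_def]

lemma lintegral_condLast {g : E d (i + 1) → ℝ≥0∞} (hg : Measurable g) :
    ∫⁻ x, ∫⁻ z, g (join x z) ∂(condLast μ i x) ∂(marg μ i) = ∫⁻ x, g x ∂(marg μ (i + 1)) := by
  rw [← marg_compProd_condLast, lintegral_map hg (by fun_prop),
    Measure.lintegral_compProd (by fun_prop)]

lemma withDensity_compProd_condLast_map {D : E d i → ℝ≥0∞} (hD : Measurable D) :
    ((marg μ i).withDensity D ⊗ₘ condLast μ i).map (fun q => join q.1 q.2) =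
      (marg μ (i + 1)).withDensity fun x => D (head x) := by
  refine Measure.ext_of_lintegral _ fun g hg => ?_
  rw [lintegral_map hg (by fun_prop), Measure.lintegral_compProd (by fun_prop),
    lintegral_withDensity_eq_lintegral_mul _ hD
      (Measurable.lintegral_kernel_prod_right' (f := fun q : E d i × B d (i + 1) =>
        g (join q.1 q.2)) (by fun_prop)),
    lintegral_withDensity_eq_lintegral_mul _ (by fun_prop) hg, ← lintegral_condLast (by fun_prop)]
  refine lintegral_congr fun x => ?_
  simp only [Pi.mul_apply, head_join]
  rw [lintegral_const_mul _ (by fun_prop)]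

/-- The new block of x is drawn given x' alone, so it turns μ_i into μ_{i+1} and leaves the density
unchanged. -/
lemma otimes_withDensity {D : E d i → E d i → ℝ≥0∞}
    (hD : Measurable fun q : E d i × E d i => D q.1 q.2) :
    otimes μ (((marg μ i).prod volume).withDensity fun q => D q.1 q.2) =
      ((marg μ (i + 1)).prod volume).withDensity fun q => D (head q.1) q.2 := by
  refine Measure.ext_of_lintegral _ fun g hg => ?_
  have hD' : Measurable fun q : E d (i + 1) × E d i => D (head q.1) q.2 :=
    hD.comp (by fun_prop : Measurable fun q : E d (i + 1) × E d i => (head q.1, q.2))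
  have hm : Measurable fun q : E d i × E d i => ∫⁻ z, g (join q.1 z, q.2) ∂(condLast μ i q.1) :=
    Measurable.lintegral_kernel_prod_right'
      (κ := (condLast μ i).comap Prod.fst measurable_fst)
      (f := fun q : (E d i × E d i) × B d (i + 1) => g (join q.1.1 q.2, q.1.2)) (by fun_prop)
  rw [otimes, lintegral_map hg (by fun_prop), Measure.lintegral_compProd (by fun_prop)]
  simp only [ProbabilityTheory.Kernel.comap_apply]
  rw [lintegral_withDensity_eq_lintegral_mul _ hD hm,
    lintegral_withDensity_eq_lintegral_mul _ hD' hg,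
    lintegral_prod_symm _ (hD.mul hm).aemeasurable, lintegral_prod_symm _ (hD'.mul hg).aemeasurable]
  refine lintegral_congr fun t => ?_
  simp only [Pi.mul_apply]
  rw [← lintegral_condLast (g := fun x => D (head x) t * g (x, t))
    ((hD'.mul hg).comp measurable_prodMk_right)]
  refine lintegral_congr fun x => ?_
  simp only [head_join]
  rw [lintegral_const_mul _ (by fun_prop)]

end FirstMarginals

end CondSchrodinger

/-! ### Existence of continuous solutions for a family of kernels -/

namespace CondSchrodinger

open Filter Topology Set ProbabilityTheory

section Gauge

lemma exists_bound_nat {A : Type*} [NormedAddCommGroup A] [ProperSpace A] {g : A → ℝ}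
    (hg : Continuous g) : ∃ c : ℕ → ℝ, ∀ a, ∀ n : ℕ, ‖a‖ ≤ n → g a ≤ c n := by
  have : ∀ n : ℕ, ∃ c, ∀ a ∈ Metric.closedBall (0 : A) n, ‖g a‖ ≤ c := fun n =>
    (isCompact_closedBall (0 : A) n).exists_bound_of_continuousOn hg.continuousOn
  choose c hc using this
  exact ⟨c, fun a n ha => (le_abs_self _).trans (hc n a (mem_closedBall_zero_iff.2 ha))⟩

variable {T X Y : Type*} [NormedAddCommGroup T] [ProperSpace T] [NormedAddCommGroup X]
  [ProperSpace X] [NormedAddCommGroup Y] [ProperSpace Y]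

/-- A continuous function of three variables is dominated by a product. -/
lemma exists_nat_gauge {g : T × X × Y → ℝ} (hg : Continuous g) :
    ∃ c : ℕ → ℝ, (∀ n, 1 ≤ c n) ∧ ∀ t x y, g (t, x, y) ≤ c ⌈‖t‖⌉₊ * (c ⌈‖x‖⌉₊ * c ⌈‖y‖⌉₊) := by
  obtain ⟨c, hc⟩ := exists_bound_nat hg
  refine ⟨fun n => max 1 (c n), fun n => le_max_left _ _, fun t x y => ?_⟩
  have h1 : ∀ n, 1 ≤ max 1 (c n) := fun n => le_max_left _ _
  have h0 : ∀ n, 0 ≤ max 1 (c n) := fun n => zero_le_one.trans (h1 n)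
  have key : ∀ n, n = ⌈‖t‖⌉₊ ∨ n = ⌈‖x‖⌉₊ ∨ n = ⌈‖y‖⌉₊ →
      max 1 (c n) ≤ max 1 (c ⌈‖t‖⌉₊) * (max 1 (c ⌈‖x‖⌉₊) * max 1 (c ⌈‖y‖⌉₊)) := by
    rintro n (rfl | rfl | rfl)
    · exact le_mul_of_one_le_right (h0 _) (one_le_mul_of_one_le_of_one_le (h1 _) (h1 _))
    · exact (le_mul_of_one_le_right (h0 _) (h1 _)).trans
        (le_mul_of_one_le_left (mul_nonneg (h0 _) (h0 _)) (h1 _))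
    · exact (le_mul_of_one_le_left (h0 _) (h1 _)).trans
        (le_mul_of_one_le_left (mul_nonneg (h0 _) (h0 _)) (h1 _))
  -- Take n to be the largest of the three ceilings: the ball of radius n contains the point, its
  -- bound is one of the three factors, and the other two are at least 1.
  have h2 : ∃ n, (n = ⌈‖t‖⌉₊ ∨ n = ⌈‖x‖⌉₊ ∨ n = ⌈‖y‖⌉₊) ∧
      ⌈‖t‖⌉₊ ≤ n ∧ ⌈‖x‖⌉₊ ≤ n ∧ ⌈‖y‖⌉₊ ≤ n := by
    refine ⟨max ⌈‖t‖⌉₊ (max ⌈‖x‖⌉₊ ⌈‖y‖⌉₊), ?_, ?_, ?_, ?_⟩ <;> omega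
  obtain ⟨n, hn, ht, hx, hy⟩ := h2
  refine (hc (t, x, y) n ?_).trans ((le_max_right _ _).trans (key n hn))
  rw [Prod.norm_def, Prod.norm_def]
  exact max_le (Nat.ceil_le.1 ht) (max_le (Nat.ceil_le.1 hx) (Nat.ceil_le.1 hy))

end Gauge

section Fibers

variable {T X : Type*} [NormedAddCommGroup T] [ProperSpace T] [MeasurableSpace T] [BorelSpace T]
  [NormedAddCommGroup X] [ProperSpace X] [MeasurableSpace X] [BorelSpace X]
  {n : ℕ}
  {P : Kernel T X} {Q : Kernel T (Fin n → ℝ)} [IsMarkovKernel P] [IsMarkovKernel Q]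
  {k : T → X → (Fin n → ℝ) → ℝ}

lemma exists_solution_of_continuous {τ : Measure T} [IsFiniteMeasure τ]
    (hk : Continuous fun q : T × X × (Fin n → ℝ) => k q.1 q.2.1 q.2.2) (hk0 : ∀ t x y, 0 < k t x y) :
    ∃ b : T → (Fin n → ℝ) → ℝ≥0∞, Measurable (Function.uncurry b) ∧ ∀ᵐ t ∂τ, ∀ᵐ y ∂(Q t),
      b t y * ∫⁻ x, ENNReal.ofReal (k t x y) /
        (∫⁻ z, b t z * ENNReal.ofReal (k t x z) ∂(Q t)) ∂(P t) = 1 := by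
  obtain ⟨c, hc1, hc⟩ := exists_nat_gauge hk
  obtain ⟨e, he1, he⟩ := exists_nat_gauge (g := fun q : T × X × (Fin n → ℝ) => (k q.1 q.2.1 q.2.2)⁻¹)
    (hk.inv₀ fun q => (hk0 _ _ _).ne')
  -- γ bounds the kernel from above and ε bounds its reciprocal. Dividing by the three factors γ
  -- gives a kernel at most 1 and at least a positive function of (t, x) times one of y.
  set γ : ℕ → ℝ≥0∞ := fun j => ENNReal.ofReal (c j) with hγ
  set ε : ℕ → ℝ≥0∞ := fun j => ENNReal.ofReal (e j) with hε
  have hγ0 : ∀ j, γ j ≠ 0 := fun j => by simp [hγ, zero_lt_one.trans_le (hc1 j)]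
  have hγt : ∀ j, γ j ≠ ∞ := fun j => ENNReal.ofReal_ne_top
  have hε0 : ∀ j, ε j ≠ 0 := fun j => by simp [hε, zero_lt_one.trans_le (he1 j)]
  have hεt : ∀ j, ε j ≠ ∞ := fun j => ENNReal.ofReal_ne_top
  have hcn : ∀ j, 0 ≤ c j := fun j => zero_le_one.trans (hc1 j)
  have hen : ∀ j, 0 ≤ e j := fun j => zero_le_one.trans (he1 j)
  set κ : T → X → (Fin n → ℝ) → ℝ≥0∞ := fun t x y => ENNReal.ofReal (k t x y) with hκ
  have hup : ∀ t x y, κ t x y ≤ γ ⌈‖t‖⌉₊ * (γ ⌈‖x‖⌉₊ * γ ⌈‖y‖⌉₊) := fun t x y => by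
    simp only [hγ, hκ]
    rw [← ENNReal.ofReal_mul (hcn _), ← ENNReal.ofReal_mul (hcn _)]
    exact ENNReal.ofReal_le_ofReal (hc t x y)
  have hlow : ∀ t x y, (ε ⌈‖t‖⌉₊)⁻¹ * ((ε ⌈‖x‖⌉₊)⁻¹ * (ε ⌈‖y‖⌉₊)⁻¹) ≤ κ t x y := fun t x y => by
    have h1 : (κ t x y)⁻¹ ≤ ε ⌈‖t‖⌉₊ * (ε ⌈‖x‖⌉₊ * ε ⌈‖y‖⌉₊) := by
      simp only [hε, hκ]
      rw [← ENNReal.ofReal_mul (hen _), ← ENNReal.ofReal_mul (hen _),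
        ← ENNReal.ofReal_inv_of_pos (hk0 _ _ _)]
      exact ENNReal.ofReal_le_ofReal (he t x y)
    have h2 := ENNReal.inv_le_inv.2 h1
    rwa [inv_inv, ENNReal.mul_inv (Or.inl (hε0 _)) (Or.inl (hεt _)),
      ENNReal.mul_inv (Or.inl (hε0 _)) (Or.inl (hεt _))] at h2
  have hκm : Measurable fun q : T × X × (Fin n → ℝ) => κ q.1 q.2.1 q.2.2 :=
    hk.measurable.ennreal_ofReal
  have hγm : Measurable γ := measurable_from_top
  have hεm : Measurable ε := measurable_from_top
  have hle : ∀ t x y, κ t x y * ((γ ⌈‖t‖⌉₊)⁻¹ * (γ ⌈‖x‖⌉₊)⁻¹ * (γ ⌈‖y‖⌉₊)⁻¹) ≤ 1 := fun t x y => by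
    calc κ t x y * ((γ ⌈‖t‖⌉₊)⁻¹ * (γ ⌈‖x‖⌉₊)⁻¹ * (γ ⌈‖y‖⌉₊)⁻¹)
        = κ t x y / (γ ⌈‖t‖⌉₊ * (γ ⌈‖x‖⌉₊ * γ ⌈‖y‖⌉₊)) := by
          rw [div_eq_mul_inv, ENNReal.mul_inv (Or.inl (hγ0 _)) (Or.inl (hγt _)),
            ENNReal.mul_inv (Or.inl (hγ0 _)) (Or.inl (hγt _)), mul_assoc (γ ⌈‖t‖⌉₊)⁻¹]
      _ ≤ 1 := ENNReal.div_le_of_le_mul (by rw [one_mul]; exact hup t x y)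
  have hρm : Measurable fun q : T × X =>
      (ε ⌈‖q.1‖⌉₊)⁻¹ * (ε ⌈‖q.2‖⌉₊)⁻¹ * ((γ ⌈‖q.1‖⌉₊)⁻¹ * (γ ⌈‖q.2‖⌉₊)⁻¹) := by fun_prop
  have hσm : Measurable fun q : T × (Fin n → ℝ) => (ε ⌈‖q.2‖⌉₊)⁻¹ * (γ ⌈‖q.2‖⌉₊)⁻¹ := by fun_prop
  have hge : ∀ t x y, (ε ⌈‖t‖⌉₊)⁻¹ * (ε ⌈‖x‖⌉₊)⁻¹ * ((γ ⌈‖t‖⌉₊)⁻¹ * (γ ⌈‖x‖⌉₊)⁻¹) *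
      ((ε ⌈‖y‖⌉₊)⁻¹ * (γ ⌈‖y‖⌉₊)⁻¹) ≤
      κ t x y * ((γ ⌈‖t‖⌉₊)⁻¹ * (γ ⌈‖x‖⌉₊)⁻¹ * (γ ⌈‖y‖⌉₊)⁻¹) := fun t x y => by
    calc _ = (ε ⌈‖t‖⌉₊)⁻¹ * ((ε ⌈‖x‖⌉₊)⁻¹ * (ε ⌈‖y‖⌉₊)⁻¹) *
        ((γ ⌈‖t‖⌉₊)⁻¹ * (γ ⌈‖x‖⌉₊)⁻¹ * (γ ⌈‖y‖⌉₊)⁻¹) := by ring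
      _ ≤ _ := mul_le_mul_left (hlow t x y) _
  obtain ⟨b, hb, hsol⟩ := exists_measurable_solution (P := P) (Q := Q) (τ := τ)
    (k := fun t x y => κ t x y * ((γ ⌈‖t‖⌉₊)⁻¹ * (γ ⌈‖x‖⌉₊)⁻¹ * (γ ⌈‖y‖⌉₊)⁻¹))
    (ρ := fun t x => (ε ⌈‖t‖⌉₊)⁻¹ * (ε ⌈‖x‖⌉₊)⁻¹ * ((γ ⌈‖t‖⌉₊)⁻¹ * (γ ⌈‖x‖⌉₊)⁻¹))
    (σ := fun _ y => (ε ⌈‖y‖⌉₊)⁻¹ * (γ ⌈‖y‖⌉₊)⁻¹) (by fun_prop) hle hρm hσm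
    (fun t x => pos_iff_ne_zero.2 (mul_ne_zero (mul_ne_zero (by simp [hεt]) (by simp [hεt]))
      (mul_ne_zero (by simp [hγt]) (by simp [hγt]))))
    (fun t y => pos_iff_ne_zero.2 (mul_ne_zero (by simp [hεt]) (by simp [hγt]))) hge
  -- The rescaling factors in t and x cancel between the kernel and its normalisation; only the
  -- factor in y must be absorbed into the solution.
  refine ⟨fun t y => b t y * (γ ⌈‖y‖⌉₊)⁻¹, ?_, ?_⟩
  · have h1 : Measurable fun q : T × (Fin n → ℝ) => b q.1 q.2 := hb
    have : Measurable fun q : T × (Fin n → ℝ) => b q.1 q.2 * (γ ⌈‖q.2‖⌉₊)⁻¹ := by fun_prop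
    exact this
  filter_upwards [hsol] with t ht
  filter_upwards [ht] with y hy
  rw [← hy, mul_assoc, ← lintegral_const_mul' _ _ (ENNReal.inv_ne_top.2 (hγ0 _))]
  congr 1
  refine lintegral_congr fun x => ?_
  have h3 : ∫⁻ z, b t z * (κ t x z * ((γ ⌈‖t‖⌉₊)⁻¹ * (γ ⌈‖x‖⌉₊)⁻¹ * (γ ⌈‖z‖⌉₊)⁻¹)) ∂(Q t) =
      ((γ ⌈‖t‖⌉₊)⁻¹ * (γ ⌈‖x‖⌉₊)⁻¹) * ∫⁻ z, b t z * (γ ⌈‖z‖⌉₊)⁻¹ * κ t x z ∂(Q t) := by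
    rw [← lintegral_const_mul' _ _ (ENNReal.mul_ne_top (ENNReal.inv_ne_top.2 (hγ0 _))
      (ENNReal.inv_ne_top.2 (hγ0 _)))]
    refine lintegral_congr fun z => ?_
    ring
  rw [h3]
  set g := (γ ⌈‖t‖⌉₊)⁻¹ * (γ ⌈‖x‖⌉₊)⁻¹ with hg
  have hg0 : g ≠ 0 := mul_ne_zero (ENNReal.inv_ne_zero.2 (hγt _)) (ENNReal.inv_ne_zero.2 (hγt _))
  have hgt : g ≠ ∞ := ENNReal.mul_ne_top (ENNReal.inv_ne_top.2 (hγ0 _))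
    (ENNReal.inv_ne_top.2 (hγ0 _))
  rw [show κ t x y * (g * (γ ⌈‖y‖⌉₊)⁻¹) = g * (κ t x y * (γ ⌈‖y‖⌉₊)⁻¹) by ring,
    ENNReal.mul_div_mul_left _ _ hg0 hgt]
  change (γ ⌈‖y‖⌉₊)⁻¹ * (κ t x y / ∫⁻ z, b t z * (γ ⌈‖z‖⌉₊)⁻¹ * κ t x z ∂(Q t)) = _
  simp only [div_eq_mul_inv]
  ring

omit [ProperSpace X] in
/-- From a possibly infinite solution `h₀` of the functional equation to a finite continuous one. -/
lemma IsSchrodingerSol.exists_continuous {P : Measure X} [IsProbabilityMeasure P]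
    {k : X → (Fin n → ℝ) → ℝ} {ψ F : (Fin n → ℝ) → ℝ} {h₀ : (Fin n → ℝ) → ℝ≥0∞}
    (hs : IsSchrodingerSol P volume (fun y => ENNReal.ofReal (F y))
      (fun x y => ENNReal.ofReal (k x y)) h₀)
    (hk : Continuous (Function.uncurry k)) (hk0 : ∀ x y, 0 < k x y) (hh₀ : Measurable h₀)
    (hψ : Continuous ψ) (hconv : ∀ x, ConvexOn ℝ univ fun y => Real.log (k x y) + ψ y)
    (hF : Continuous F) (hF0 : ∀ y, 0 ≤ F y) (hF1 : ∫⁻ y, ENNReal.ofReal (F y) = 1) :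
    (Continuous fun y => (ENNReal.ofReal (F y) / ∫⁻ x, ENNReal.ofReal (k x y) /
      (∫⁻ z, h₀ z * ENNReal.ofReal (k x z)) ∂P).toNNReal) ∧
    IsSchrodingerSol P volume (fun y => ENNReal.ofReal (F y))
      (fun x y => ENNReal.ofReal (k x y)) (fun y => ((ENNReal.ofReal (F y) /
        ∫⁻ x, ENNReal.ofReal (k x y) / (∫⁻ z, h₀ z * ENNReal.ofReal (k x z)) ∂P).toNNReal :
          ℝ≥0∞)) := by
  have hkm : Measurable (Function.uncurry fun x y => ENNReal.ofReal (k x y)) :=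
    hk.measurable.ennreal_ofReal
  set u : X → ℝ≥0∞ := fun x => ∫⁻ z, h₀ z * ENNReal.ofReal (k x z) with hu
  have hum : Measurable u := measurable_lintegral_mul_kernel hkm hh₀
  have hne := hs.norm_ne hkm hh₀ hF1
  have hkc : ∀ x, Continuous (k x) := fun x => hk.comp (Continuous.prodMk_right x)
  have hkx : ∀ y, Measurable fun x => k x y := fun y =>
    (hk.comp (Continuous.prodMk_left y)).measurable
  set G : (Fin n → ℝ) → ℝ≥0∞ := fun y => ∫⁻ x, ENNReal.ofReal (k x y) / u x ∂P with hG
  have hG0 : ∀ y, G y ≠ 0 := by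
    intro y h0
    have hm := hkx y
    rw [hG, lintegral_eq_zero_iff (by fun_prop)] at h0
    obtain ⟨x, hx, hx2⟩ := (h0.and hne).exists
    simp only [Pi.zero_apply, ENNReal.div_eq_zero_iff, ENNReal.ofReal_eq_zero,
      not_le.2 (hk0 x y), false_or] at hx
    exact hx2.2 hx
  -- If G(y) = ∞, then h₀(y) G(y) is 0 or ∞ and cannot equal a positive finite F(y).
  have hGt : ∀ᵐ y, 0 < F y → G y ≠ ∞ := by
    filter_upwards [hs] with y hy hpos htop
    change ENNReal.ofReal (F y) = h₀ y * G y at hy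
    rw [htop] at hy
    by_cases h0 : h₀ y = 0
    · simp [h0, not_le.2 hpos] at hy
    · rw [ENNReal.mul_top h0] at hy
      exact ENNReal.ofReal_ne_top hy
  refine ⟨continuous_div_lintegral_kernel hkx hum hk0 hconv hF hGt hψ hkc hF0
    (hne.mono fun x hx => hx.2), ?_⟩
  have heq : (fun y => ((ENNReal.ofReal (F y) / G y).toNNReal : ℝ≥0∞)) =ᵐ[volume] h₀ := by
    filter_upwards [hs, hGt] with y hy hpos
    change ENNReal.ofReal (F y) = h₀ y * G y at hy
    rw [ENNReal.coe_toNNReal (ENNReal.div_ne_top ENNReal.ofReal_ne_top (hG0 y))]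
    rcases (hF0 y).eq_or_lt with h0 | h0
    · rw [← h0, ENNReal.ofReal_zero, eq_comm, mul_eq_zero, or_iff_left (hG0 y)] at hy
      rw [← h0, hy]
      simp
    · rw [hy, ENNReal.mul_div_cancel_right (hG0 y) (hpos h0)]
  have hu' : ∀ x, ∫⁻ z, ((ENNReal.ofReal (F z) / G z).toNNReal : ℝ≥0∞) * ENNReal.ofReal (k x z) =
      u x := fun x => by
    refine lintegral_congr_ae ?_
    filter_upwards [heq] with z hz
    rw [hz]
  filter_upwards [hs, heq] with y hy hy2
  refine hy.trans ?_
  rw [← hy2]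
  refine congrArg _ (lintegral_congr fun x => ?_)
  change _ / u x = _
  rw [← hu' x]

/-- A measurable family of probability densities, which outside a null set of parameters need not
be normalized, agrees a.e. with a Markov kernel. -/
lemma exists_markov_withDensity {T X : Type*} [MeasurableSpace T] [MeasurableSpace X] [Nonempty X]
    {τ : Measure T} {mX : Measure X} [SFinite mX] {w : T → X → ℝ≥0∞}
    (hw : Measurable (Function.uncurry w)) (h1 : ∀ᵐ t ∂τ, ∫⁻ x, w t x ∂mX = 1) :
    ∃ P : Kernel T X, IsMarkovKernel P ∧ ∀ᵐ t ∂τ, P t = mX.withDensity (w t) := by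
  classical
  have hms : MeasurableSet {t | ∫⁻ x, w t x ∂mX = 1} :=
    (Measurable.lintegral_prod_right' hw) (measurableSet_singleton 1)
  have hval : ∀ t, Kernel.withDensity (Kernel.const T mX) w t = mX.withDensity (w t) := fun t => by
    rw [Kernel.withDensity_apply _ hw, Kernel.const_apply]
  obtain ⟨x₀⟩ := ‹Nonempty X›
  refine ⟨Kernel.piecewise hms (Kernel.withDensity (Kernel.const T mX) w)
    (Kernel.const T (Measure.dirac x₀)), ⟨fun t => ⟨?_⟩⟩, ?_⟩
  · rw [Kernel.piecewise_apply]
    split_ifs with ht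
    · rw [hval, withDensity_apply _ .univ, Measure.restrict_univ]
      exact ht
    · rw [Kernel.const_apply]
      exact measure_univ
  · filter_upwards [h1] with t ht
    rw [Kernel.piecewise_apply, if_pos (by exact ht), hval]

/-- Existence for a measurable family of Schrödinger functional equations, with solutions that are
jointly measurable and continuous for each value of the parameter. -/
theorem exists_continuous_solution {τ : Measure T} [IsFiniteMeasure τ] {mX : Measure X} [SFinite mX]
    {w : T → X → ℝ≥0∞} {F : T → (Fin n → ℝ) → ℝ} {ψ : (Fin n → ℝ) → ℝ}
    (hw : Measurable (Function.uncurry w)) (hw1 : ∀ᵐ t ∂τ, ∫⁻ x, w t x ∂mX = 1)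
    (hFm : Measurable (Function.uncurry F)) (hFc : ∀ t, Continuous (F t)) (hF0 : ∀ t y, 0 ≤ F t y)
    (hF1 : ∀ᵐ t ∂τ, ∫⁻ y, ENNReal.ofReal (F t y) = 1)
    (hk : Continuous fun q : T × X × (Fin n → ℝ) => k q.1 q.2.1 q.2.2) (hk0 : ∀ t x y, 0 < k t x y)
    (hψ : Continuous ψ) (hconv : ∀ t x, ConvexOn ℝ univ fun y => Real.log (k t x y) + ψ y) :
    ∃ h : T → (Fin n → ℝ) → ℝ≥0, Measurable (Function.uncurry h) ∧ (∀ t, Continuous (h t)) ∧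
      ∀ᵐ t ∂τ, IsSchrodingerSol (mX.withDensity (w t)) volume (fun y => ENNReal.ofReal (F t y))
        (fun x y => ENNReal.ofReal (k t x y)) (fun y => (h t y : ℝ≥0∞)) := by
  have hFm' : Measurable fun q : T × (Fin n → ℝ) => ENNReal.ofReal (F q.1 q.2) := hFm.ennreal_ofReal
  obtain ⟨P, hP, hPw⟩ := exists_markov_withDensity hw hw1
  obtain ⟨Q, hQ, hQF⟩ := exists_markov_withDensity (τ := τ) (mX := (volume : Measure (Fin n → ℝ)))
    (w := fun t y => ENNReal.ofReal (F t y)) hFm' hF1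
  obtain ⟨b, hb, hsol⟩ := exists_solution_of_continuous (P := P) (Q := Q) (τ := τ) hk hk0
  have hbm : Measurable fun q : T × (Fin n → ℝ) => b q.1 q.2 := hb
  have hκm : Measurable fun q : T × X × (Fin n → ℝ) => ENNReal.ofReal (k q.1 q.2.1 q.2.2) :=
    hk.measurable.ennreal_ofReal
  -- The system was solved relative to the law F(t, y) dy; the factor F converts b into a solution
  -- relative to Lebesgue measure.
  set h₀ : T → (Fin n → ℝ) → ℝ≥0∞ := fun t y => ENNReal.ofReal (F t y) * b t y with hh₀
  have hh₀m : Measurable fun q : T × (Fin n → ℝ) => h₀ q.1 q.2 := by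
    simp only [hh₀]; fun_prop
  have hae : ∀ᵐ t ∂τ, IsSchrodingerSol (P t) volume (fun y => ENNReal.ofReal (F t y))
      (fun x y => ENNReal.ofReal (k t x y)) (h₀ t) ∧ P t = mX.withDensity (w t) ∧
      ∫⁻ y, ENNReal.ofReal (F t y) = 1 := by
    filter_upwards [hsol, hPw, hQF, hF1] with t ht1 ht2 ht3 ht4
    refine ⟨?_, ht2, ht4⟩
    have hFt : Measurable fun y => ENNReal.ofReal (F t y) := (hFc t).measurable.ennreal_ofReal
    have hbt : Measurable (b t) := hbm.comp measurable_prodMk_left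
    have hu : ∀ x, ∫⁻ z, b t z * ENNReal.ofReal (k t x z) ∂(Q t) =
        ∫⁻ z, h₀ t z * ENNReal.ofReal (k t x z) := fun x => by
      have : Measurable fun z => ENNReal.ofReal (k t x z) :=
        hκm.comp (by fun_prop : Measurable fun z : Fin n → ℝ => (t, x, z))
      rw [ht3, lintegral_withDensity_eq_lintegral_mul _ hFt (by fun_prop)]
      refine lintegral_congr fun z => ?_
      simp only [Pi.mul_apply, hh₀, mul_assoc]
    simp only [hu] at ht1
    rw [ht3, ae_withDensity_iff hFt] at ht1
    unfold IsSchrodingerSol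
    filter_upwards [ht1] with y hy
    by_cases h0 : ENNReal.ofReal (F t y) = 0
    · simp only [hh₀, h0, zero_mul]
    · change _ = ENNReal.ofReal (F t y) * b t y * _
      rw [mul_assoc, hy h0, mul_one]
  obtain ⟨s, hs, hsm, hsP⟩ := hae.exists_measurable_mem
  have hu_m : Measurable fun q : T × X =>
      ∫⁻ z, h₀ q.1 z * ENNReal.ofReal (k q.1 q.2 z) := by
    refine Measurable.lintegral_prod_right' (f := fun q : (T × X) × (Fin n → ℝ) =>
      h₀ q.1.1 q.2 * ENNReal.ofReal (k q.1.1 q.1.2 q.2)) ?_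
    refine Measurable.mul (hh₀m.comp (by fun_prop : Measurable fun q : (T × X) × (Fin n → ℝ) =>
      (q.1.1, q.2))) (hκm.comp (by fun_prop : Measurable fun q : (T × X) × (Fin n → ℝ) =>
      (q.1.1, q.1.2, q.2)))
  have hG_m : Measurable fun q : T × (Fin n → ℝ) => ∫⁻ x, ENNReal.ofReal (k q.1 x q.2) /
      (∫⁻ z, h₀ q.1 z * ENNReal.ofReal (k q.1 x z)) ∂(P q.1) := by
    refine measurable_lintegral_fst_kernel (f := fun q x => ENNReal.ofReal (k q.1 x q.2) /
      (∫⁻ z, h₀ q.1 z * ENNReal.ofReal (k q.1 x z))) ?_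
    refine Measurable.div (hκm.comp (by fun_prop : Measurable fun q : (T × (Fin n → ℝ)) × X =>
      (q.1.1, q.2, q.1.2))) (hu_m.comp (by fun_prop : Measurable fun q : (T × (Fin n → ℝ)) × X =>
      (q.1.1, q.2)))
  have hgood : ∀ t ∈ s, _ := fun t ht => (hsP t ht).1.exists_continuous (ψ := ψ)
    (hk.comp (by fun_prop : Continuous fun q : X × (Fin n → ℝ) => (t, q.1, q.2))) (hk0 t)
    (hh₀m.comp measurable_prodMk_left) hψ (hconv t) (hFc t) (hF0 t) (hsP t ht).2.2
  classical
  -- Off the measurable set s of good parameters, of full measure, the value 0 keeps continuity in y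
  -- true for every t.
  refine ⟨fun t y => if t ∈ s then (ENNReal.ofReal (F t y) / ∫⁻ x, ENNReal.ofReal (k t x y) /
      (∫⁻ z, h₀ t z * ENNReal.ofReal (k t x z)) ∂(P t)).toNNReal else 0, ?_, fun t => ?_, ?_⟩
  · exact Measurable.ite (measurable_fst hsm) (hFm'.div hG_m).ennreal_toNNReal measurable_const
  · by_cases ht : t ∈ s
    · simpa only [ht, if_true] using (hgood t ht).1
    · simpa only [ht, if_false] using continuous_const
  · filter_upwards [hs] with t ht
    rw [← (hsP t ht).2.1]
    simpa only [ht, if_true] using (hgood t ht).2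

end Fibers

end CondSchrodinger

/-! ### The conditional functional equation in density form -/

namespace CondSchrodinger

open Filter Topology Set ProbabilityTheory

section Density

variable {d : ℕ → ℕ} {k₀ i : ℕ} {p : E d k₀ → E d k₀ → ℝ} {μ ν : Measure (E d k₀)}
  {f : E d k₀ → ℝ} {D : E d i → E d i → ℝ≥0∞} {g h : E d (i + 1) → ℝ≥0}

lemma A0.measurable_pm (hp : A0 p) (hi : i + 1 ≤ k₀) :
    Measurable fun q : E d (i + 1) × E d (i + 1) => ENNReal.ofReal (pm p (i + 1) q.1 q.2) :=
  (hp.continuous_pm (Nat.le_add_left 1 i) hi).measurable.ennreal_ofReal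

lemma A0.measurable_pm_join (hp : A0 p) (hi : i + 1 ≤ k₀) (t : E d i) :
    Measurable (Function.uncurry fun (x : E d (i + 1)) (z : B d (i + 1)) =>
      ENNReal.ofReal (pm p (i + 1) x (join t z))) :=
  (hp.measurable_pm hi).comp
    (by fun_prop : Measurable fun q : E d (i + 1) × B d (i + 1) => (q.1, join t q.2))

lemma A0.measurable_hZero (hp : A0 p) (hi : i + 1 ≤ k₀) (hg : Measurable g) :
    Measurable fun q : E d (i + 1) × E d i => hZero p g q.1 q.2 := by
  have h1 : Measurable fun q : (E d (i + 1) × E d i) × B d (i + 1) =>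
      ENNReal.ofReal (pm p (i + 1) q.1.1 (join q.1.2 q.2)) :=
    (hp.measurable_pm hi).comp (by fun_prop : Measurable fun q : (E d (i + 1) × E d i) × B d (i + 1) =>
      (q.1.1, join q.1.2 q.2))
  exact Measurable.lintegral_prod_right' (f := fun q : (E d (i + 1) × E d i) × B d (i + 1) =>
    (g (join q.1.2 q.2) : ℝ≥0∞) * ENNReal.ofReal (pm p (i + 1) q.1.1 (join q.1.2 q.2)))
    (by fun_prop)

lemma A0.pCond_eq (hp : A0 p) (h1 : 1 ≤ i) (hi : i + 1 ≤ k₀) (x : E d (i + 1)) (z : B d (i + 1))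
    (t : E d i) : pCond p i x z t =
      ENNReal.ofReal (pm p (i + 1) x (join t z)) * (ENNReal.ofReal (pm p i (head x) t))⁻¹ := by
  rw [pCond, hp.lintegral_pm_join h1 hi, div_eq_mul_inv]

lemma A0.ofReal_pm_ne_zero (hp : A0 p) (h1 : 1 ≤ i) (hi : i ≤ k₀) (x y : E d i) :
    ENNReal.ofReal (pm p i x y) ≠ 0 := by
  simpa using hp.pm_pos h1 hi x y

lemma A0.condNorm_eq (hp : A0 p) (h1 : 1 ≤ i) (hi : i + 1 ≤ k₀) (x : E d (i + 1)) (t : E d i) :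
    condNorm p g x t = hZero p g x t * (ENNReal.ofReal (pm p i (head x) t))⁻¹ := by
  simp only [condNorm, hZero, hp.pCond_eq h1 hi, ← mul_assoc]
  rw [lintegral_mul_const' _ _
    (ENNReal.inv_ne_top.2 (hp.ofReal_pm_ne_zero h1 (Nat.le_of_succ_le hi) _ _))]

/-- Numerator and denominator both carry the factor p_i(x', t)⁻¹, which is positive and finite and
so cancels. -/
lemma A0.pCond_div_condNorm (hp : A0 p) (h1 : 1 ≤ i) (hi : i + 1 ≤ k₀) (x : E d (i + 1))
    (z : B d (i + 1)) (t : E d i) : pCond p i x z t / condNorm p g x t =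
      ENNReal.ofReal (pm p (i + 1) x (join t z)) / hZero p g x t := by
  rw [hp.pCond_eq h1 hi, hp.condNorm_eq h1 hi, ENNReal.mul_div_mul_right]
  · exact ENNReal.inv_ne_zero.2 ENNReal.ofReal_ne_top
  · exact ENNReal.inv_ne_top.2 (hp.ofReal_pm_ne_zero h1 (Nat.le_of_succ_le hi) _ _)

lemma A0.lintegral_pCond (hp : A0 p) (h1 : 1 ≤ i) (hi : i + 1 ≤ k₀) (x : E d (i + 1)) (t : E d i) :
    ∫⁻ z, pCond p i x z t = 1 := by
  have h0 := hp.ofReal_pm_ne_zero h1 (Nat.le_of_succ_le hi) (head x) t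
  simp only [hp.pCond_eq h1 hi]
  rw [lintegral_mul_const' _ _ (ENNReal.inv_ne_top.2 h0), hp.lintegral_pm_join h1 hi,
    ENNReal.mul_inv_cancel h0 ENNReal.ofReal_ne_top]

lemma A0.measurable_pCond (hp : A0 p) (h1 : 1 ≤ i) (hi : i + 1 ≤ k₀) :
    Measurable fun q : (E d (i + 1) × E d i) × B d (i + 1) => pCond p i q.1.1 q.2 q.1.2 := by
  have hm : Measurable fun q : (E d (i + 1) × E d i) × B d (i + 1) =>
      ENNReal.ofReal (pm p (i + 1) q.1.1 (join q.1.2 q.2)) :=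
    (hp.measurable_pm hi).comp (by fun_prop : Measurable fun q : (E d (i + 1) × E d i) × B d (i + 1) =>
      (q.1.1, join q.1.2 q.2))
  have hm2 : Measurable fun q : (E d (i + 1) × E d i) × B d (i + 1) =>
      ENNReal.ofReal (pm p i (head q.1.1) q.1.2) :=
    ((hp.continuous_pm h1 (Nat.le_of_succ_le hi)).measurable.ennreal_ofReal).comp
      (by fun_prop : Measurable fun q : (E d (i + 1) × E d i) × B d (i + 1) =>
        (head q.1.1, q.1.2))
  simp only [hp.pCond_eq h1 hi]
  fun_prop

lemma A0.measurable_condNorm (hp : A0 p) (h1 : 1 ≤ i) (hi : i + 1 ≤ k₀) (hg : Measurable g) :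
    Measurable fun q : E d (i + 1) × E d i => condNorm p g q.1 q.2 := by
  have hm := hp.measurable_pCond h1 hi
  exact Measurable.lintegral_prod_right' (f := fun q : (E d (i + 1) × E d i) × B d (i + 1) =>
    (g (join q.1.2 q.2) : ℝ≥0∞) * pCond p i q.1.1 q.2 q.1.2) (by fun_prop)

/-- `D` is the density of a coupling of `μ_i` and `ν_i` with respect to `μ_i ⊗ dy`. -/
structure IsCouplingDensity (μ : Measure (E d k₀)) (f : E d k₀ → ℝ) (i : ℕ)
    (D : E d i → E d i → ℝ≥0∞) : Prop where
  meas : Measurable fun q : E d i × E d i => D q.1 q.2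
  snd : ∀ᵐ t, ∫⁻ x, D x t ∂(marg μ i) = ENNReal.ofReal (fm f i t)
  fst : ∀ᵐ x ∂(marg μ i), ∫⁻ t, D x t = 1

/-- The conditional law of `x ∈ ℝ^{n_{i+1}}` given `t ∈ ℝ^{n_i}` attached to the density `D`. -/
noncomputable def fiberLaw (μ : Measure (E d k₀)) (f : E d k₀ → ℝ) (D : E d i → E d i → ℝ≥0∞)
    (t : E d i) : Measure (E d (i + 1)) :=
  (marg μ (i + 1)).withDensity fun x => (ENNReal.ofReal (fm f i t))⁻¹ * D (head x) t

/-- The functional equation for `g(t, ·)` at the point `t`. -/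
def FiberSol (p : E d k₀ → E d k₀ → ℝ) (μ : Measure (E d k₀)) (f : E d k₀ → ℝ)
    (D : E d i → E d i → ℝ≥0∞) (g : E d (i + 1) → ℝ≥0) (t : E d i) : Prop :=
  IsSchrodingerSol (fiberLaw μ f D t) volume
    (fun y => ENNReal.ofReal (fm f (i + 1) (join t y) / fm f i t))
    (fun x y => ENNReal.ofReal (pm p (i + 1) x (join t y))) fun y => (g (join t y) : ℝ≥0∞)

/-- `∫ D(x', y') p_{i+1}(x, y) / g(0, x, y') μ_{i+1}(dx)`. -/
noncomputable def dualFactor (p : E d k₀ → E d k₀ → ℝ) (μ : Measure (E d k₀))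
    (D : E d i → E d i → ℝ≥0∞) (g : E d (i + 1) → ℝ≥0) (y : E d (i + 1)) : ℝ≥0∞ :=
  ∫⁻ x, D (head x) (head y) * (ENNReal.ofReal (pm p (i + 1) x y) / hZero p g x (head y))
    ∂(marg μ (i + 1))

/-- The functional equations at all points `t`, multiplied by `f_{ν_i}(t)`. -/
def JointSol (p : E d k₀ → E d k₀ → ℝ) (μ : Measure (E d k₀)) (f : E d k₀ → ℝ)
    (D : E d i → E d i → ℝ≥0∞) (g : E d (i + 1) → ℝ≥0) : Prop :=
  ∀ᵐ y, ENNReal.ofReal (fm f (i + 1) y) = g y * dualFactor p μ D g y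

variable [IsProbabilityMeasure μ] [IsProbabilityMeasure ν]

section

variable (hp : A0 p) (hν : A1 ν f) (hi : i + 1 ≤ k₀) (hD : IsCouplingDensity μ f i D)
  (hg : Measurable g)

omit [IsProbabilityMeasure μ] in
include hp hi hD hg in
lemma measurable_joint_integrand :
    Measurable fun q : E d (i + 1) × E d (i + 1) => D (head q.1) (head q.2) *
      (ENNReal.ofReal (pm p (i + 1) q.1 q.2) / hZero p g q.1 (head q.2)) := by
  have h1 : Measurable fun q : E d (i + 1) × E d (i + 1) => D (head q.1) (head q.2) :=
    hD.meas.comp (by fun_prop : Measurable fun q : E d (i + 1) × E d (i + 1) =>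
      (head q.1, head q.2))
  have h2 := hp.measurable_pm hi
  have h3 : Measurable fun q : E d (i + 1) × E d (i + 1) => hZero p g q.1 (head q.2) :=
    (hp.measurable_hZero hi hg).comp (by fun_prop : Measurable fun q : E d (i + 1) × E d (i + 1) =>
      (q.1, head q.2))
  exact h1.mul (h2.div h3)

include hp hi hD hg in
lemma measurable_dualFactor : Measurable (dualFactor p μ D g) :=
  Measurable.lintegral_prod_left' (measurable_joint_integrand hp hi hD hg)

omit [IsProbabilityMeasure μ] in
include hD in
lemma IsCouplingDensity.measurable_left (t : E d i) : Measurable fun x => D x t :=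
  hD.meas.comp measurable_prodMk_right

omit [IsProbabilityMeasure μ] in
include hD in
lemma IsCouplingDensity.lintegral_head :
    ∀ᵐ t, ∫⁻ x, D (head x) t ∂(marg μ (i + 1)) = ENNReal.ofReal (fm f i t) := by
  filter_upwards [hD.snd] with t ht
  have hm := hD.measurable_left t
  rw [← ht, ← marg_map_head (i := i), lintegral_map hm measurable_head]

omit [IsProbabilityMeasure μ] in
include hD in
lemma isProbabilityMeasure_fiberLaw :
    ∀ᵐ t, 0 < fm f i t → IsProbabilityMeasure (fiberLaw μ f D t) := by
  filter_upwards [hD.lintegral_head] with t ht hpos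
  have hm := hD.measurable_left t
  refine ⟨?_⟩
  rw [fiberLaw, withDensity_apply _ .univ, Measure.restrict_univ,
    lintegral_const_mul _ (by fun_prop), ht, ENNReal.inv_mul_cancel (by simpa using hpos)
      ENNReal.ofReal_ne_top]

include hν hi in
lemma A1.lintegral_div {t : E d i} (hpos : 0 < fm f i t) :
    ∫⁻ y, ENNReal.ofReal (fm f (i + 1) (join t y) / fm f i t) = 1 := by
  simp only [ENNReal.ofReal_div_of_pos hpos]
  simp only [div_eq_mul_inv]
  rw [lintegral_mul_const' _ _ (ENNReal.inv_ne_top.2 (by simpa using hpos)),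
    hν.lintegral_fm_join hi, ENNReal.mul_inv_cancel (by simpa using hpos) ENNReal.ofReal_ne_top]

omit [IsProbabilityMeasure μ] in
include hp hi hD hg in
lemma fiberSol_iff {t : E d i} (hpos : 0 < fm f i t) :
    FiberSol p μ f D g t ↔
      ∀ᵐ y, ENNReal.ofReal (fm f (i + 1) (join t y)) =
        g (join t y) * dualFactor p μ D g (join t y) := by
  have h0 : ENNReal.ofReal (fm f i t) ≠ 0 := by simpa using hpos
  have hm := hD.measurable_left t
  have key : ∀ y, (g (join t y) : ℝ≥0∞) * ∫⁻ x, ENNReal.ofReal (pm p (i + 1) x (join t y)) /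
      (∫⁻ z, (g (join t z) : ℝ≥0∞) * ENNReal.ofReal (pm p (i + 1) x (join t z)))
        ∂(fiberLaw μ f D t) =
      (g (join t y) * dualFactor p μ D g (join t y)) / ENNReal.ofReal (fm f i t) := fun y => by
    have hm1 : Measurable fun x => D (head x) t * (ENNReal.ofReal (pm p (i + 1) x (join t y)) /
        hZero p g x t) := by
      have := (measurable_joint_integrand hp hi hD hg).comp
        (measurable_prodMk_right (y := join t y))
      simpa only [Function.comp_def, head_join] using this
    have hm2 : Measurable fun x => ENNReal.ofReal (pm p (i + 1) x (join t y)) / hZero p g x t := by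
      have h1 : Measurable fun x => ENNReal.ofReal (pm p (i + 1) x (join t y)) :=
        (hp.measurable_pm hi).comp measurable_prodMk_right
      have h2 : Measurable fun x => hZero p g x t :=
        (hp.measurable_hZero hi hg).comp measurable_prodMk_right
      fun_prop
    change _ * ∫⁻ x, ENNReal.ofReal (pm p (i + 1) x (join t y)) / hZero p g x t ∂_ = _
    rw [fiberLaw, lintegral_withDensity_eq_lintegral_mul _ (by fun_prop) hm2]
    simp only [Pi.mul_apply, mul_assoc]
    rw [lintegral_const_mul _ hm1, dualFactor, div_eq_mul_inv]
    simp only [head_join]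
    ring
  unfold FiberSol IsSchrodingerSol EventuallyEq
  simp only [key, ENNReal.ofReal_div_of_pos hpos]
  refine eventually_congr (Eventually.of_forall fun y => ?_)
  refine ⟨fun h => ?_, fun h => by rw [h]⟩
  have := congrArg (· * ENNReal.ofReal (fm f i t)) h
  simpa only [ENNReal.div_mul_cancel h0 ENNReal.ofReal_ne_top] using this

-- Where f_{ν_i}(t) > 0 the two equations differ by this factor. Where it is 0, for almost every
-- such t, the density D(·, t) and f_{ν_{i+1}}(t, ·) vanish almost everywhere, so the joint equation
-- reads 0 = 0.
include hp hν hi hD hg in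
lemma jointSol_iff :
    JointSol p μ f D g ↔ ∀ᵐ t, 0 < fm f i t → FiberSol p μ f D g t := by
  have hm := measurable_dualFactor hp hi hD hg
  have hf := hν.measurable_ofReal_fm hi
  rw [JointSol, ae_join_iff (measurableSet_eq_fun hf (by fun_prop))]
  refine eventually_congr ?_
  filter_upwards [hD.lintegral_head] with t ht
  rcases (hν.fm_nonneg t).eq_or_lt with h0 | h0
  · simp only [← h0, lt_irrefl, false_imp_iff, iff_true]
    have hmt := hD.measurable_left t
    have h1 : ∫⁻ z, ((fun y => ENNReal.ofReal (fm f (i + 1) y)) ∘ fun z => join t z) z = _ :=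
      hν.lintegral_fm_join hi t
    rw [← h0, ENNReal.ofReal_zero] at h1 ht
    rw [lintegral_eq_zero_iff (hf.comp (by fun_prop : Measurable fun z => join t z))] at h1
    rw [lintegral_eq_zero_iff (by fun_prop)] at ht
    filter_upwards [h1] with y hy
    have : dualFactor p μ D g (join t y) = 0 := by
      rw [dualFactor, ← lintegral_zero (μ := marg μ (i + 1))]
      refine lintegral_congr_ae ?_
      filter_upwards [ht] with x hx
      simp only [head_join]
      rw [hx, Pi.zero_apply, zero_mul]
    rw [this, mul_zero]
    exact hy
  · simp only [h0, true_imp_iff]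
    exact (fiberSol_iff hp hi hD hg h0).symm

include hp hν hi hD hg in
/-- The normalizing factor is positive and finite wherever the density `D` charges. -/
lemma hZero_ne (hs : JointSol p μ f D g) :
    ∀ᵐ t, ∀ᵐ x ∂(marg μ (i + 1)), D (head x) t ≠ 0 → hZero p g x t ≠ 0 ∧ hZero p g x t ≠ ∞ := by
  filter_upwards [(jointSol_iff hp hν hi hD hg).1 hs, isProbabilityMeasure_fiberLaw hD,
    hD.lintegral_head] with t h1 h2 h3
  have hmt := hD.measurable_left t
  rcases (hν.fm_nonneg t).eq_or_lt with h0 | h0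
  · rw [← h0, ENNReal.ofReal_zero, lintegral_eq_zero_iff (by fun_prop)] at h3
    filter_upwards [h3] with x hx hx'
    exact absurd hx hx'
  · have := h2 h0
    have h4 := (h1 h0).norm_ne (hp.measurable_pm_join hi t) (by fun_prop) (hν.lintegral_div hi h0)
    rw [fiberLaw, ae_withDensity_iff (by fun_prop)] at h4
    filter_upwards [h4] with x hx hx'
    exact hx (mul_ne_zero (ENNReal.inv_ne_zero.2 ENNReal.ofReal_ne_top) hx')

/-- The density of the next coupling. -/
noncomputable def nextDensity (p : E d k₀ → E d k₀ → ℝ) (D : E d i → E d i → ℝ≥0∞)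
    (g : E d (i + 1) → ℝ≥0) (x y : E d (i + 1)) : ℝ≥0∞ :=
  D (head x) (head y) * (g y * ENNReal.ofReal (pm p (i + 1) x y) / hZero p g x (head y))

lemma nextDensity_eq (x y : E d (i + 1)) : nextDensity p D g x y =
    g y * (D (head x) (head y) * (ENNReal.ofReal (pm p (i + 1) x y) / hZero p g x (head y))) := by
  rw [nextDensity, mul_div_assoc, ← mul_assoc, ← mul_assoc, mul_comm (D _ _)]

omit [IsProbabilityMeasure μ] in
include hp hi hD hg in
lemma measurable_nextDensity :
    Measurable fun q : E d (i + 1) × E d (i + 1) => nextDensity p D g q.1 q.2 := by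
  have := measurable_joint_integrand hp hi hD hg
  simp only [nextDensity_eq]
  fun_prop

-- The last block integrates g p to the normalising factor, which cancels where D is nonzero;
-- elsewhere both sides vanish.
include hp hν hi hD hg in
lemma lintegral_nextDensity_join (hs : JointSol p μ f D g) :
    ∀ᵐ t, ∀ᵐ x ∂(marg μ (i + 1)), ∫⁻ z, nextDensity p D g x (join t z) = D (head x) t := by
  filter_upwards [hZero_ne hp hν hi hD hg hs] with t ht
  filter_upwards [ht] with x hx
  have hm : Measurable fun z => (g (join t z) : ℝ≥0∞) * ENNReal.ofReal (pm p (i + 1) x (join t z)) := by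
    have : Measurable fun z => ENNReal.ofReal (pm p (i + 1) x (join t z)) :=
      (hp.measurable_pm_join hi t).comp measurable_prodMk_left
    fun_prop
  simp only [nextDensity, head_join, div_eq_mul_inv]
  rw [lintegral_const_mul _ (by fun_prop), lintegral_mul_const _ hm]
  by_cases h0 : D (head x) t = 0
  · simp [h0]
  · change _ * (hZero p g x t * _) = _
    rw [ENNReal.mul_inv_cancel (hx h0).1 (hx h0).2, mul_one]

include hp hν hi hD hg in
lemma ae_lintegral_nextDensity_join (hs : JointSol p μ f D g) :
    ∀ᵐ q ∂((marg μ (i + 1)).prod (volume : Measure (E d i))),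
      ∫⁻ z, nextDensity p D g q.1 (join q.2 z) = D (head q.1) q.2 := by
  have hm : Measurable fun q : E d (i + 1) × E d i => ∫⁻ z, nextDensity p D g q.1 (join q.2 z) :=
    Measurable.lintegral_prod_right' (f := fun q : (E d (i + 1) × E d i) × B d (i + 1) =>
      nextDensity p D g q.1.1 (join q.1.2 q.2)) ((measurable_nextDensity hp hi hD hg).comp
        (by fun_prop : Measurable fun q : (E d (i + 1) × E d i) × B d (i + 1) =>
          (q.1.1, join q.1.2 q.2)))
  have hm2 : Measurable fun q : E d (i + 1) × E d i => D (head q.1) q.2 :=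
    hD.meas.comp (by fun_prop : Measurable fun q : E d (i + 1) × E d i => (head q.1, q.2))
  rw [Measure.ae_prod_iff_ae_ae (measurableSet_eq_fun hm hm2), Measure.ae_ae_comm]
  · exact lintegral_nextDensity_join hp hν hi hD hg hs
  · exact measurableSet_eq_fun hm hm2

-- The second marginal is the functional equation itself; the first follows by integrating out the
-- last block, which brings back D.
include hp hν hi hD hg in
lemma isCouplingDensity_nextDensity (hs : JointSol p μ f D g) :
    IsCouplingDensity μ f (i + 1) (nextDensity p D g) := by
  refine ⟨measurable_nextDensity hp hi hD hg, ?_, ?_⟩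
  · filter_upwards [hs] with y hy
    simp only [nextDensity_eq]
    rw [lintegral_const_mul' _ _ ENNReal.coe_ne_top, hy, dualFactor]
  · have h1 : ∀ᵐ x ∂(marg μ (i + 1)), ∫⁻ t, D (head x) t = 1 := by
      have := hD.fst
      rw [← marg_map_head] at this
      exact ae_of_ae_map measurable_head.aemeasurable this
    filter_upwards [h1, Measure.ae_ae_of_ae_prod (ae_lintegral_nextDensity_join hp hν hi hD hg hs)]
      with x hx hx2
    rw [lintegral_join (g := fun y => nextDensity p D g x y)
      ((measurable_nextDensity hp hi hD hg).comp measurable_prodMk_left),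
      lintegral_congr_ae hx2, hx]

end

end Density

end CondSchrodinger

/-! ### The recursive construction -/

namespace CondSchrodinger

open Filter Topology Set ProbabilityTheory

section Step

variable {d : ℕ → ℕ} {k₀ i : ℕ} {p : E d k₀ → E d k₀ → ℝ} {μ ν : Measure (E d k₀)}
  {f : E d k₀ → ℝ} {D : E d i → E d i → ℝ≥0∞} {g : E d (i + 1) → ℝ≥0} {h : ∀ i, E d i → ℝ≥0}

lemma prodDensity_zero (x y : E d 0) : prodDensity p h 0 x y = 1 := by
  simp [prodDensity]

lemma prodDensity_succ (i : ℕ) :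
    prodDensity p h (i + 1) = nextDensity p (prodDensity p h i) (h (i + 1)) := by
  ext x y
  rw [prodDensity, Finset.prod_range_succ, nextDensity, prodDensity]
  congr 1
  · refine Finset.prod_congr rfl fun j hj => ?_
    have hj' : j + 1 ≤ i := Finset.mem_range.1 hj
    rw [coords_head (nn_mono hj'), coords_head (nn_mono hj'),
      coords_head (nn_mono (Nat.le_of_succ_le hj'))]
  · rw [coords_self, coords_self, head_eq_coords]

variable [IsProbabilityMeasure μ] [IsProbabilityMeasure ν]

/-- Existence of a solution of the conditional functional equations. -/
lemma exists_fiberSol (hp : A0 p) (hν : A1 ν f) (hi : i + 1 ≤ k₀)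
    (hD : IsCouplingDensity μ f i D) :
    ∃ g : E d (i + 1) → ℝ≥0, Measurable g ∧
      (∀ t : E d i, Continuous fun z : B d (i + 1) => g (join t z)) ∧ JointSol p μ f D g := by
  obtain ⟨ψ, hψ, hconv⟩ := hp.convex i hi
  have hfm := hν.measurable_ofReal_fm (Nat.le_of_succ_le hi)
  have hfc := hν.continuous_fm (Nat.le_of_succ_le hi)
  have hfc' := hν.continuous_fm hi
  -- Weighting the parameter by ν_i makes its law a probability measure and discards the points with
  -- f_{ν_i}(t) = 0, where there is nothing to solve.
  have hae : ∀ {q : E d i → Prop}, (∀ᵐ t ∂(marg ν i), q t) ↔ ∀ᵐ t, 0 < fm f i t → q t := by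
    intro q
    rw [hν.marg_eq (Nat.le_of_succ_le hi), ae_withDensity_iff hfm]
    simp
  have hwm : Measurable (Function.uncurry fun (t : E d i) (x : E d (i + 1)) =>
      (ENNReal.ofReal (fm f i t))⁻¹ * D (head x) t) := by
    have h1 : Measurable fun q : E d i × E d (i + 1) => D (head q.2) q.1 :=
      hD.meas.comp (by fun_prop : Measurable fun q : E d i × E d (i + 1) => (head q.2, q.1))
    exact (hfm.comp measurable_fst).inv.mul h1
  obtain ⟨g, hgm, hgc, hgs⟩ := exists_continuous_solution (τ := marg ν i) (mX := marg μ (i + 1))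
    (w := fun t x => (ENNReal.ofReal (fm f i t))⁻¹ * D (head x) t)
    (F := fun t y => fm f (i + 1) (join t y) / fm f i t)
    (k := fun t x y => pm p (i + 1) x (join t y)) (ψ := ψ) hwm
    (hae.2 <| (isProbabilityMeasure_fiberLaw hD).mono fun t ht hpos => by
      have := (ht hpos).measure_univ
      rwa [fiberLaw, withDensity_apply _ .univ, Measure.restrict_univ] at this)
    (by
      have : Measurable fun q : E d i × B d (i + 1) => fm f (i + 1) (join q.1 q.2) / fm f i q.1 := by
        have h1 := hfc.measurable
        have h2 := hfc'.measurable
        fun_prop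
      exact this)
    (fun t => by fun_prop)
    (fun t y => div_nonneg (hν.fm_nonneg _) (hν.fm_nonneg _))
    (hae.2 <| Eventually.of_forall fun t hpos => hν.lintegral_div hi hpos)
    ((hp.continuous_pm (Nat.le_add_left 1 i) hi).comp
      (by fun_prop : Continuous fun q : E d i × E d (i + 1) × B d (i + 1) =>
        (q.2.1, join q.1 q.2.2)))
    (fun t x y => hp.pm_pos (Nat.le_add_left 1 i) hi _ _) hψ (fun t x => hconv x t)
  have hgm' : Measurable fun y : E d (i + 1) => g (head y) (lastBlock y) :=
    hgm.comp (by fun_prop : Measurable fun y : E d (i + 1) => (head y, lastBlock y))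
  refine ⟨fun y => g (head y) (lastBlock y), hgm', fun t => ?_, ?_⟩
  · simpa only [head_join, lastBlock_join] using hgc t
  · rw [jointSol_iff hp hν hi hD hgm', ← hae]
    filter_upwards [hgs] with t ht
    simpa only [FiberSol, fiberLaw, head_join, lastBlock_join] using ht

lemma lintegral_E_zero (t : E d 0) (F : E d 0 → ℝ≥0∞) : ∫⁻ s, F s = F t := by
  have := isEmpty_fin_nn_zero (d := d)
  rw [lintegral_unique, volume_pi, Measure.pi_of_empty, Measure.dirac_apply_of_mem (mem_univ _),
    mul_one]
  exact congrArg F (Subsingleton.elim _ _)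

lemma isCouplingDensity_one (hν : A1 ν f) :
    IsCouplingDensity μ f 0 (fun _ _ => 1) where
  meas := measurable_const
  snd := Eventually.of_forall fun t => by simp [hν.fm_zero]
  fst := Eventually.of_forall fun t => lintegral_E_zero t _

omit [IsProbabilityMeasure μ] in
lemma A0.hZero_zero (hp : A0 p) (h1 : 1 ≤ k₀) {g : E d 1 → ℝ≥0} (hg : Measurable g) (x : E d 1)
    (t : E d 0) :
    hZero p g x t = ∫⁻ z : E d 1, (g z : ℝ≥0∞) * ENNReal.ofReal (pm p 1 x z) := by
  have hm : Measurable fun z : E d 1 => (g z : ℝ≥0∞) * ENNReal.ofReal (pm p 1 x z) := by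
    have : Measurable fun z : E d 1 => ENNReal.ofReal (pm p 1 x z) :=
      (hp.measurable_pm (i := 0) h1).comp measurable_prodMk_left
    exact hg.coe_nnreal_ennreal.mul this
  rw [lintegral_join (i := 0) hm, lintegral_E_zero t]
  rfl

/-- Over the one-point space ℝ^{n_0}, with D = 1, the conditional equation is the equation for the
first block. Equality of measures becomes equality almost everywhere because f_{ν_1} is integrable.
-/
lemma sfe_iff_jointSol (hp : A0 p) (hν : A1 ν f) (h1 : 1 ≤ k₀) {g : E d 1 → ℝ≥0}
    (hg : Measurable g) :
    SFE₁ p μ f g ↔ JointSol (i := 0) p μ f (fun _ _ => 1) g := by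
  have hD : IsCouplingDensity μ f 0 fun _ _ => 1 := isCouplingDensity_one hν
  have hm := measurable_dualFactor (i := 0) hp h1 hD hg
  have heq : ∀ y : E d 1, dualFactor (i := 0) p μ (fun _ _ => 1) g y =
      ∫⁻ x, ENNReal.ofReal (pm p 1 x y) /
        (∫⁻ z : E d 1, (g z : ℝ≥0∞) * ENNReal.ofReal (pm p 1 x z)) ∂(marg μ 1) := fun y => by
    refine lintegral_congr fun x => ?_
    rw [hp.hZero_zero h1 hg, one_mul]
  have hfin : ∫⁻ y : E d 1, ENNReal.ofReal (fm f 1 y) ≠ ∞ := by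
    rw [← setLIntegral_univ, ← withDensity_apply _ .univ, ← hν.marg_eq h1]
    exact measure_ne_top _ _
  unfold SFE₁ JointSol
  simp only [← heq]
  exact withDensity_eq_iff (hν.measurable_ofReal_fm h1).aemeasurable
    (hg.coe_nnreal_ennreal.mul hm).aemeasurable hfin

lemma piMeas_one (hp : A0 p) (h1 : 1 ≤ k₀) (hh : Measurable (h 1)) :
    piMeas p μ h 1 = ((marg μ 1).prod volume).withDensity fun q => prodDensity p h 1 q.1 q.2 := by
  unfold piMeas
  refine withDensity_congr_ae (Eventually.of_forall fun q => ?_)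
  have h2 : prodDensity p h 1 q.1 q.2 = prodDensity p h 0 (head q.1) (head q.2) *
      (h 1 q.2 * ENNReal.ofReal (pm p 1 q.1 q.2) / hZero p (i := 0) (h 1) q.1 (head q.2)) := by
    rw [prodDensity_succ 0]
    rfl
  beta_reduce
  rw [h2, prodDensity_zero, one_mul, hp.hZero_zero h1 hh]
  simp only [div_eq_mul_inv]
  ring

omit [IsProbabilityMeasure μ] in
lemma prod_withDensity_map_join {A : Type*} [MeasurableSpace A] {m : Measure A} [SFinite m]
    {w : A × E d i → ℝ≥0∞} {c : (A × E d i) × B d (i + 1) → ℝ≥0∞} (hw : Measurable w)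
    (hc : Measurable c) :
    ((((m.prod volume).withDensity w).prod (volume : Measure (B d (i + 1)))).withDensity c).map
      (fun q => (q.1.1, join q.1.2 q.2)) =
    (m.prod volume).withDensity fun q => w (q.1, head q.2) * c ((q.1, head q.2), lastBlock q.2) := by
  have hm : Measurable fun q : A × E d (i + 1) =>
      w (q.1, head q.2) * c ((q.1, head q.2), lastBlock q.2) := by fun_prop
  refine Measure.ext_of_lintegral _ fun F hF => ?_
  have hF' : Measurable fun q : (A × E d i) × B d (i + 1) => F (q.1.1, join q.1.2 q.2) := by
    fun_prop
  have hcF : Measurable fun q : (A × E d i) × B d (i + 1) => c q * F (q.1.1, join q.1.2 q.2) :=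
    hc.mul hF'
  have hI : Measurable fun a : A × E d i => ∫⁻ z, c (a, z) * F (a.1, join a.2 z) :=
    Measurable.lintegral_prod_right' hcF
  have hwI : Measurable fun a : A × E d i => w a * ∫⁻ z, c (a, z) * F (a.1, join a.2 z) :=
    hw.mul hI
  have hmF : Measurable fun q : A × E d (i + 1) =>
      w (q.1, head q.2) * c ((q.1, head q.2), lastBlock q.2) * F q := hm.mul hF
  rw [lintegral_map hF (by fun_prop), lintegral_withDensity_eq_lintegral_mul _ hc hF',
    lintegral_withDensity_eq_lintegral_mul _ hm hF]
  simp only [Pi.mul_apply]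
  rw [lintegral_prod _ hcF.aemeasurable, lintegral_withDensity_eq_lintegral_mul _ hw hI]
  simp only [Pi.mul_apply]
  rw [lintegral_prod _ hwI.aemeasurable, lintegral_prod _ hmF.aemeasurable]
  refine lintegral_congr fun x => ?_
  have hmx : Measurable fun y => w (x, head y) * c ((x, head y), lastBlock y) * F (x, y) := by
    fun_prop
  rw [lintegral_join hmx]
  refine lintegral_congr fun t => ?_
  simp only [head_join, lastBlock_join, mul_assoc]
  have hmz : Measurable fun z => c ((x, t), z) * F (x, join t z) := by fun_prop
  rw [lintegral_const_mul _ hmz]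

section Reference

variable (hp : A0 p) (hν : A1 ν f) (h1 : 1 ≤ i) (hi : i + 1 ≤ k₀) (hD : IsCouplingDensity μ f i D)
  (hg : Measurable g)

include hp h1 hi hD

omit [IsProbabilityMeasure μ] in
lemma measurable_head_mul_pCond :
    Measurable fun q : E d (i + 1) × E d (i + 1) =>
      D (head q.1) (head q.2) * pCond p i q.1 (lastBlock q.2) (head q.2) := by
  have hm1 : Measurable fun q : E d (i + 1) × E d (i + 1) => D (head q.1) (head q.2) :=
    hD.meas.comp (by fun_prop : Measurable fun q : E d (i + 1) × E d (i + 1) =>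
      (head q.1, head q.2))
  have hm2 := (hp.measurable_pCond h1 hi).comp
    (by fun_prop : Measurable fun q : E d (i + 1) × E d (i + 1) =>
      ((q.1, head q.2), lastBlock q.2))
  exact hm1.mul hm2

lemma refMeas_eq :
    refMeas p μ (((marg μ i).prod volume).withDensity fun q => D q.1 q.2) =
      ((marg μ (i + 1)).prod volume).withDensity fun q =>
        D (head q.1) (head q.2) * pCond p i q.1 (lastBlock q.2) (head q.2) := by
  have hDm : Measurable fun q : E d (i + 1) × E d i => D (head q.1) q.2 :=
    hD.meas.comp (by fun_prop : Measurable fun q : E d (i + 1) × E d i => (head q.1, q.2))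
  rw [refMeas, otimes_withDensity hD.meas]
  exact prod_withDensity_map_join hDm (hp.measurable_pCond h1 hi)

/-- The conditional kernel and, for almost every x', the density D(x', ·) integrate to 1. The
entropy comparison requires this finiteness. -/
lemma isFiniteMeasure_refMeas :
    IsFiniteMeasure (refMeas p μ (((marg μ i).prod volume).withDensity fun q => D q.1 q.2)) := by
  have hm := measurable_head_mul_pCond hp h1 hi hD
  refine ⟨?_⟩
  rw [refMeas_eq hp h1 hi hD, withDensity_apply _ .univ, Measure.restrict_univ,
    lintegral_prod _ hm.aemeasurable]
  have key : ∀ᵐ x ∂(marg μ (i + 1)), ∫⁻ y, D (head x) (head y) *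
      pCond p i x (lastBlock y) (head y) = 1 := by
    have h2 : ∀ᵐ x ∂(marg μ (i + 1)), ∫⁻ t, D (head x) t = 1 := by
      have := hD.fst
      rw [← marg_map_head] at this
      exact ae_of_ae_map measurable_head.aemeasurable this
    filter_upwards [h2] with x hx
    have hmx := hm.comp (measurable_prodMk_left (x := x))
    simp only [Function.comp_def] at hmx
    rw [lintegral_join hmx, ← hx]
    refine lintegral_congr fun t => ?_
    simp only [head_join, lastBlock_join]
    have := (hp.measurable_pCond h1 hi).comp (measurable_prodMk_left (x := (x, t)))
    simp only [Function.comp_def] at this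
    rw [lintegral_const_mul _ this, hp.lintegral_pCond h1 hi, mul_one]
  rw [lintegral_congr_ae key]
  simp

include hg

/-- One inductive step of `piMeas` in density form: the conditional kernel over its normalisation is
p_{i+1} over `hZero`. -/
lemma refMeas_withDensity :
    (refMeas p μ (((marg μ i).prod volume).withDensity fun q => D q.1 q.2)).withDensity
      (fun q => (g q.2 : ℝ≥0∞) / condNorm p g q.1 (head q.2)) =
    ((marg μ (i + 1)).prod volume).withDensity fun q => nextDensity p D g q.1 q.2 := by
  have hn : Measurable fun q : E d (i + 1) × E d (i + 1) => condNorm p g q.1 (head q.2) :=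
    (hp.measurable_condNorm h1 hi hg).comp (by fun_prop : Measurable
      fun q : E d (i + 1) × E d (i + 1) => (q.1, head q.2))
  rw [refMeas_eq hp h1 hi hD, ← withDensity_mul _ (measurable_head_mul_pCond hp h1 hi hD)
    (by fun_prop)]
  refine withDensity_congr_ae (Eventually.of_forall fun q => ?_)
  have key := hp.pCond_div_condNorm (g := g) h1 hi q.1 (lastBlock q.2) (head q.2)
  rw [join_head_lastBlock] at key
  simp only [Pi.mul_apply]
  rw [nextDensity_eq, ← key]
  simp only [div_eq_mul_inv]
  ring

end Reference

end Step

end CondSchrodinger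

/-! ### Properties of the solutions -/

namespace CondSchrodinger

open Filter Topology Set ProbabilityTheory

section Projections

variable {A C : Type*} [MeasurableSpace A] [MeasurableSpace C] {m : Measure A} {n : Measure C}
  [SFinite m] [SFinite n] {W : A × C → ℝ≥0∞}

lemma map_snd_prod_withDensity (hW : Measurable W) :
    ((m.prod n).withDensity W).map Prod.snd = n.withDensity fun y => ∫⁻ x, W (x, y) ∂m := by
  refine Measure.ext_of_lintegral _ fun F hF => ?_
  have hm : Measurable fun y => ∫⁻ x, W (x, y) ∂m := Measurable.lintegral_prod_left' hW
  rw [lintegral_map hF measurable_snd, lintegral_withDensity_eq_lintegral_mul _ hW (by fun_prop),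
    lintegral_withDensity_eq_lintegral_mul _ hm hF]
  simp only [Pi.mul_apply]
  rw [lintegral_prod_symm _ (by fun_prop)]
  refine lintegral_congr fun y => ?_
  dsimp only
  rw [lintegral_mul_const _ (by fun_prop)]

omit [SFinite m] in
lemma map_fst_prod_withDensity (hW : Measurable W) :
    ((m.prod n).withDensity W).map Prod.fst = m.withDensity fun x => ∫⁻ y, W (x, y) ∂n := by
  refine Measure.ext_of_lintegral _ fun F hF => ?_
  have hm : Measurable fun x => ∫⁻ y, W (x, y) ∂n := Measurable.lintegral_prod_right' hW
  rw [lintegral_map hF measurable_fst, lintegral_withDensity_eq_lintegral_mul _ hW (by fun_prop),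
    lintegral_withDensity_eq_lintegral_mul _ hm hF]
  simp only [Pi.mul_apply]
  rw [lintegral_prod _ (by fun_prop)]
  refine lintegral_congr fun y => ?_
  dsimp only
  rw [lintegral_mul_const _ (by fun_prop)]

lemma map_head_prod_withDensity {d : ℕ → ℕ} {i : ℕ} {W : A × E d (i + 1) → ℝ≥0∞}
    (hW : Measurable W) :
    ((m.prod volume).withDensity W).map (fun q => (q.1, head q.2)) =
      (m.prod volume).withDensity fun q => ∫⁻ z, W (q.1, join q.2 z) := by
  refine Measure.ext_of_lintegral _ fun F hF => ?_
  have hm : Measurable fun q : A × E d i => ∫⁻ z, W (q.1, join q.2 z) :=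
    Measurable.lintegral_prod_right' (f := fun q : (A × E d i) × B d (i + 1) =>
      W (q.1.1, join q.1.2 q.2)) (by fun_prop)
  rw [lintegral_map hF (by fun_prop), lintegral_withDensity_eq_lintegral_mul _ hW (by fun_prop),
    lintegral_withDensity_eq_lintegral_mul _ hm hF]
  simp only [Pi.mul_apply]
  rw [lintegral_prod _ (by fun_prop), lintegral_prod _ (by fun_prop)]
  refine lintegral_congr fun x => ?_
  have hmx : Measurable fun y => W (x, y) * F (x, head y) := by fun_prop
  rw [lintegral_join hmx]
  refine lintegral_congr fun t => ?_
  simp only [head_join]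
  have : Measurable fun z => W (x, join t z) := by fun_prop
  rw [lintegral_mul_const _ this]

end Projections

/-! ### Homogeneity of the functional equation -/

section Scaling

variable {X Y : Type*} [MeasurableSpace X] [MeasurableSpace Y] {P : Measure X} {m : Measure Y}
  {f : Y → ℝ≥0∞} {k : X → Y → ℝ≥0∞} {h g : Y → ℝ≥0∞}

lemma IsSchrodingerSol.of_eq_const_mul (hs : IsSchrodingerSol P m f k h) {c : ℝ≥0∞} (hc0 : c ≠ 0)
    (hct : c ≠ ∞) (hg : ∀ᵐ y ∂m, g y = c * h y) : IsSchrodingerSol P m f k g := by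
  have hu : ∀ x, ∫⁻ z, g z * k x z ∂m = c * ∫⁻ z, h z * k x z ∂m := fun x => by
    rw [← lintegral_const_mul' _ _ hct]
    refine lintegral_congr_ae ?_
    filter_upwards [hg] with z hz
    rw [hz, mul_assoc]
  filter_upwards [hs, hg] with y hy hgy
  rw [hy, hgy]
  have : ∀ x, k x y / (∫⁻ z, g z * k x z ∂m) = c⁻¹ * (k x y / ∫⁻ z, h z * k x z ∂m) := fun x => by
    rw [hu, div_eq_mul_inv, ENNReal.mul_inv (Or.inl hc0) (Or.inl hct), div_eq_mul_inv]
    ring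
  simp only [this]
  rw [lintegral_const_mul' _ _ (ENNReal.inv_ne_top.2 hc0), mul_comm c, mul_assoc, ← mul_assoc c,
    ENNReal.mul_inv_cancel hc0 hct, one_mul]

end Scaling

section Conclusions

variable {d : ℕ → ℕ} {k₀ i : ℕ} {p : E d k₀ → E d k₀ → ℝ} {μ ν : Measure (E d k₀)}
  {f : E d k₀ → ℝ} {D : E d i → E d i → ℝ≥0∞} {g h : E d (i + 1) → ℝ≥0}
  [IsProbabilityMeasure μ] [IsProbabilityMeasure ν]

lemma A1.lintegral_fm (hν : A1 ν f) (hi : i ≤ k₀) : ∫⁻ y : E d i, ENNReal.ofReal (fm f i y) = 1 := by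
  rw [← setLIntegral_univ, ← withDensity_apply _ .univ, ← hν.marg_eq hi]
  exact measure_univ

/-- Uniqueness of the solution up to a positive measurable function of `y'`. -/
lemma jointSol_iff_exists_mul (hp : A0 p) (hν : A1 ν f) (hi : i + 1 ≤ k₀)
    (hD : IsCouplingDensity μ f i D) (hh : Measurable h) (hs : JointSol p μ f D h)
    (hg : Measurable g) :
    JointSol p μ f D g ↔ ∃ φ : E d i → ℝ≥0, Measurable φ ∧ (∀ t, 0 < φ t) ∧
      ∀ᵐ y : E d (i + 1), 0 < fm f i (head y) → g y = φ (head y) * h y := by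
  have hfm := (hν.continuous_fm (Nat.le_of_succ_le hi)).measurable
  have hfm' := (hν.continuous_fm hi).measurable
  have hs' := (jointSol_iff hp hν hi hD hh).1 hs
  constructor
  · intro gs
    have gs' := (jointSol_iff hp hν hi hD hg).1 gs
    -- Uniqueness gives a constant c for each t separately. Averaging g / h against the conditional
    -- target density recovers it as a measurable function of t.
    set φ₀ : E d i → ℝ≥0 := fun t => (∫⁻ z, (g (join t z) / h (join t z) : ℝ≥0) *
      ENNReal.ofReal (fm f (i + 1) (join t z) / fm f i t)).toNNReal with hφ₀
    have hφ₀m : Measurable φ₀ := by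
      refine Measurable.ennreal_toNNReal ?_
      exact Measurable.lintegral_prod_right' (f := fun q : E d i × B d (i + 1) =>
        ((g (join q.1 q.2) / h (join q.1 q.2) : ℝ≥0) : ℝ≥0∞) *
        ENNReal.ofReal (fm f (i + 1) (join q.1 q.2) / fm f i q.1)) (by fun_prop)
    -- The value 1 replaces 0 where the average is of no use, so that the factor is positive
    -- everywhere.
    have hφm : Measurable fun t => if φ₀ t = 0 then 1 else φ₀ t :=
      Measurable.ite (hφ₀m (measurableSet_singleton 0)) measurable_const hφ₀m
    refine ⟨fun t => if φ₀ t = 0 then 1 else φ₀ t, hφm, fun t => ?_, ?_⟩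
    · dsimp only
      split_ifs with h0
      · exact one_pos
      · exact pos_iff_ne_zero.2 h0
    have hset : MeasurableSet {y : E d (i + 1) | 0 < fm f i (head y) →
        g y = (if φ₀ (head y) = 0 then 1 else φ₀ (head y)) * h y} := by
      have m1 : MeasurableSet {y : E d (i + 1) | 0 < fm f i (head y)} :=
        measurableSet_lt measurable_const (hfm.comp measurable_head)
      have m2 : MeasurableSet {y : E d (i + 1) |
          g y = (if φ₀ (head y) = 0 then 1 else φ₀ (head y)) * h y} :=
        measurableSet_eq_fun hg ((hφm.comp measurable_head).mul hh)
      simp only [imp_iff_not_or]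
      exact m1.compl.union m2
    rw [ae_join_iff hset]
    filter_upwards [hs', gs', isProbabilityMeasure_fiberLaw hD] with t h1 h2 h3
    simp only [head_join]
    by_cases hpos : 0 < fm f i t
    swap
    · exact Eventually.of_forall fun _ h => absurd h hpos
    simp only [hpos, true_imp_iff]
    have := h3 hpos
    obtain ⟨c, hc, hcg⟩ := (h1 hpos).unique (h2 hpos) (hp.measurable_pm_join hi t)
      (fun x y => hp.ofReal_pm_ne_zero (Nat.le_add_left 1 i) hi _ _)
      (fun _ _ => ENNReal.ofReal_ne_top) (by fun_prop) (by fun_prop) (hν.lintegral_div hi hpos)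
    have hφt : φ₀ t = c := by
      have hI : ∫⁻ z, ((g (join t z) / h (join t z) : ℝ≥0) : ℝ≥0∞) *
          ENNReal.ofReal (fm f (i + 1) (join t z) / fm f i t) = c := by
        calc _ = ∫⁻ z, (c : ℝ≥0∞) * ENNReal.ofReal (fm f (i + 1) (join t z) / fm f i t) := by
              refine lintegral_congr_ae ?_
              filter_upwards [h1 hpos, hcg] with z hz1 hz2
              -- Where h vanishes the equation makes the target density vanish, so the convention
              -- for 0 / 0 does not matter.
              by_cases hz : h (join t z) = 0
              · rw [hz1, hz]
                simp
              · rw [hz2, mul_div_cancel_right₀ _ hz]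
          _ = c := by
              rw [lintegral_const_mul' _ _ ENNReal.coe_ne_top, hν.lintegral_div hi hpos, mul_one]
      simp only [hφ₀]
      rw [hI, ENNReal.toNNReal_coe]
    rw [hφt, if_neg hc.ne']
    exact hcg
  · rintro ⟨φ, -, hφ0, hφ⟩
    rw [jointSol_iff hp hν hi hD hg]
    filter_upwards [hs', ae_ae_of_ae_join hφ] with t h1 h2 hpos
    refine (h1 hpos).of_eq_const_mul (c := φ t) (by simpa using (hφ0 t).ne') ENNReal.coe_ne_top ?_
    filter_upwards [h2] with z hz
    rw [head_join] at hz
    rw [hz hpos, ENNReal.coe_mul]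

variable {H : ∀ i, E d i → ℝ≥0}

lemma piKerOtimes_eq (hD : IsCouplingDensity μ f i (prodDensity p H i)) (t : E d i) :
    piKerOtimes p μ f H i t = fiberLaw μ f (prodDensity p H i) t := by
  exact withDensity_compProd_condLast_map ((hD.measurable_left t).const_mul _)

lemma condSFE_of_fiberSol (hp : A0 p) (h1 : 1 ≤ i) (hi : i + 1 ≤ k₀)
    (hD : IsCouplingDensity μ f i (prodDensity p H i)) {t : E d i}
    (hs : FiberSol p μ f (prodDensity p H i) (H (i + 1)) t) : CondSFE p μ f H i t := by
  unfold CondSFE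
  simp only [hp.pCond_div_condNorm h1 hi, piKerOtimes_eq hD]
  exact withDensity_congr_ae hs

/-- The measure in (2) has density `dualFactor` in y once x is integrated out. Since f_{ν_{i+1}} is
integrable, equality of the measures is equality of the densities almost everywhere. -/
lemma funEq_iff_jointSol (hp : A0 p) (hν : A1 ν f) (h1 : 1 ≤ i) (hi : i + 1 ≤ k₀)
    (hD : IsCouplingDensity μ f i (prodDensity p H i))
    (hpi : piMeas p μ H i =
      ((marg μ i).prod volume).withDensity fun q => prodDensity p H i q.1 q.2)
    (hg : Measurable g) :
    FunEq p μ f H i g ↔ JointSol p μ f (prodDensity p H i) g := by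
  have hn : Measurable fun q : E d (i + 1) × E d (i + 1) => condNorm p g q.1 (head q.2) :=
    (hp.measurable_condNorm h1 hi hg).comp (by fun_prop : Measurable
      fun q : E d (i + 1) × E d (i + 1) => (q.1, head q.2))
  have hm := measurable_dualFactor hp hi hD hg
  have hW := measurable_joint_integrand hp hi hD hg
  have key : ((refMeas p μ (piMeas p μ H i)).withDensity fun q =>
      (condNorm p g q.1 (head q.2))⁻¹) = ((marg μ (i + 1)).prod volume).withDensity fun q =>
        prodDensity p H i (head q.1) (head q.2) *
          (ENNReal.ofReal (pm p (i + 1) q.1 q.2) / hZero p g q.1 (head q.2)) := by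
    rw [hpi, refMeas_eq hp h1 hi hD, ← withDensity_mul _ (measurable_head_mul_pCond hp h1 hi hD)
      (by fun_prop)]
    refine withDensity_congr_ae (Eventually.of_forall fun q => ?_)
    have key := hp.pCond_div_condNorm (g := g) h1 hi q.1 (lastBlock q.2) (head q.2)
    rw [join_head_lastBlock] at key
    simp only [Pi.mul_apply]
    rw [← key, mul_assoc, div_eq_mul_inv]
  rw [FunEq, key, map_snd_prod_withDensity hW]
  change _ = (volume.withDensity (dualFactor p μ (prodDensity p H i) g)).withDensity _ ↔ _
  rw [← withDensity_mul _ hm (by fun_prop), withDensity_eq_iff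
    (hν.measurable_ofReal_fm hi).aemeasurable (by fun_prop) (by simp [hν.lintegral_fm hi])]
  unfold JointSol EventuallyEq
  simp only [Pi.mul_apply, mul_comm]

/-- The measure with the next density has the required marginals. -/
lemma withDensity_nextDensity_mem (hp : A0 p) (hν : A1 ν f) (hi : i + 1 ≤ k₀)
    (hD : IsCouplingDensity μ f i D) (hg : Measurable g) (hs : JointSol p μ f D g) :
    (((marg μ (i + 1)).prod volume).withDensity fun q => nextDensity p D g q.1 q.2) ∈
      constrained μ ν (((marg μ i).prod volume).withDensity fun q => D q.1 q.2) := by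
  have hN := isCouplingDensity_nextDensity hp hν hi hD hg hs
  have hfst : (((marg μ (i + 1)).prod volume).withDensity
      fun q => nextDensity p D g q.1 q.2).map Prod.fst = marg μ (i + 1) := by
    rw [map_fst_prod_withDensity hN.meas, withDensity_congr_ae hN.fst, withDensity_const, one_smul]
  refine ⟨⟨⟨?_⟩, hfst, ?_⟩, ?_⟩
  · have := congrArg (fun m => m univ) hfst
    simpa only [Measure.map_apply measurable_fst MeasurableSet.univ, preimage_univ,
      measure_univ] using this
  · rw [map_snd_prod_withDensity hN.meas, withDensity_congr_ae hN.snd, hν.marg_eq hi]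
  · rw [map_head_prod_withDensity hN.meas, otimes_withDensity hD.meas]
    exact withDensity_congr_ae (ae_lintegral_nextDensity_join hp hν hi hD hg hs)

/-- The measure with the next density is the unique minimizer of the relative entropy. -/
lemma klDiv_nextDensity (hp : A0 p) (hν : A1 ν f) (h1 : 1 ≤ i) (hi : i + 1 ≤ k₀)
    (hD : IsCouplingDensity μ f i D) (hg : Measurable g) (hs : JointSol p μ f D g)
    {π : Measure (E d (i + 1) × E d (i + 1))}
    (hπ : π ∈ constrained μ ν (((marg μ i).prod volume).withDensity fun q => D q.1 q.2)) :
    klDiv (((marg μ (i + 1)).prod volume).withDensity fun q => nextDensity p D g q.1 q.2)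
        (refMeas p μ (((marg μ i).prod volume).withDensity fun q => D q.1 q.2)) ≤
      klDiv π (refMeas p μ (((marg μ i).prod volume).withDensity fun q => D q.1 q.2)) ∧
    (klDiv π (refMeas p μ (((marg μ i).prod volume).withDensity fun q => D q.1 q.2)) ≤
      klDiv (((marg μ (i + 1)).prod volume).withDensity fun q => nextDensity p D g q.1 q.2)
        (refMeas p μ (((marg μ i).prod volume).withDensity fun q => D q.1 q.2)) →
      klDiv π (refMeas p μ (((marg μ i).prod volume).withDensity fun q => D q.1 q.2)) ≠ ∞ →
      π = ((marg μ (i + 1)).prod volume).withDensity fun q => nextDensity p D g q.1 q.2) := by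
  have hmem := withDensity_nextDensity_mem hp hν hi hD hg hs
  have hfin := isFiniteMeasure_refMeas hp h1 hi hD
  have hn := hp.measurable_condNorm h1 hi hg
  rw [← refMeas_withDensity hp h1 hi hD hg] at hmem ⊢
  have hprob := hmem.1.1
  have hprob' := hπ.1.1
  -- The density g(y) / `condNorm`(x, y') splits along the maps to (x, y') and to y. Every
  -- competitor has the same image under the first by the constraint on π̃, and under the second by
  -- its marginal ν_{i+1}.
  exact klDiv_withDensity_mul_le
    (α := fun q : E d (i + 1) × E d (i + 1) => (q.1, head q.2)) (β := Prod.snd)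
    (a := fun q : E d (i + 1) × E d i => (condNorm p g q.1 q.2)⁻¹) (b := fun y => (g y : ℝ≥0∞))
    (by fun_prop) measurable_snd (by fun_prop) (by fun_prop)
    (fun z => by rw [div_eq_mul_inv, mul_comm]) (hπ.2.trans hmem.2.symm)
    (hπ.1.2.2.trans hmem.1.2.2.symm)

end Conclusions

end CondSchrodinger

/-! ### Successive choice of the potentials -/

namespace CondSchrodinger

section Recursion

variable {d : ℕ → ℕ} {k₀ : ℕ}

/-- The functions `h_i` and coupling densities built from a rule that selects `h_{i+1}` given the
density at level `i`. -/
noncomputable def potentials (p : E d k₀ → E d k₀ → ℝ)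
    (sel : ∀ i, (E d i → E d i → ℝ≥0∞) → E d (i + 1) → ℝ≥0) :
    ∀ i, (E d i → ℝ≥0) × (E d i → E d i → ℝ≥0∞)
  | 0 => (0, fun _ _ => 1)
  | i + 1 => (sel i (potentials p sel i).2, nextDensity p (potentials p sel i).2
      (sel i (potentials p sel i).2))

lemma prodDensity_potentials (p : E d k₀ → E d k₀ → ℝ)
    (sel : ∀ i, (E d i → E d i → ℝ≥0∞) → E d (i + 1) → ℝ≥0) (i : ℕ) :
    prodDensity p (fun j => (potentials p sel j).1) i = (potentials p sel i).2 := by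
  induction i with
  | zero =>
    ext x y
    exact prodDensity_zero x y
  | succ i ih =>
    rw [prodDensity_succ, ih]
    rfl

variable {p : E d k₀ → E d k₀ → ℝ} {μ ν : Measure (E d k₀)} {f : E d k₀ → ℝ}
  [IsProbabilityMeasure μ] [IsProbabilityMeasure ν]

/-- Successive choice of solutions of the conditional functional equations. -/
lemma exists_potentials (hp : A0 p) (hν : A1 ν f) (hk : 1 ≤ k₀) {h₁ : E d 1 → ℝ≥0}
    (hm : Measurable h₁) (hs : SFE₁ p μ f h₁) :
    ∃ h : ∀ i, E d i → ℝ≥0, h 1 = h₁ ∧ ∀ i, i + 1 ≤ k₀ →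
      IsCouplingDensity μ f i (prodDensity p h i) ∧ Measurable (h (i + 1)) ∧
      JointSol p μ f (prodDensity p h i) (h (i + 1)) ∧
      (1 ≤ i → ∀ t : E d i, Continuous fun z : B d (i + 1) => h (i + 1) (join t z)) := by
  -- With the value 0 when no equation is posed, the choice becomes a function of the density alone,
  -- and the recursion carries data without proofs.
  have hex : ∀ (i : ℕ) (D : E d i → E d i → ℝ≥0∞), ∃ g : E d (i + 1) → ℝ≥0, i + 1 ≤ k₀ →
      IsCouplingDensity μ f i D → Measurable g ∧
        (∀ t : E d i, Continuous fun z : B d (i + 1) => g (join t z)) ∧ JointSol p μ f D g := by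
    intro i D
    by_cases hi : i + 1 ≤ k₀ ∧ IsCouplingDensity μ f i D
    · obtain ⟨g, hg⟩ := exists_fiberSol hp hν hi.1 hi.2
      exact ⟨g, fun _ _ => hg⟩
    · exact ⟨0, fun h1 h2 => absurd ⟨h1, h2⟩ hi⟩
  choose sel hsel using hex
  -- The first rule returns the prescribed h₁ instead of a selected solution.
  set sel' : ∀ i, (E d i → E d i → ℝ≥0∞) → E d (i + 1) → ℝ≥0 := fun i =>
    match i with
    | 0 => fun _ => h₁
    | i + 1 => sel (i + 1) with hsel'
  refine ⟨fun j => (potentials p sel' j).1, rfl, ?_⟩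
  have key : ∀ i, i + 1 ≤ k₀ → IsCouplingDensity μ f i (potentials p sel' i).2 →
      Measurable (sel' i (potentials p sel' i).2) ∧
      JointSol p μ f (potentials p sel' i).2 (sel' i (potentials p sel' i).2) := by
    intro i hi hD
    match i with
    | 0 => exact ⟨hm, (sfe_iff_jointSol hp hν hk hm).1 hs⟩
    | i + 1 => exact ⟨(hsel (i + 1) _ hi hD).1, (hsel (i + 1) _ hi hD).2.2⟩
  have hcoup : ∀ i, i + 1 ≤ k₀ → IsCouplingDensity μ f i (potentials p sel' i).2 := by
    intro i
    induction i with
    | zero => exact fun _ => isCouplingDensity_one hν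
    | succ i ih =>
      intro hi
      have hi' : i + 1 ≤ k₀ := Nat.le_of_succ_le hi
      exact isCouplingDensity_nextDensity hp hν hi' (ih hi') (key i hi' (ih hi')).1
        (key i hi' (ih hi')).2
  intro i hi
  rw [prodDensity_potentials]
  refine ⟨hcoup i hi, (key i hi (hcoup i hi)).1, (key i hi (hcoup i hi)).2, fun h1 => ?_⟩
  match i, h1 with
  | i + 1, _ => exact (hsel (i + 1) _ hi (hcoup (i + 1) hi)).2.1

end Recursion

end CondSchrodinger

/-! ### The main theorem -/

theorem theorem2p1 (d : ℕ → ℕ) (k₀ : ℕ) (hk₀ : 2 ≤ k₀) (hd : ∀ i, 1 ≤ i → i ≤ k₀ → 1 ≤ d i)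
    (p : E d k₀ → E d k₀ → ℝ) (μ ν : Measure (E d k₀)) [IsProbabilityMeasure μ]
    [IsProbabilityMeasure ν] (f : E d k₀ → ℝ) (hA0 : A0 p) (hA1 : A1 ν f) :
    (∃ h₁ : E d 1 → ℝ≥0, Continuous h₁ ∧ SFE₁ p μ f h₁) ∧
    ∀ h₁ : E d 1 → ℝ≥0, Measurable h₁ → SFE₁ p μ f h₁ →
      ∃ h : ∀ i, E d i → ℝ≥0, h 1 = h₁ ∧
        ∀ i, 1 ≤ i → i + 1 ≤ k₀ →
          Measurable (h (i + 1)) ∧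
          (∀ᵐ y' ∂(volume.withDensity fun y' : E d i => ENNReal.ofReal (fm f i y')),
            CondSFE p μ f h i y') ∧
          (∀ y' : E d i, Continuous fun y'' : B d (i + 1) => h (i + 1) (join y' y'')) ∧
          FunEq p μ f h i (h (i + 1)) ∧
          (∀ g : E d (i + 1) → ℝ≥0, Measurable g →
            (FunEq p μ f h i g ↔
              ∃ φ : E d i → ℝ≥0, Measurable φ ∧ (∀ y', 0 < φ y') ∧
                ∀ᵐ y : E d (i + 1), 0 < fm f i (head y) → g y = φ (head y) * h (i + 1) y)) ∧
          piMeas p μ h (i + 1) =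
            ((marg μ (i + 1)).prod volume).withDensity
              (fun q => prodDensity p h (i + 1) q.1 q.2) ∧
          piMeas p μ h (i + 1) ∈ constrained μ ν (piMeas p μ h i) ∧
          (V p μ ν (piMeas p μ h i) ≠ ∞ →
            klDiv (piMeas p μ h (i + 1)) (refMeas p μ (piMeas p μ h i)) =
              V p μ ν (piMeas p μ h i) ∧
            ∀ π ∈ constrained μ ν (piMeas p μ h i),
              klDiv π (refMeas p μ (piMeas p μ h i)) = V p μ ν (piMeas p μ h i) →
                π = piMeas p μ h (i + 1)) := by
  have hk1 : 1 ≤ k₀ := by omega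
  refine ⟨?_, fun h₁ hm hs => ?_⟩
  · obtain ⟨g, hgm, hgc, hgs⟩ := exists_fiberSol (i := 0) (D := fun _ _ => 1) hA0 hA1 hk1
      (isCouplingDensity_one (μ := μ) hA1)
    refine ⟨g, ?_, (sfe_iff_jointSol hA0 hA1 hk1 hgm).2 hgs⟩
    have := isEmpty_fin_nn_zero (d := d)
    -- Over the one-point space, continuity in the only block is continuity of h₁ itself.
    have h0 : ∀ y : E d (0 + 1), g y = g (join (default : E d 0) (lastBlock y)) := fun y => by
      rw [Subsingleton.elim (default : E d 0) (head y), join_head_lastBlock]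
    have hc := (hgc default).comp continuous_lastBlock
    exact hc.congr fun y => (h0 y).symm
  · obtain ⟨h, hh1, hh⟩ := exists_potentials hA0 hA1 hk1 hm hs
    have hpi : ∀ i, 1 ≤ i → i ≤ k₀ → piMeas p μ h i =
        ((marg μ i).prod volume).withDensity fun q => prodDensity p h i q.1 q.2 := by
      intro i
      induction i with
      | zero => exact fun h => absurd h (by omega)
      | succ i ih =>
        intro _ hi
        match i with
        | 0 => exact piMeas_one hA0 hk1 (hh1 ▸ hm)
        | i + 1 =>
          obtain ⟨hD, hm', -, -⟩ := hh (i + 1) hi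
          rw [prodDensity_succ, ← refMeas_withDensity hA0 (Nat.le_add_left 1 i) hi hD hm',
            ← ih (Nat.le_add_left 1 i) (Nat.le_of_succ_le hi)]
          rfl
    refine ⟨h, hh1, fun i h1 hi => ?_⟩
    obtain ⟨hD, hm', hsol, hcont⟩ := hh i hi
    have hpi0 := hpi i h1 (Nat.le_of_succ_le hi)
    have hpi1 := hpi (i + 1) (Nat.le_add_left 1 i) hi
    have hfun : ∀ {g : E d (i + 1) → ℝ≥0}, Measurable g → _ := fun hg =>
      funEq_iff_jointSol hA0 hA1 h1 hi hD hpi0 hg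
    have hmem : piMeas p μ h (i + 1) ∈ constrained μ ν (piMeas p μ h i) := by
      rw [hpi1, hpi0, prodDensity_succ]
      exact withDensity_nextDensity_mem hA0 hA1 hi hD hm' hsol
    have hkl : ∀ π ∈ constrained μ ν (piMeas p μ h i),
        klDiv (piMeas p μ h (i + 1)) (refMeas p μ (piMeas p μ h i)) ≤
          klDiv π (refMeas p μ (piMeas p μ h i)) ∧
        (klDiv π (refMeas p μ (piMeas p μ h i)) ≤
          klDiv (piMeas p μ h (i + 1)) (refMeas p μ (piMeas p μ h i)) →
          klDiv π (refMeas p μ (piMeas p μ h i)) ≠ ∞ → π = piMeas p μ h (i + 1)) := by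
      rw [hpi1, hpi0, prodDensity_succ]
      exact fun π hπ => klDiv_nextDensity hA0 hA1 h1 hi hD hm' hsol hπ
    -- The infimum is attained at an element of the constraint set, so any minimiser has entropy at
    -- most that of `piMeas`, and the equality case applies.
    have hV : klDiv (piMeas p μ h (i + 1)) (refMeas p μ (piMeas p μ h i)) =
        V p μ ν (piMeas p μ h i) :=
      le_antisymm (le_iInf₂ fun π hπ => (hkl π hπ).1) (iInf₂_le _ hmem)
    refine ⟨hm', ?_, hcont h1, (hfun hm').2 hsol, fun g hg => ?_, hpi1, hmem, fun hfin => ⟨hV, ?_⟩⟩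
    · rw [ae_withDensity_iff (hA1.measurable_ofReal_fm (Nat.le_of_succ_le hi))]
      filter_upwards [(jointSol_iff hA0 hA1 hi hD hm').1 hsol] with t ht hpos
      exact condSFE_of_fiberSol hA0 h1 hi hD (ht (by simpa using hpos))
    · rw [hfun hg]
      exact jointSol_iff_exists_mul hA0 hA1 hi hD hm' hsol hg
    · intro π hπ hπV
      exact (hkl π hπ).2 (hπV.trans hV.symm).le (hπV ▸ hfin)
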